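/- Setting. Let $G_0$ be a finite graph with at least two edges which is strictly balanced, i.e. $\mu(G_1)/\nu(G_1)<\mu(G_0)/\nu(G_0)$ for every proper subgraph $G_1$ with at least one vertex, where $\nu$ and $\mu$ count vertices and edges. Let ${\cal E}$ be the set of proper subgraphs of $G_0$ with at least one edge, and put $$\chi=\max_{G_1\in{\cal E}}\frac{\nu(G_0)-\nu(G_1)}{\mu(G_0)-\mu(G_1)},\qquad x=x(n,p)=\max_{G_1\in{\cal E}}n^{\nu(G_0)-\nu(G_1)}p^{\mu(G_0)-\mu(G_1)}.$$ Consider either the $G_0$-clustering of $E(K_n)$, the smallest family ${\cal K}$ of edge sets that contains the edge set of every copy of $G_0$ and is closed under unions of two intersecting members, or the $G_0^*$-clustering, which is generated in the same way by the copies of $G_0$ and the single edges. Members of ${\cal K}$ are clusters, the type $\tau(Q)$ of a cluster $Q$ is the isomorphism class of the graph it induces, and ${\cal T}$ is the set of all types (over all $n$). For a type $t$, $\nu(t)$ and $\mu(t)$ are its numbers of vertices and edges, $|t|$ is the number of edge sets in $K_n$ of type $t$, and $\lambda_t=|t|p^{\mu(t)}$. For an edge set $H$ and a type $t$, $s_H(t)$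 is the number of maximal clusters of $H$ of type $t$. For real $\kappa$ let ${\cal S}=\{t\in{\cal T}:\nu(t)/\mu(t)\ge\kappa\}$ and let ${\cal F}$ be the set of non-negative integer functions on ${\cal S}$ (extended by $0$ to ${\cal T}$). Let ${\cal F}_{\cal S}={\cal F}_{\cal S}(n)$ be the set of $f\in{\cal F}$ such that, for all $t\in{\cal S}$, $f(t)\le 3\lambda_t$ if $\nu(t)/\mu(t)>\kappa$ and $f(t)\le\lambda_t\log n$ if $\nu(t)/\mu(t)=\kappa$. Put $\lambda_{\cal L}=\sup_{t\in{\cal T}\setminus{\cal S}}\lambda_t$. Say that $p=p(n)$ satisfies $(*)_\kappa$ if $p=n^{-\kappa+o(1)}$ as $n\to\infty$. For types $u,t$ and $h:{\cal T}\to\mathbb Z_{\ge0}$, and any fixed cluster $J$ of type $u$, let $$c(u,t,h)=\sum_{Q\in{\cal K},\,Q\subseteq J,\,\tau(Q)=t}\ \sum_{H\cup Q=J,\ s_H=h}p^{|Q\cap H|}(1-p)^{|J\setminus H|},$$ a polynomial in $p$. If $c(u,t,h)\neq0$ then $\lambda_u/\lambda_t$ is a polynomial in $n$ and $p$. For $\kappa>\chi$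 the set ${\cal S}$ is finite, and $\overline\gamma_t$, $t\in{\cal S}$, are the formal power series over $\mathbb R$ in $n$, $p$ and $g_v$ ($v\in{\cal S}$) with constant term $1$ determined by $$\overline\gamma_t=\frac1{c(t,t,{\bf 0})}\Bigl(1-\sum_{u\in{\cal S},\,h\in{\cal F},\,(u,h)\ne(t,{\bf 0})}\frac{\lambda_u}{\lambda_t}\,c(u,t,h)\,\overline\gamma_u\prod_{v\in{\cal S}}\Bigl(\frac{g_v}{\overline\gamma_v}\Bigr)^{h(v)}\Bigr)\qquad(t\in{\cal S}).$$ For a power series or polynomial $\psi$ in $n$, $p$, ${\bf g}$ and $f\in{\cal F}$, write $\psi(f)$ for its value at the given $n$, $p=p(n)$ and $g_v=f(v)/\lambda_v$. Corollary. There are formal power series $\xi_t$ ($t\in{\cal T}$) over $\mathbb R$ in $n$, $p$ and ${\bf g}=(g_u)_{u\in{\cal T}}$, independent of $\kappa$, and, for every $\epsilon>0$ and $t\in{\cal T}$, a truncation $\xi_{t,\epsilon}$ of $\xi_t$ to finitely many terms, such that the following hold. (a) For all $t\in{\cal T}$ and ${\bf i}\neq{\bf 0}$ (finitely supported), $[{\bf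 g}^{\bf i}]\xi_t=O(x)$, in the sense that every truncation of this series in $n$ and $p$ to finitely many terms is at most $Cx$ in absolute value for all sufficiently large $n$, whenever $p$ satisfies $(*)_\kappa$ with $\kappa>\chi$, where $C$ does not depend on $\kappa$ and $p$. (b) For all $t\in{\cal T}$ and all finitely supported ${\bf i}$, the coefficient $[{\bf g}^{\bf i}]\xi_t\in\mathbb R[[n,p]]$ is a multiple of $\prod_u p^{\mu(u)i_u}$. (c) For every $\epsilon>0$ there is a constant $C$ with the following properties. (c1) There is $\epsilon_1>0$ such that for all $\kappa\ge\chi+\epsilon$, all $p$ satisfying $(*)_\kappa$, all $\eta>0$ and all sufficiently large $n$: for all $t\in{\cal S}$ and $f\in{\cal F}_{\cal S}$ the series $\overline\gamma_t(f)$ converges absolutely and $$|\xi_{t,\epsilon}(f)-\overline\gamma_t(f)|\le C\,\frac{n^{-\epsilon_1}+n^{\eta}\lambda_{\cal L}}{\lambda_t}.$$ (c2) For every $\kappa\ge\chi+\epsilon$ there is $\overline\epsilon>0$ such that for all $p$ satisfying $(*)_\kappa$ and all sufficiently large $n$: for all $t\in{\cal S}$ and $f\in{\cal F}_{\cal S}$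 the series $\overline\gamma_t(f)$ converges absolutely and $$|\xi_{t,\epsilon}(f)-\overline\gamma_t(f)|\le C\,\frac{n^{-\overline\epsilon}}{\lambda_t}.$$ -/

import Mathlib

open Filter Topology

namespace SubgraphClusters

/-! ### The graph `G₀` -/

/-- The number of vertices of a subgraph of `G₀`. -/
noncomputable def subNu {V : Type*} {G₀ : SimpleGraph V} (G₁ : G₀.Subgraph) : ℕ :=
  G₁.verts.ncard

/-- The number of edges of a subgraph of `G₀`. -/
noncomputable def subMu {V : Type*} {G₀ : SimpleGraph V} (G₁ : G₀.Subgraph) : ℕ :=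
  G₁.edgeSet.ncard

/-- `G₀` is strictly balanced: every proper subgraph with at least one vertex is strictly less
dense than `G₀`. -/
def StrictlyBalanced {V : Type*} (G₀ : SimpleGraph V) : Prop :=
  ∀ G₁ : G₀.Subgraph, G₁ ≠ ⊤ → G₁.verts.Nonempty →
    (subMu G₁ : ℝ) / subNu G₁ < (subMu (⊤ : G₀.Subgraph) : ℝ) / subNu (⊤ : G₀.Subgraph)

/-- The proper subgraphs of `G₀` which contain at least one edge. -/
def ProperSub {V : Type*} (G₀ : SimpleGraph V) : Type _ :=
  {G₁ : G₀.Subgraph // G₁ ≠ ⊤ ∧ G₁.edgeSet.Nonempty}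

/-- `χ(G₀)`, the maximum of `(ν(G₀) - ν(G₁)) / (μ(G₀) - μ(G₁))` over the proper subgraphs `G₁`
with at least one edge. -/
noncomputable def chi {V : Type*} (G₀ : SimpleGraph V) : ℝ :=
  ⨆ G₁ : ProperSub G₀,
    ((subNu (⊤ : G₀.Subgraph) : ℝ) - subNu G₁.1) / ((subMu (⊤ : G₀.Subgraph) : ℝ) - subMu G₁.1)

/-- The extension value `x(G₀, p, n)`, the maximum of `n ^ (ν(G₀) - ν(G₁)) * p ^ (μ(G₀) - μ(G₁))`
over the proper subgraphs `G₁` with at least one edge. -/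
noncomputable def extVal {V : Type*} (G₀ : SimpleGraph V) (n : ℕ) (p : ℝ) : ℝ :=
  ⨆ G₁ : ProperSub G₀,
    (n : ℝ) ^ (subNu (⊤ : G₀.Subgraph) - subNu G₁.1) *
      p ^ (subMu (⊤ : G₀.Subgraph) - subMu G₁.1)

/-- `p = n ^ (-κ + o(1))`. -/
def PKappa (κ : ℝ) (p : ℕ → ℝ) : Prop :=
  ∃ δ : ℕ → ℝ, Tendsto δ atTop (𝓝 0) ∧ ∀ᶠ n : ℕ in atTop, p n = (n : ℝ) ^ (-κ + δ n)

/-! ### Clusters and their types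

The complete graphs `K_n` are nested in the complete graph on `ℕ`: the edges of `K_n` are those
with both ends in `{0, …, n - 1}`. A set of edges of `K_n` is in the clustering of `K_n` generated
by a family of graphs if and only if it is in the clustering generated by them in the complete
graph on `ℕ`, so one family of clusters serves for all `n`. -/

/-- Edges of the complete graph on `ℕ`. -/
abbrev Edge : Type := {e : Sym2 ℕ // ¬ e.IsDiag}

/-- The edge set of `K_n`. -/
def Omega (n : ℕ) : Set Edge := {e | ∀ v ∈ e.1, v < n}

/-- The vertices covered by a set of edges. -/
def verts (H : Finset Edge) : Set ℕ := {v | ∃ e ∈ H, v ∈ e.1}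

/-- The graph induced by a set of edges. -/
def graph (H : Finset Edge) : SimpleGraph (verts H) :=
  (SimpleGraph.fromEdgeSet (Subtype.val '' (H : Set Edge))).induce (verts H)

/-- The members of the `G₀`-clustering (`star = false`) and of the `G₀*`-clustering
(`star = true`): the smallest family of edge sets which contains the edge set of every copy of
`G₀` (and, for `star = true`, every single edge) and which contains the union of any two of its
members whose intersection is not empty. -/
inductive IsCluster {V : Type*} (G₀ : SimpleGraph V) (star : Bool) : Finset Edge → Prop
  | copy (φ : V ↪ ℕ) (H : Finset Edge) (hH : ∀ e : Edge, e ∈ H ↔ e.1 ∈ Sym2.map φ '' G₀.edgeSet) :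
      IsCluster G₀ star H
  | edge (hs : star = true) (e : Edge) : IsCluster G₀ star {e}
  | union (H H' : Finset Edge) (h : IsCluster G₀ star H) (h' : IsCluster G₀ star H')
      (hne : (H ∩ H').Nonempty) : IsCluster G₀ star (H ∪ H')

/-- The clusters. -/
def Cluster {V : Type*} (G₀ : SimpleGraph V) (star : Bool) : Type :=
  {H : Finset Edge // IsCluster G₀ star H}

/-- Two clusters are equivalent if they induce isomorphic graphs. -/
instance clusterSetoid {V : Type*} (G₀ : SimpleGraph V) (star : Bool) :
    Setoid (Cluster G₀ star) where
  r Q Q' := Nonempty (graph Q.1 ≃g graph Q'.1)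
  iseqv :=
    { refl := fun _ => ⟨SimpleGraph.Iso.refl⟩
      symm := fun ⟨e⟩ => ⟨e.symm⟩
      trans := fun ⟨e⟩ ⟨e'⟩ => ⟨e.trans e'⟩ }

/-- The set of types of clusters. -/
def ClType {V : Type*} (G₀ : SimpleGraph V) (star : Bool) : Type :=
  Quotient (clusterSetoid G₀ star)

section
variable {V : Type*} {G₀ : SimpleGraph V} {star : Bool}

/-- The type of a cluster. -/
def tau (Q : Cluster G₀ star) : ClType G₀ star := Quotient.mk _ Q

/-- A cluster of type `t`. -/
noncomputable def rep (t : ClType G₀ star) : Cluster G₀ star := Quotient.out t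

/-- The number of vertices of the clusters of type `t`. -/
noncomputable def nu (t : ClType G₀ star) : ℕ := (verts (rep t).1).ncard

/-- The number of edges of the clusters of type `t`. -/
noncomputable def mu (t : ClType G₀ star) : ℕ := (rep t).1.card

/-- The number of automorphisms of the graphs of type `t`. -/
noncomputable def aut (t : ClType G₀ star) : ℕ :=
  Nat.card (graph (rep t).1 ≃g graph (rep t).1)

/-- `|t|`, the number of sets of edges of `K_n` which have type `t`. -/
noncomputable def numType (n : ℕ) (t : ClType G₀ star) : ℕ :=
  {Q : Cluster G₀ star | (∀ e ∈ Q.1, e ∈ Omega n) ∧ tau Q = t}.ncard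

/-- `λ_t = |t| p ^ μ(t)`. -/
noncomputable def lam (n : ℕ) (p : ℝ) (t : ClType G₀ star) : ℝ := numType n t * p ^ mu t

/-- The maximal clusters of a set `H` of edges. -/
def maxClusters (G₀ : SimpleGraph V) (star : Bool) (H : Finset Edge) : Set (Cluster G₀ star) :=
  {Q | Q.1 ⊆ H ∧ ∀ J : Cluster G₀ star, J.1 ⊆ H → Q.1 ⊆ J.1 → J = Q}

/-- `s_H(t)` is the number of maximal clusters of `H` of type `t`. -/
noncomputable def sFun (H : Finset Edge) (t : ClType G₀ star) : ℕ :=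
  {Q : Cluster G₀ star | Q ∈ maxClusters G₀ star H ∧ tau Q = t}.ncard

/-! ### Small types -/

/-- The set `𝓢` of small types, those with `ν(t) / μ(t) ≥ κ`. -/
def SmallTypes (G₀ : SimpleGraph V) (star : Bool) (κ : ℝ) : Set (ClType G₀ star) :=
  {t | κ ≤ (nu t : ℝ) / mu t}

/-- The set `𝓕` of non-negative integer functions on `𝓢`; they are extended by zero to all
types. -/
def Fun (G₀ : SimpleGraph V) (star : Bool) (κ : ℝ) : Set (ClType G₀ star → ℕ) :=
  {f | ∀ t, t ∉ SmallTypes G₀ star κ → f t = 0}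

open Classical in
/-- The bound `m_t`: `λ_t log n` if `ν(t) / μ(t) = κ`, and `3 λ_t` for the other small types. -/
noncomputable def mBound (κ : ℝ) (n : ℕ) (p : ℝ) (t : ClType G₀ star) : ℝ :=
  if (nu t : ℝ) / mu t = κ then lam n p t * Real.log n else 3 * lam n p t

/-- The set `𝓕_𝓢` of those `f ∈ 𝓕` with `f(t) ≤ m_t` for all `t ∈ 𝓢`. -/
def FunS (G₀ : SimpleGraph V) (star : Bool) (κ : ℝ) (n : ℕ) (p : ℝ) :
    Set (ClType G₀ star → ℕ) :=
  {f | f ∈ Fun G₀ star κ ∧ ∀ t ∈ SmallTypes G₀ star κ, (f t : ℝ) ≤ mBound κ n p t}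

/-- `λ_𝓛`, the supremum of `λ_t` over the types which are not small. -/
noncomputable def lamLarge (G₀ : SimpleGraph V) (star : Bool) (κ : ℝ) (n : ℕ) (p : ℝ) : ℝ :=
  ⨆ t : {t : ClType G₀ star // t ∉ SmallTypes G₀ star κ}, lam n p t.1

/-! ### Power series in `n`, `p` and the `g_t` -/

/-- The index set of the indeterminates: `inl 0` for `n`, `inl 1` for `p`, `inr t` for `g_t`. -/
abbrev Idx (G₀ : SimpleGraph V) (star : Bool) : Type := Fin 2 ⊕ ClType G₀ star

/-- Real power series in `n`, `p` and the `g_t`. -/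
abbrev Series (G₀ : SimpleGraph V) (star : Bool) : Type := MvPowerSeries (Idx G₀ star) ℝ

/-- The indeterminate `n`. -/
noncomputable def varN : Series G₀ star := MvPowerSeries.X (Sum.inl 0)

/-- The indeterminate `p`. -/
noncomputable def varP : Series G₀ star := MvPowerSeries.X (Sum.inl 1)

/-- The indeterminate `g_t`. -/
noncomputable def varG (t : ClType G₀ star) : Series G₀ star := MvPowerSeries.X (Sum.inr t)

open Classical in
/-- `c(u, t, h)` for `J` the chosen cluster of type `u`: the sum of
`p ^ |Q ∩ H| * (1 - p) ^ |J \ H|` over the clusters `Q ⊆ J` of type `t` and the sets `H` with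
`H ∪ Q = J` and `s_H = h`; a polynomial in the indeterminate `p`. -/
noncomputable def cSer (u t : ClType G₀ star) (h : ClType G₀ star → ℕ) : Series G₀ star :=
  ∑ᶠ Q ∈ {Q : Cluster G₀ star | Q.1 ⊆ (rep u).1 ∧ tau Q = t},
    ∑ H ∈ (rep u).1.powerset.filter (fun H => H ∪ Q.1 = (rep u).1 ∧ sFun H = h),
      varP ^ (Q.1 ∩ H).card * (1 - varP) ^ ((rep u).1 \ H).card

/-- `λ_u / λ_t` as a polynomial in the indeterminates `n` and `p`, for types such that every
cluster of type `u` contains one of type `t`. Recall that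
`|t| = n (n - 1) ⋯ (n - ν(t) + 1) / |aut t|`. -/
noncomputable def ratioSer (u t : ClType G₀ star) : Series G₀ star :=
  MvPowerSeries.C ((aut t : ℝ) / aut u) *
    (∏ j ∈ Finset.Ico (nu t) (nu u), (varN - MvPowerSeries.C (j : ℝ))) * varP ^ (mu u - mu t)

/-- The defining equations of the `\bar γ_t`, for `t ∈ 𝓢`:
`\bar γ_t = c(t,t,0)⁻¹ (1 - ∑ (λ_u / λ_t) c(u,t,h) \bar γ_u ∏_i (g_{t_i} / \bar γ_{t_i}))`,
the sum being over `u ∈ 𝓢` and `h ∈ 𝓕` with `(u, h) ≠ (t, 0)`, where `h = ∑_i δ_{t_i}`,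
and `\bar γ_t` has constant term `1`. -/
def IsGammaBar (G₀ : SimpleGraph V) (star : Bool) (κ : ℝ)
    (γ : ClType G₀ star → Series G₀ star) : Prop :=
  ∀ t ∈ SmallTypes G₀ star κ,
    MvPowerSeries.constantCoeff (γ t) = 1 ∧
    γ t = (cSer t t 0)⁻¹ *
      (1 - ∑ᶠ uh ∈ {uh : ClType G₀ star × (ClType G₀ star → ℕ) |
          uh.1 ∈ SmallTypes G₀ star κ ∧ uh.2 ∈ Fun G₀ star κ ∧ uh ≠ (t, 0)},
        ratioSer uh.1 t * cSer uh.1 t uh.2 * γ uh.1 *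
          ∏ᶠ v : ClType G₀ star, (varG v * (γ v)⁻¹) ^ uh.2 v)

/-- The power series `\bar γ_t`, `t ∈ 𝓢`: the unique solution of the defining equations. -/
noncomputable def gammaBar (G₀ : SimpleGraph V) (star : Bool) (κ : ℝ) :
    ClType G₀ star → Series G₀ star :=
  Classical.epsilon (IsGammaBar G₀ star κ)

/-- The coefficient of `g ^ i` in a power series in `n`, `p` and the `g_t`: a power series in `n`
(index `0`) and `p` (index `1`). -/
noncomputable def gCoeff (i : ClType G₀ star →₀ ℕ) (φ : Series G₀ star) :
    MvPowerSeries (Fin 2) ℝ :=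
  fun e => MvPowerSeries.coeff (Finsupp.sumElim e i) φ

/-- The values substituted for the indeterminates: `n`, `p`, and `f(t) / λ_t` for `g_t`. -/
noncomputable def point (n : ℕ) (p : ℝ) (f : ClType G₀ star → ℕ) : Idx G₀ star → ℝ :=
  Sum.elim ![(n : ℝ), p] (fun t => (f t : ℝ) / lam n p t)

end

/-- The truncation of a power series to the terms whose monomials are in a given finite set. -/
noncomputable def truncate {σ : Type*} (A : Finset (σ →₀ ℕ)) (φ : MvPowerSeries σ ℝ) :
    MvPolynomial σ ℝ :=
  ∑ m ∈ A, MvPolynomial.monomial m (MvPowerSeries.coeff m φ)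

/-- The value of the term of a power series with monomial `m`. -/
noncomputable def termValue {σ : Type*} (φ : MvPowerSeries σ ℝ) (a : σ → ℝ) (m : σ →₀ ℕ) : ℝ :=
  MvPowerSeries.coeff m φ * m.prod fun v k => a v ^ k

end SubgraphClusters

open SubgraphClusters

/-! Multiplied by c(t,t,0), whose constant term is 1, the defining equations become a polynomial
system γ_t = 1 - R_t(γ, δ), where δ_t = γ_t⁻¹ is encoded by δ_t = 1 + R_t δ_t. Every coefficient
K_{t,(u,h)} of R is divisible by p. For (u,h) = (t,0) it is c(t,t,0) - 1. For h = 0 and u ≠ t the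
ratio λ_u/λ_t supplies p^(μ(u)-μ(t)). For h ≠ 0 the set H contains disjoint clusters of the types
counted by h. So the right-hand sides are contractions for the filtration by degree in p, and facts
about solutions are proved by induction on that degree (`exists_isSol`, `IsSol.suppIn`,
`IsSol.exists_wnorm_le`).

Exponents: a cluster is built from any nonempty set of its edges by adding copies of G₀ which meet
what is already there, so (ν, μ) grows by an element of the monoid E = `extMonoid G₀`. If (a,b) is
in E then a ≤ χb, hence n^a p^b ≤ (n^χ p)^b; when n^χ p ≤ 1 and (a,b) ≠ 0, the monomial is also at
most x. All monomials of K, and therefore of the solutions, have their (n,p)-exponent in E and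
p-degree at least ∑ μ(v) i_v (`admissible_coefK`). This yields (a) and (b).

The series ξ: the system can be restricted to any finite set S of types, and S = 𝓢 gives \bar γ.
Enlarging S changes γ_t only in the monomials of `devSet`: those containing g_u for a new type u,
and those which, multiplied by n^ν(t) p^μ(t), become n^ν(u) p^μ(u) times a monomial from E, up to a
smaller power of n (`IsSol.suppIn_sub`). For monomials of the solutions both cases force μ(u) ≤ μ(t)
+ (p-degree), so each coefficient is eventually constant as S grows. The limit ξ_t does not involve
κ (`exists_xi`).

Error in (c): at the point given by f the first kind of monomial vanishes, since f(u) = 0 for u not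
in 𝓢. The second kind, multiplied by λ_t, is at most a power of log n times n^ν(u) p^μ(u) = O(λ_u)
with u not small. The tail of \bar γ_t is geometric: the absolute values of its coefficients,
weighted by r to the p-degree, have sum at most 2 for some r > 0, while its monomials are at most
q^(p-degree) with q = n^χ p log n ≤ n^(-ε/2). Truncation at a p-degree depending only on t and ε
makes the tail smaller than n^(-1)/λ_t (`exists_eventually_abs_sub_le`). -/

namespace SubgraphClusters

/-! ### Supports of power series -/

section Support
variable {σ : Type*}

/-- All monomials which occur in `φ` have their exponents in `B`. -/
def SuppIn (B : Set (σ →₀ ℕ)) (φ : MvPowerSeries σ ℝ) : Prop :=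
  ∀ m, MvPowerSeries.coeff m φ ≠ 0 → m ∈ B

lemma SuppIn.mono {A B : Set (σ →₀ ℕ)} {φ : MvPowerSeries σ ℝ} (h : SuppIn A φ) (hAB : A ⊆ B) :
    SuppIn B φ := fun _ hm => hAB (h _ hm)

lemma suppIn_zero (B : Set (σ →₀ ℕ)) : SuppIn B (0 : MvPowerSeries σ ℝ) :=
  fun _ hm => absurd (map_zero _) hm

lemma suppIn_univ (φ : MvPowerSeries σ ℝ) : SuppIn Set.univ φ := fun _ _ => trivial

lemma suppIn_monomial {B : Set (σ →₀ ℕ)} {m : σ →₀ ℕ} (a : ℝ) (h : m ∈ B) :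
    SuppIn B (MvPowerSeries.monomial m a) := by
  classical
  intro k hk
  rw [MvPowerSeries.coeff_monomial] at hk
  split_ifs at hk with h'
  · exact h' ▸ h
  · exact absurd rfl hk

lemma suppIn_C {B : Set (σ →₀ ℕ)} (a : ℝ) (h : 0 ∈ B) :
    SuppIn B (MvPowerSeries.C a) := suppIn_monomial a h

lemma suppIn_one {B : Set (σ →₀ ℕ)} (h : 0 ∈ B) : SuppIn B (1 : MvPowerSeries σ ℝ) :=
  suppIn_monomial 1 h

lemma suppIn_X {B : Set (σ →₀ ℕ)} (s : σ) (h : Finsupp.single s 1 ∈ B) :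
    SuppIn B (MvPowerSeries.X s : MvPowerSeries σ ℝ) := suppIn_monomial 1 h

lemma SuppIn.add {B : Set (σ →₀ ℕ)} {φ ψ : MvPowerSeries σ ℝ} (h : SuppIn B φ)
    (h' : SuppIn B ψ) : SuppIn B (φ + ψ) := by
  intro m hm
  by_contra hB
  have h1 : MvPowerSeries.coeff m φ = 0 := by_contra fun h0 => hB (h m h0)
  have h2 : MvPowerSeries.coeff m ψ = 0 := by_contra fun h0 => hB (h' m h0)
  exact hm (by rw [map_add, h1, h2, add_zero])

lemma suppIn_support (φ : MvPowerSeries σ ℝ) :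
    SuppIn {k | MvPowerSeries.coeff k φ ≠ 0} φ := fun _ h => h

lemma SuppIn.neg {B : Set (σ →₀ ℕ)} {φ : MvPowerSeries σ ℝ} (h : SuppIn B φ) :
    SuppIn B (-φ) := by
  intro m hm
  exact h m fun h0 => hm (by rw [map_neg, h0, neg_zero])

lemma SuppIn.sub {B : Set (σ →₀ ℕ)} {φ ψ : MvPowerSeries σ ℝ} (h : SuppIn B φ)
    (h' : SuppIn B ψ) : SuppIn B (φ - ψ) := sub_eq_add_neg φ ψ ▸ h.add h'.neg

lemma suppIn_sum {ι : Type*} {B : Set (σ →₀ ℕ)} (s : Finset ι) {φ : ι → MvPowerSeries σ ℝ}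
    (h : ∀ i ∈ s, SuppIn B (φ i)) : SuppIn B (∑ i ∈ s, φ i) := by
  classical
  induction s using Finset.induction_on with
  | empty => simpa using suppIn_zero B
  | insert a s ha ih =>
    rw [Finset.sum_insert ha]
    exact (h a (by simp)).add (ih fun i hi => h i (by simp [hi]))

lemma SuppIn.mul {A B C : Set (σ →₀ ℕ)} {φ ψ : MvPowerSeries σ ℝ} (h : SuppIn A φ)
    (h' : SuppIn B ψ)
    (hC : ∀ a b, MvPowerSeries.coeff a φ ≠ 0 → a ∈ A → b ∈ B → a + b ∈ C) :
    SuppIn C (φ * ψ) := by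
  classical
  intro m hm
  rw [MvPowerSeries.coeff_mul] at hm
  obtain ⟨x, hx, hx'⟩ := Finset.exists_ne_zero_of_sum_ne_zero hm
  rw [← Finset.HasAntidiagonal.mem_antidiagonal.1 hx]
  exact hC _ _ (left_ne_zero_of_mul hx') (h _ (left_ne_zero_of_mul hx'))
    (h' _ (right_ne_zero_of_mul hx'))

lemma SuppIn.mul_mem {M : AddSubmonoid (σ →₀ ℕ)} {φ ψ : MvPowerSeries σ ℝ}
    (h : SuppIn (M : Set (σ →₀ ℕ)) φ) (h' : SuppIn (M : Set (σ →₀ ℕ)) ψ) :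
    SuppIn (M : Set (σ →₀ ℕ)) (φ * ψ) :=
  h.mul h' fun _ _ _ ha hb => M.add_mem ha hb

lemma SuppIn.pow_mem {M : AddSubmonoid (σ →₀ ℕ)} {φ : MvPowerSeries σ ℝ}
    (h : SuppIn (M : Set (σ →₀ ℕ)) φ) (k : ℕ) : SuppIn (M : Set (σ →₀ ℕ)) (φ ^ k) := by
  induction k with
  | zero => simpa using suppIn_one M.zero_mem
  | succ k ih => rw [pow_succ]; exact ih.mul_mem h

lemma suppIn_prod {ι : Type*} {M : AddSubmonoid (σ →₀ ℕ)} (s : Finset ι)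
    {φ : ι → MvPowerSeries σ ℝ} (h : ∀ i ∈ s, SuppIn (M : Set (σ →₀ ℕ)) (φ i)) :
    SuppIn (M : Set (σ →₀ ℕ)) (∏ i ∈ s, φ i) := by
  classical
  induction s using Finset.induction_on with
  | empty => simpa using suppIn_one M.zero_mem
  | insert a s ha ih =>
    rw [Finset.prod_insert ha]
    exact (h a (by simp)).mul_mem (ih fun i hi => h i (by simp [hi]))

/-- Congruence of products modulo the series supported in an `M`-stable set `W`. -/
lemma suppIn_mul_sub {M W : Set (σ →₀ ℕ)} (hW : ∀ m ∈ M, ∀ w ∈ W, m + w ∈ W)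
    {φ φ' ψ ψ' : MvPowerSeries σ ℝ} (h1 : SuppIn M φ') (h2 : SuppIn M ψ)
    (h3 : SuppIn W (φ' - φ)) (h4 : SuppIn W (ψ' - ψ)) :
    SuppIn W (φ' * ψ' - φ * ψ) := by
  have : φ' * ψ' - φ * ψ = φ' * (ψ' - ψ) + ψ * (φ' - φ) := by ring
  rw [this]
  exact (h1.mul h4 fun a b _ ha hb => hW a ha b hb).add
    (h2.mul h3 fun a b _ ha hb => hW a ha b hb)

lemma suppIn_pow_sub {M : AddSubmonoid (σ →₀ ℕ)} {W : Set (σ →₀ ℕ)}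
    (hW : ∀ m ∈ M, ∀ w ∈ W, m + w ∈ W) {φ φ' : MvPowerSeries σ ℝ}
    (h1 : SuppIn (M : Set (σ →₀ ℕ)) φ') (h2 : SuppIn (M : Set (σ →₀ ℕ)) φ)
    (h3 : SuppIn W (φ' - φ)) (k : ℕ) : SuppIn W (φ' ^ k - φ ^ k) := by
  induction k with
  | zero => simpa using suppIn_zero W
  | succ k ih =>
    rw [pow_succ, pow_succ]
    exact suppIn_mul_sub (M := (M : Set (σ →₀ ℕ))) hW (h1.pow_mem k) h2 ih h3

lemma suppIn_prod_sub {ι : Type*} {M : AddSubmonoid (σ →₀ ℕ)} {W : Set (σ →₀ ℕ)}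
    (hW : ∀ m ∈ M, ∀ w ∈ W, m + w ∈ W) (s : Finset ι) {φ φ' : ι → MvPowerSeries σ ℝ}
    (h1 : ∀ i ∈ s, SuppIn (M : Set (σ →₀ ℕ)) (φ' i))
    (h2 : ∀ i ∈ s, SuppIn (M : Set (σ →₀ ℕ)) (φ i))
    (h3 : ∀ i ∈ s, SuppIn W (φ' i - φ i)) :
    SuppIn W (∏ i ∈ s, φ' i - ∏ i ∈ s, φ i) := by
  classical
  induction s using Finset.induction_on with
  | empty => simpa using suppIn_zero W
  | insert a s ha ih =>
    rw [Finset.prod_insert ha, Finset.prod_insert ha]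
    exact suppIn_mul_sub (M := (M : Set (σ →₀ ℕ))) hW (h1 a (by simp))
      (suppIn_prod s fun i hi => h2 i (by simp [hi])) (h3 a (by simp))
      (ih (fun i hi => h1 i (by simp [hi])) (fun i hi => h2 i (by simp [hi]))
        (fun i hi => h3 i (by simp [hi])))

/-- The exponents with degree at least `k` in the indeterminate `i`. -/
def degGE (i : σ) (k : ℕ) : Set (σ →₀ ℕ) := {m | k ≤ m i}

lemma mem_degGE {i : σ} {k : ℕ} {m : σ →₀ ℕ} : m ∈ degGE i k ↔ k ≤ m i := Iff.rfl

lemma add_mem_degGE_left {i : σ} {k : ℕ} {m : σ →₀ ℕ} (h : m ∈ degGE i k) (m' : σ →₀ ℕ) :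
    m + m' ∈ degGE i k := by
  rw [mem_degGE, Finsupp.add_apply] at *
  omega

lemma add_mem_degGE {i : σ} {k l : ℕ} {m m' : σ →₀ ℕ} (h : m ∈ degGE i k) (h' : m' ∈ degGE i l) :
    m + m' ∈ degGE i (k + l) := by
  rw [mem_degGE] at *
  rw [Finsupp.add_apply]
  omega

lemma mem_degGE_of_le {i : σ} {k l : ℕ} {m : σ →₀ ℕ} (h : m ∈ degGE i k) (hl : l ≤ k) :
    m ∈ degGE i l := le_trans hl h

lemma eq_zero_of_forall_degGE {i : σ} {φ : MvPowerSeries σ ℝ} (h : ∀ k, SuppIn (degGE i k) φ) :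
    φ = 0 := by
  ext m
  by_contra hm
  have := h (m i + 1) m hm
  simp [degGE] at this

end Support

/-! ### Weighted norms -/

section Norm
variable {σ : Type*}
open scoped ENNReal

/-- The sum of the absolute values of the coefficients, with weight `r` for the indeterminate `i`
and weight `1` for the others. -/
noncomputable def wnorm (i : σ) (r : ℝ≥0∞) (φ : MvPowerSeries σ ℝ) : ℝ≥0∞ :=
  ∑' m, ‖MvPowerSeries.coeff m φ‖ₑ * r ^ m i

variable (i : σ) (r : ℝ≥0∞)

lemma wnorm_add_le (φ ψ : MvPowerSeries σ ℝ) : wnorm i r (φ + ψ) ≤ wnorm i r φ + wnorm i r ψ := by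
  rw [wnorm, wnorm, wnorm, ← ENNReal.tsum_add]
  refine ENNReal.tsum_le_tsum fun m => ?_
  rw [map_add, ← add_mul]
  gcongr
  exact enorm_add_le _ _

lemma wnorm_neg (φ : MvPowerSeries σ ℝ) : wnorm i r (-φ) = wnorm i r φ := by
  simp [wnorm]

lemma wnorm_zero : wnorm i r (0 : MvPowerSeries σ ℝ) = 0 := by
  simp [wnorm]

lemma wnorm_sub_le (φ ψ : MvPowerSeries σ ℝ) : wnorm i r (φ - ψ) ≤ wnorm i r φ + wnorm i r ψ := by
  rw [sub_eq_add_neg, ← wnorm_neg i r ψ]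
  exact wnorm_add_le i r _ _

lemma wnorm_monomial (m : σ →₀ ℕ) (a : ℝ) :
    wnorm i r (MvPowerSeries.monomial m a) = ‖a‖ₑ * r ^ m i := by
  classical
  rw [wnorm, tsum_eq_single m]
  · simp
  · intro k hk
    simp [MvPowerSeries.coeff_monomial, hk]

lemma wnorm_one : wnorm i r (1 : MvPowerSeries σ ℝ) = 1 := by
  simpa using wnorm_monomial i r 0 1

lemma wnorm_mul_le (φ ψ : MvPowerSeries σ ℝ) :
    wnorm i r (φ * ψ) ≤ wnorm i r φ * wnorm i r ψ := by
  classical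
  -- Cauchy product: in `ℝ≥0∞` the double sum may be regrouped along antidiagonals without any
  -- summability condition.
  have key : wnorm i r φ * wnorm i r ψ = ∑' m : σ →₀ ℕ, ∑ x ∈ Finset.HasAntidiagonal.antidiagonal m,
      (‖MvPowerSeries.coeff x.1 φ‖ₑ * r ^ x.1 i) * (‖MvPowerSeries.coeff x.2 ψ‖ₑ * r ^ x.2 i) := by
    rw [wnorm, wnorm, ← ENNReal.tsum_mul_right]
    simp_rw [← ENNReal.tsum_mul_left]
    rw [← ENNReal.tsum_prod, ← Finset.HasAntidiagonal.sigmaAntidiagonalEquivProd.tsum_eq,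
      ENNReal.tsum_sigma']
    refine tsum_congr fun m => ?_
    rw [tsum_fintype, ← Finset.sum_coe_sort (Finset.HasAntidiagonal.antidiagonal m)]
    rfl
  rw [key]
  refine ENNReal.tsum_le_tsum fun m => ?_
  rw [MvPowerSeries.coeff_mul]
  refine (mul_le_mul_left (enorm_sum_le _ _) _).trans ?_
  rw [Finset.sum_mul]
  refine Finset.sum_le_sum fun x hx => ?_
  rw [enorm_mul, ← Finset.HasAntidiagonal.mem_antidiagonal.1 hx, Finsupp.add_apply, pow_add]
  exact le_of_eq (by ring)

lemma wnorm_sum_le {ι : Type*} (s : Finset ι) (φ : ι → MvPowerSeries σ ℝ) :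
    wnorm i r (∑ j ∈ s, φ j) ≤ ∑ j ∈ s, wnorm i r (φ j) := by
  classical
  induction s using Finset.induction_on with
  | empty => simp [wnorm_zero]
  | insert a s ha ih =>
    rw [Finset.sum_insert ha, Finset.sum_insert ha]
    exact (wnorm_add_le i r _ _).trans (by gcongr)

lemma wnorm_pow_le (φ : MvPowerSeries σ ℝ) (k : ℕ) : wnorm i r (φ ^ k) ≤ wnorm i r φ ^ k := by
  induction k with
  | zero => simp [wnorm_one]
  | succ k ih =>
    rw [pow_succ, pow_succ]
    exact (wnorm_mul_le i r _ _).trans (by gcongr)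

lemma wnorm_prod_le {ι : Type*} (s : Finset ι) (φ : ι → MvPowerSeries σ ℝ) :
    wnorm i r (∏ j ∈ s, φ j) ≤ ∏ j ∈ s, wnorm i r (φ j) := by
  classical
  induction s using Finset.induction_on with
  | empty => simp [wnorm_one]
  | insert a s ha ih =>
    rw [Finset.prod_insert ha, Finset.prod_insert ha]
    exact (wnorm_mul_le i r _ _).trans (by gcongr)

/-- Divisibility by the indeterminate `i` is worth one factor `r`. This is what makes the system a
contraction in norm for small `r`. -/
lemma wnorm_le_mul_of_suppIn {φ : MvPowerSeries σ ℝ} (h : SuppIn (degGE i 1) φ) (hr : r ≤ 1) :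
    wnorm i r φ ≤ wnorm i 1 φ * r := by
  rw [wnorm, wnorm, ← ENNReal.tsum_mul_right]
  refine ENNReal.tsum_le_tsum fun m => ?_
  by_cases hm : MvPowerSeries.coeff m φ = 0
  · simp [hm]
  · have h1 : 1 ≤ m i := h m hm
    rw [one_pow, mul_one]
    gcongr
    simpa using pow_le_pow_right_of_le_one' hr h1

/-- The part of a power series of degree less than `k` in the indeterminate `i`. -/
noncomputable def cut (k : ℕ) (φ : MvPowerSeries σ ℝ) : MvPowerSeries σ ℝ :=
  fun m => if m i < k then MvPowerSeries.coeff m φ else 0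

lemma coeff_cut (k : ℕ) (φ : MvPowerSeries σ ℝ) (m : σ →₀ ℕ) :
    MvPowerSeries.coeff m (cut i k φ) = if m i < k then MvPowerSeries.coeff m φ else 0 := rfl

lemma suppIn_sub_cut (k : ℕ) (φ : MvPowerSeries σ ℝ) : SuppIn (degGE i k) (φ - cut i k φ) := by
  intro m hm
  rw [map_sub, coeff_cut] at hm
  by_contra h
  have : m i < k := not_le.1 h
  simp [this] at hm

lemma wnorm_cut_le (k : ℕ) (φ : MvPowerSeries σ ℝ) : wnorm i r (cut i k φ) ≤ wnorm i r φ := by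
  refine ENNReal.tsum_le_tsum fun m => ?_
  rw [coeff_cut]
  split_ifs <;> simp

lemma cut_eq_of_suppIn_sub {k : ℕ} {φ ψ : MvPowerSeries σ ℝ}
    (h : SuppIn (degGE i k) (φ - ψ)) : cut i k φ = cut i k ψ := by
  ext m
  rw [coeff_cut, coeff_cut]
  split_ifs with hm
  · by_contra hne
    have := h m (by rw [map_sub]; exact sub_ne_zero.2 hne)
    exact absurd this (not_le.2 hm)
  · rfl

/-- A finite partial sum involves only bounded degrees in `i`, so uniform bounds for the cuts
suffice; finiteness of the norm need not be known beforehand. -/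
lemma wnorm_le_of_cut {φ : MvPowerSeries σ ℝ} {b : ℝ≥0∞} (h : ∀ k, wnorm i r (cut i k φ) ≤ b) :
    wnorm i r φ ≤ b := by
  rw [wnorm, ENNReal.tsum_eq_iSup_sum]
  refine iSup_le fun s => ?_
  refine le_trans ?_ (h (s.sup (fun m => m i) + 1))
  refine le_trans (le_of_eq ?_) (ENNReal.sum_le_tsum s)
  refine Finset.sum_congr rfl fun m hm => ?_
  rw [coeff_cut, if_pos (Nat.lt_succ_of_le (Finset.le_sup (f := fun m : σ →₀ ℕ => m i) hm))]

end Norm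

/-! ### A system of polynomial equations for power series -/

section System
variable {σ T : Type*}
open scoped ENNReal

/-- The polynomial `∑ K_{t,(u,h)} γ_u ∏ δ_v ^ h(v)`, the sum being over `(u, h) ∈ J`. -/
noncomputable def sysR (J : Finset (T × (T →₀ ℕ))) (K : T → T × (T →₀ ℕ) → MvPowerSeries σ ℝ)
    (γ δ : T → MvPowerSeries σ ℝ) (t : T) : MvPowerSeries σ ℝ :=
  ∑ j ∈ J, K t j * (γ j.1 * ∏ v ∈ j.2.support, δ v ^ j.2 v)

/-- The equations `γ = 1 - R` and `δ = 1 + R δ`, so that `δ = γ⁻¹`, for the indices in `S`. -/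
structure IsSol (S : Set T) (J : Finset (T × (T →₀ ℕ)))
    (K : T → T × (T →₀ ℕ) → MvPowerSeries σ ℝ) (γ δ : T → MvPowerSeries σ ℝ) : Prop where
  gamma : ∀ t ∈ S, γ t = 1 - sysR J K γ δ t
  delta : ∀ t ∈ S, δ t = 1 + sysR J K γ δ t * δ t

/-- All indices which occur in `J` are in `S`. -/
def IndexIn (S : Set T) (J : Finset (T × (T →₀ ℕ))) : Prop :=
  ∀ j ∈ J, j.1 ∈ S ∧ ∀ v ∈ j.2.support, v ∈ S

variable {J : Finset (T × (T →₀ ℕ))} {K : T → T × (T →₀ ℕ) → MvPowerSeries σ ℝ}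
  {γ δ γ' δ' : T → MvPowerSeries σ ℝ} {S : Set T}

lemma suppIn_sysR {M : AddSubmonoid (σ →₀ ℕ)} {A : Set (σ →₀ ℕ)} (hJ : IndexIn S J)
    (hγ : ∀ t ∈ S, SuppIn (M : Set (σ →₀ ℕ)) (γ t))
    (hδ : ∀ t ∈ S, SuppIn (M : Set (σ →₀ ℕ)) (δ t)) {t : T}
    (hK : ∀ j ∈ J, ∀ k, MvPowerSeries.coeff k (K t j) ≠ 0 → ∀ m ∈ M, k + m ∈ A) :
    SuppIn A (sysR J K γ δ t) := by
  refine suppIn_sum _ fun j hj => ?_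
  refine (suppIn_support (K t j)).mul
    (B := (M : Set (σ →₀ ℕ))) ?_ fun a b ha _ hb => hK j hj a ha b hb
  exact (hγ _ (hJ j hj).1).mul_mem
    (suppIn_prod _ fun v hv => (hδ v ((hJ j hj).2 v hv)).pow_mem _)

/-- Telescoping: the factors of a term are replaced one at a time while the others keep their
exponents in `M`. The coefficient `K t j` stays attached to the difference, so only the sums `k + w`
have to lie in `Z`. -/
lemma suppIn_sysR_sub {M : AddSubmonoid (σ →₀ ℕ)} {Z : Set (σ →₀ ℕ)} (hJ : IndexIn S J)
    (hZ : ∀ m ∈ M, ∀ z ∈ Z, m + z ∈ Z)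
    (hδ : ∀ t ∈ S, SuppIn (M : Set (σ →₀ ℕ)) (δ t))
    (hγ' : ∀ t ∈ S, SuppIn (M : Set (σ →₀ ℕ)) (γ' t))
    (hδ' : ∀ t ∈ S, SuppIn (M : Set (σ →₀ ℕ)) (δ' t)) {t : T}
    (h1 : ∀ j ∈ J, ∀ k, MvPowerSeries.coeff k (K t j) ≠ 0 →
      ∀ w, MvPowerSeries.coeff w (γ' j.1 - γ j.1) ≠ 0 → k + w ∈ Z)
    (h2 : ∀ j ∈ J, ∀ k, MvPowerSeries.coeff k (K t j) ≠ 0 → ∀ v ∈ j.2.support,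
      ∀ w, MvPowerSeries.coeff w (δ' v - δ v) ≠ 0 → k + w ∈ Z) :
    SuppIn Z (sysR J K γ' δ' t - sysR J K γ δ t) := by
  rw [sysR, sysR, ← Finset.sum_sub_distrib]
  refine suppIn_sum _ fun j hj => ?_
  rw [← mul_sub]
  -- The exponents which every exponent of `K t j` moves into `Z`; stability under `M` passes from
  -- `Z` to `W`.
  set W : Set (σ →₀ ℕ) := {w | ∀ k, MvPowerSeries.coeff k (K t j) ≠ 0 → k + w ∈ Z} with hW
  have hWM : ∀ m ∈ M, ∀ w ∈ W, m + w ∈ W := fun m hm w hw k hk => by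
    rw [add_left_comm]
    exact hZ m hm _ (hw k hk)
  refine (suppIn_support (K t j)).mul
    (B := W) ?_ fun a b ha _ hb => hb a ha
  have hjS := hJ j hj
  refine suppIn_mul_sub (M := (M : Set (σ →₀ ℕ))) hWM (hγ' _ hjS.1)
    (suppIn_prod _ fun v hv => (hδ v (hjS.2 v hv)).pow_mem _)
    (fun w hw k hk => h1 j hj k hk w hw) (suppIn_prod_sub hWM _
      (fun v hv => (hδ' v (hjS.2 v hv)).pow_mem _) (fun v hv => (hδ v (hjS.2 v hv)).pow_mem _)
      fun v hv => suppIn_pow_sub hWM (hδ' v (hjS.2 v hv)) (hδ v (hjS.2 v hv))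
        (fun w hw k hk => h2 j hj k hk v hv w hw) _)

variable {i : σ}

lemma sysR_degGE (hK : ∀ t, ∀ j ∈ J, SuppIn (degGE i 1) (K t j)) (t : T) :
    SuppIn (degGE i 1) (sysR J K γ δ t) := by
  refine suppIn_sysR (S := Set.univ) (M := ⊤) (fun _ _ => ⟨trivial, fun _ _ => trivial⟩)
    (fun _ _ => suppIn_univ _) (fun _ _ => suppIn_univ _) fun j hj k hk m _ => ?_
  exact add_mem_degGE_left (hK t j hj k hk) m

/-- The contraction property: agreement below degree `k` becomes agreement below degree `k + 1`,
since each `K t j` contributes at least one degree. -/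
lemma sysR_contract (hJ : IndexIn S J) (hK : ∀ t, ∀ j ∈ J, SuppIn (degGE i 1) (K t j)) {k : ℕ}
    (h1 : ∀ t ∈ S, SuppIn (degGE i k) (γ' t - γ t))
    (h2 : ∀ t ∈ S, SuppIn (degGE i k) (δ' t - δ t)) (t : T) :
    SuppIn (degGE i (k + 1)) (sysR J K γ' δ' t - sysR J K γ δ t) := by
  refine suppIn_sysR_sub (M := ⊤) hJ ?_ (fun _ _ => suppIn_univ _) (fun _ _ => suppIn_univ _)
    (fun _ _ => suppIn_univ _) ?_ ?_
  · intro m _ z hz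
    exact add_comm m z ▸ add_mem_degGE_left hz m
  · intro j hj a ha w hw
    rw [add_comm k]
    exact add_mem_degGE (hK t j hj a ha) (h1 _ (hJ j hj).1 w hw)
  · intro j hj a ha v hv w hw
    rw [add_comm k]
    exact add_mem_degGE (hK t j hj a ha) (h2 _ ((hJ j hj).2 v hv) w hw)

lemma sysR_mul_contract (hJ : IndexIn S J) (hK : ∀ t, ∀ j ∈ J, SuppIn (degGE i 1) (K t j)) {k : ℕ}
    (h1 : ∀ t ∈ S, SuppIn (degGE i k) (γ' t - γ t))
    (h2 : ∀ t ∈ S, SuppIn (degGE i k) (δ' t - δ t)) {t : T} (ht : t ∈ S) :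
    SuppIn (degGE i (k + 1)) (sysR J K γ' δ' t * δ' t - sysR J K γ δ t * δ t) := by
  have : sysR J K γ' δ' t * δ' t - sysR J K γ δ t * δ t
    = sysR J K γ' δ' t * (δ' t - δ t) + (sysR J K γ' δ' t - sysR J K γ δ t) * δ t := by ring
  rw [this]
  refine SuppIn.add ?_ ?_
  · refine (sysR_degGE hK t).mul (h2 t ht) fun a b _ ha hb => ?_
    rw [add_comm k]
    exact add_mem_degGE ha hb
  · exact (sysR_contract hJ hK h1 h2 t).mul (suppIn_univ _) fun a b _ ha _ =>
      add_mem_degGE_left ha b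

lemma exists_isSol (hK : ∀ t, ∀ j ∈ J, SuppIn (degGE i 1) (K t j)) :
    ∃ γ δ, IsSol Set.univ J K γ δ := by
  have hJ : IndexIn Set.univ J := fun _ _ => ⟨trivial, fun _ _ => trivial⟩
  let Y := (T → MvPowerSeries σ ℝ) × (T → MvPowerSeries σ ℝ)
  let step : Y → Y := fun y =>
    (fun t => 1 - sysR J K y.1 y.2 t, fun t => 1 + sysR J K y.1 y.2 t * y.2 t)
  let y : ℕ → Y := fun k => step^[k] (1, 1)
  have hy : ∀ k, y (k + 1) = step (y k) := fun k => Function.iterate_succ_apply' _ _ _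
  have hstep : ∀ k (z z' : Y), (∀ t, SuppIn (degGE i k) (z'.1 t - z.1 t)) →
      (∀ t, SuppIn (degGE i k) (z'.2 t - z.2 t)) →
      (∀ t, SuppIn (degGE i (k + 1)) ((step z').1 t - (step z).1 t)) ∧
      (∀ t, SuppIn (degGE i (k + 1)) ((step z').2 t - (step z).2 t)) := by
    intro k z z' h1 h2
    refine ⟨fun t => ?_, fun t => ?_⟩
    · have := (sysR_contract hJ hK (fun t _ => h1 t) (fun t _ => h2 t) t).neg
      convert this using 1
      simp only [step]; ring
    · have := sysR_mul_contract hJ hK (fun t _ => h1 t) (fun t _ => h2 t) (t := t) trivial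
      convert this using 1
      simp only [step]; ring
  have hsucc : ∀ k, (∀ t, SuppIn (degGE i k) ((y (k + 1)).1 t - (y k).1 t)) ∧
      (∀ t, SuppIn (degGE i k) ((y (k + 1)).2 t - (y k).2 t)) := by
    intro k
    induction k with
    | zero => exact ⟨fun t m _ => Nat.zero_le _, fun t m _ => Nat.zero_le _⟩
    | succ k ih => rw [hy (k + 1), hy k]; rw [hy k] at ih; exact hstep k _ _ ih.1 ih.2
  have hle : ∀ k l, (∀ t, SuppIn (degGE i k) ((y (k + l)).1 t - (y k).1 t)) ∧
      (∀ t, SuppIn (degGE i k) ((y (k + l)).2 t - (y k).2 t)) := by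
    intro k l
    induction l with
    | zero => simp [suppIn_zero]
    | succ l ih =>
      have h := hsucc (k + l)
      refine ⟨fun t => ?_, fun t => ?_⟩
      · have := ((h.1 t).mono fun m hm => mem_degGE_of_le hm (Nat.le_add_right k l)).add (ih.1 t)
        rw [sub_add_sub_cancel] at this
        exact this
      · have := ((h.2 t).mono fun m hm => mem_degGE_of_le hm (Nat.le_add_right k l)).add (ih.2 t)
        rw [sub_add_sub_cancel] at this
        exact this
  -- The coefficient at `m` no longer changes from the iterate `m i + 1` on, so it is read off
  -- there.
  let z : Y := (fun t m => MvPowerSeries.coeff m ((y (m i + 1)).1 t),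
    fun t m => MvPowerSeries.coeff m ((y (m i + 1)).2 t))
  have hz : ∀ k, (∀ t, SuppIn (degGE i k) (z.1 t - (y k).1 t)) ∧
      (∀ t, SuppIn (degGE i k) (z.2 t - (y k).2 t)) := by
    intro k
    refine ⟨fun t m hm => ?_, fun t m hm => ?_⟩ <;>
    · by_contra hk
      have hk' : m i + 1 ≤ k := not_le.1 (mt mem_degGE.2 hk)
      apply hm
      rw [map_sub, sub_eq_zero]
      obtain ⟨l, rfl⟩ := Nat.exists_eq_add_of_le hk'
      by_contra hne
      have h3 : m i + 1 ≤ m i := by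
        first
        | exact (hle (m i + 1) l).1 t m (by rw [map_sub]; exact sub_ne_zero.2 (Ne.symm hne))
        | exact (hle (m i + 1) l).2 t m (by rw [map_sub]; exact sub_ne_zero.2 (Ne.symm hne))
      omega
  have hfix : ∀ k, (∀ t, SuppIn (degGE i k) (z.1 t - (step z).1 t)) ∧
      (∀ t, SuppIn (degGE i k) (z.2 t - (step z).2 t)) := by
    intro k
    have h1 := hz (k + 1)
    have h2 := hstep k _ _ (hz k).1 (hz k).2
    rw [hy] at h1
    refine ⟨fun t => ?_, fun t => ?_⟩
    · have := (h1.1 t).sub (h2.1 t)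
      rw [sub_sub_sub_cancel_right] at this
      exact this.mono fun m hm => mem_degGE_of_le hm (Nat.le_succ k)
    · have := (h1.2 t).sub (h2.2 t)
      rw [sub_sub_sub_cancel_right] at this
      exact this.mono fun m hm => mem_degGE_of_le hm (Nat.le_succ k)
  exact ⟨z.1, z.2, fun t _ => sub_eq_zero.1 (eq_zero_of_forall_degGE fun k => (hfix k).1 t),
    fun t _ => sub_eq_zero.1 (eq_zero_of_forall_degGE fun k => (hfix k).2 t)⟩

/-- The exponents which are in `M` or have degree at least `k` in the indeterminate `i`. -/
def orDegGE (M : AddSubmonoid (σ →₀ ℕ)) (i : σ) (k : ℕ) : AddSubmonoid (σ →₀ ℕ) where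
  carrier := {m | m ∈ M ∨ k ≤ m i}
  zero_mem' := Or.inl M.zero_mem
  add_mem' := by
    rintro a b (ha | ha) (hb | hb)
    · exact Or.inl (M.add_mem ha hb)
    · exact Or.inr (le_trans hb (by simp))
    · exact Or.inr (le_trans ha (by simp))
    · exact Or.inr (le_trans ha (by simp))

/-- Induction on `k` with `M` relaxed to `orDegGE M i k`. This is again a monoid, so products cause
no trouble, and each pass through the equations raises the permitted error degree by one. -/
lemma IsSol.suppIn (hsol : IsSol S J K γ δ) (hJ : IndexIn S J)
    (hK : ∀ t, ∀ j ∈ J, SuppIn (degGE i 1) (K t j)) {M : AddSubmonoid (σ →₀ ℕ)}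
    (hKM : ∀ t, ∀ j ∈ J, SuppIn (M : Set (σ →₀ ℕ)) (K t j)) {t : T} (ht : t ∈ S) :
    SuppIn (M : Set (σ →₀ ℕ)) (γ t) ∧ SuppIn (M : Set (σ →₀ ℕ)) (δ t) := by
  have key : ∀ k, ∀ t ∈ S, SuppIn (orDegGE M i k : Set (σ →₀ ℕ)) (γ t) ∧
      SuppIn (orDegGE M i k : Set (σ →₀ ℕ)) (δ t) := by
    intro k
    induction k with
    | zero => exact fun t _ => ⟨fun m _ => Or.inr (Nat.zero_le _), fun m _ => Or.inr (Nat.zero_le _)⟩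
    | succ k ih =>
      intro t ht
      -- The extra information `1 ≤ m i` is needed for the product `R δ`: there it meets exponents
      -- of δ known only to have degree at least `k`.
      have hR : SuppIn {m : σ →₀ ℕ | (m ∈ M ∧ 1 ≤ m i) ∨ k + 1 ≤ m i} (sysR J K γ δ t) := by
        refine suppIn_sysR hJ (fun t ht => (ih t ht).1) (fun t ht => (ih t ht).2) ?_
        rintro j hj a ha m (hm | hm)
        · refine Or.inl ⟨M.add_mem (hKM t j hj a ha) hm, le_trans (hK t j hj a ha) (by simp)⟩
        · right
          have : 1 ≤ a i := hK t j hj a ha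
          rw [Finsupp.add_apply]; omega
      have h1 : SuppIn (orDegGE M i (k + 1) : Set (σ →₀ ℕ)) (1 : MvPowerSeries σ ℝ) :=
        suppIn_one (Or.inl M.zero_mem)
      refine ⟨?_, ?_⟩
      · rw [hsol.gamma t ht]
        refine h1.sub (hR.mono ?_)
        rintro m (hm | hm)
        · exact Or.inl hm.1
        · exact Or.inr hm
      · rw [hsol.delta t ht]
        refine h1.add (hR.mul (ih t ht).2 ?_)
        rintro a b _ (ha | ha) (hb | hb)
        · exact Or.inl (M.add_mem ha.1 hb)
        · right; rw [Finsupp.add_apply]; omega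
        · right; rw [Finsupp.add_apply]; omega
        · right; rw [Finsupp.add_apply]; omega
  refine ⟨fun m hm => ?_, fun m hm => ?_⟩
  · exact ((key (m i + 1) t ht).1 m hm).resolve_right (by omega)
  · exact ((key (m i + 1) t ht).2 m hm).resolve_right (by omega)

lemma wnorm_sysR_le (hJ : IndexIn S J) (r : ℝ≥0∞) (hγ : ∀ t ∈ S, wnorm i r (γ t) ≤ 2)
    (hδ : ∀ t ∈ S, wnorm i r (δ t) ≤ 2) (t : T) :
    wnorm i r (sysR J K γ δ t) ≤
      ∑ j ∈ J, wnorm i r (K t j) * (2 * ∏ v ∈ j.2.support, 2 ^ j.2 v) := by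
  refine (wnorm_sum_le i r _ _).trans (Finset.sum_le_sum fun j hj => ?_)
  refine (wnorm_mul_le i r _ _).trans ?_
  gcongr
  refine (wnorm_mul_le i r _ _).trans ?_
  refine mul_le_mul' (hγ _ (hJ j hj).1) ((wnorm_prod_le i r _ _).trans ?_)
  refine Finset.prod_le_prod' fun v hv => (wnorm_pow_le i r _ _).trans ?_
  exact pow_le_pow_left' (hδ v ((hJ j hj).2 v hv)) _

/-- If γ and δ have norm at most 2 and `r` is small, then R has norm at most 1/2, and the equations
return the bounds 1 + 1/2 for γ and 1 + (1/2) · 2 for δ. Since the norms are not known to be finite,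
the argument runs by induction over the cuts. -/
lemma IsSol.exists_wnorm_le (hsol : IsSol S J K γ δ) (hS : S.Finite) (hJ : IndexIn S J)
    (hK : ∀ t, ∀ j ∈ J, SuppIn (degGE i 1) (K t j))
    (hfin : ∀ t, ∀ j ∈ J, wnorm i 1 (K t j) < ∞) :
    ∃ r : ℝ, 0 < r ∧ ∀ t ∈ S, wnorm i (ENNReal.ofReal r) (γ t) ≤ 2 := by
  set B : ℝ≥0∞ := ∑ t ∈ hS.toFinset, ∑ j ∈ J,
    wnorm i 1 (K t j) * (2 * ∏ v ∈ j.2.support, 2 ^ j.2 v) with hB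
  have hBfin : B < ∞ := by
    refine ENNReal.sum_lt_top.2 fun t _ => ENNReal.sum_lt_top.2 fun j hj => ?_
    refine ENNReal.mul_lt_top (hfin t j hj) (ENNReal.mul_lt_top (by simp) ?_)
    exact ENNReal.prod_lt_top fun v _ => ENNReal.pow_lt_top (by simp)
  -- Chosen so that `B * r ≤ 1/2`; the summand 1 also gives `r ≤ 1`.
  set r : ℝ≥0∞ := (2 * (B + 1))⁻¹ with hr
  have hden : 2 * (B + 1) ≠ ∞ := ENNReal.mul_ne_top (by simp) (by simp [hBfin.ne])
  have hr0 : r ≠ 0 := ENNReal.inv_ne_zero.2 hden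
  have hr1 : r ≤ 1 := by
    refine ENNReal.inv_le_one.2 ?_
    calc (1 : ℝ≥0∞) = 1 * 1 := by simp
      _ ≤ 2 * (B + 1) := by gcongr <;> simp
  have hBr : B * r ≤ 2⁻¹ := by
    rw [hr, ENNReal.mul_inv (by simp) (by simp), mul_left_comm]
    refine mul_le_of_le_one_right' ?_
    rw [← div_eq_mul_inv]
    exact ENNReal.div_le_of_le_mul (by simp)
  have hR : ∀ γ δ : T → MvPowerSeries σ ℝ, (∀ t ∈ S, wnorm i r (γ t) ≤ 2) →
      (∀ t ∈ S, wnorm i r (δ t) ≤ 2) → ∀ t ∈ S, wnorm i r (sysR J K γ δ t) ≤ 2⁻¹ := by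
    intro γ δ hγ hδ t ht
    refine (wnorm_sysR_le hJ r hγ hδ t).trans (le_trans ?_ hBr)
    have h1 : ∑ j ∈ J, wnorm i 1 (K t j) * (2 * ∏ v ∈ j.2.support, 2 ^ j.2 v) ≤ B :=
      Finset.single_le_sum (f := fun t => ∑ j ∈ J,
        wnorm i 1 (K t j) * (2 * ∏ v ∈ j.2.support, 2 ^ j.2 v)) (fun _ _ => zero_le)
        (hS.mem_toFinset.2 ht)
    refine le_trans ?_ (mul_le_mul_left h1 r)
    rw [Finset.sum_mul]
    refine Finset.sum_le_sum fun j hj => ?_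
    rw [mul_right_comm]
    gcongr
    exact wnorm_le_mul_of_suppIn i r (hK t j hj) hr1
  have hcut : ∀ k, ∀ t ∈ S, wnorm i r (cut i k (γ t)) ≤ 2 ∧ wnorm i r (cut i k (δ t)) ≤ 2 := by
    intro k
    induction k with
    | zero =>
      intro t _
      have h0 : ∀ φ : MvPowerSeries σ ℝ, cut i 0 φ = 0 := fun φ => by
        ext m; simp [coeff_cut]
      simp [h0, wnorm_zero]
    | succ k ih =>
      intro t ht
      set γ₁ : T → MvPowerSeries σ ℝ := fun t => cut i k (γ t)
      set δ₁ : T → MvPowerSeries σ ℝ := fun t => cut i k (δ t)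
      have hR1 := hR γ₁ δ₁ (fun t ht => (ih t ht).1) (fun t ht => (ih t ht).2) t ht
      refine ⟨?_, ?_⟩
      · have h1 : cut i (k + 1) (γ t) = cut i (k + 1) (1 - sysR J K γ₁ δ₁ t) := by
          refine cut_eq_of_suppIn_sub i ?_
          rw [hsol.gamma t ht, sub_sub_sub_cancel_left, ← neg_sub]
          exact (sysR_contract hJ hK (fun t _ => suppIn_sub_cut i k _)
            (fun t _ => suppIn_sub_cut i k _) t).neg
        rw [h1]
        refine (wnorm_cut_le i r _ _).trans ((wnorm_sub_le i r _ _).trans ?_)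
        rw [wnorm_one, ← one_add_one_eq_two]
        gcongr
        exact hR1.trans (by simp)
      · have h1 : cut i (k + 1) (δ t) = cut i (k + 1) (1 + sysR J K γ₁ δ₁ t * δ₁ t) := by
          refine cut_eq_of_suppIn_sub i ?_
          rw [hsol.delta t ht, add_sub_add_left_eq_sub]
          exact sysR_mul_contract hJ hK (fun t _ => suppIn_sub_cut i k _)
            (fun t _ => suppIn_sub_cut i k _) ht
        rw [h1]
        refine (wnorm_cut_le i r _ _).trans ((wnorm_add_le i r _ _).trans ?_)
        rw [wnorm_one, ← one_add_one_eq_two]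
        gcongr
        refine (wnorm_mul_le i r _ _).trans ((mul_le_mul' hR1 (ih t ht).2).trans ?_)
        rw [ENNReal.inv_mul_cancel (by simp) (by simp)]
  have hrt : r ≠ ∞ := (hr1.trans_lt ENNReal.one_lt_top).ne
  refine ⟨r.toReal, ENNReal.toReal_pos hr0 hrt, fun t ht => ?_⟩
  rw [ENNReal.ofReal_toReal hrt]
  exact wnorm_le_of_cut i r fun k => (hcut k t ht).1

end System

/-! ### Comparison of the solutions for different sets of indices -/

section Compare
variable {T : Type*}
open scoped ENNReal

/-- The exponents whose `(n, p)`-part is in `E` and whose degree in `p` is at least the sum of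
the `μ(v)` over the indeterminates `g_v`, with multiplicities. -/
noncomputable def expMonoid (E : AddSubmonoid (ℕ × ℕ)) (μ : T → ℕ) :
    AddSubmonoid (Fin 2 ⊕ T →₀ ℕ) where
  carrier := {m | (m (Sum.inl 0), m (Sum.inl 1)) ∈ E ∧
    Finsupp.weight (Sum.elim (fun _ => 0) μ) m ≤ m (Sum.inl 1)}
  zero_mem' := ⟨E.zero_mem, by simp⟩
  add_mem' := by
    rintro a b ⟨ha, ha'⟩ ⟨hb, hb'⟩
    refine ⟨E.add_mem ha hb, ?_⟩
    rw [map_add, Finsupp.add_apply]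
    exact add_le_add ha' hb'

/-- The properties of the coefficients `K_{t,(u,h)}` on which the estimates are based. -/
structure Admissible (E : AddSubmonoid (ℕ × ℕ)) (ν μ : T → ℕ)
    (K : T → T × (T →₀ ℕ) → MvPowerSeries (Fin 2 ⊕ T) ℝ) : Prop where
  deg : ∀ t j, SuppIn (degGE (Sum.inl 1) 1) (K t j)
  mem : ∀ t j, SuppIn (expMonoid E μ : Set (Fin 2 ⊕ T →₀ ℕ)) (K t j)
  gvar : ∀ t j m, MvPowerSeries.coeff m (K t j) ≠ 0 → ∀ v ∈ j.2.support, m (Sum.inr v) ≠ 0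
  ratio : ∀ t j m, MvPowerSeries.coeff m (K t j) ≠ 0 →
    m (Sum.inl 0) + ν t ≤ ν j.1 ∧ μ j.1 ≤ m (Sum.inl 1) + μ t
  sub : ∀ t j, K t j ≠ 0 → ∀ v ∈ j.2.support, ∃ e ∈ E, ν j.1 ≤ ν v + e.1 ∧ μ j.1 = μ v + e.2
  fin : ∀ t j, wnorm (Sum.inl 1) 1 (K t j) < ∞

/-- The exponents which can occur in the difference of two solutions, where `U` is the set of
indices present in only one of the systems. -/
def devSet (E : AddSubmonoid (ℕ × ℕ)) (ν μ : T → ℕ) (U : Set T) (t : T) :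
    Set (Fin 2 ⊕ T →₀ ℕ) :=
  {m | (∃ u ∈ U, m (Sum.inr u) ≠ 0) ∨
    ∃ u ∈ U, ∃ e ∈ E, m (Sum.inl 0) + ν t ≤ ν u + e.1 ∧ m (Sum.inl 1) + μ t = μ u + e.2}

variable {E : AddSubmonoid (ℕ × ℕ)} {ν μ : T → ℕ} {U : Set T}

lemma add_mem_devSet {t : T} {m z : Fin 2 ⊕ T →₀ ℕ} (hm : m ∈ expMonoid E μ)
    (hz : z ∈ devSet E ν μ U t) : m + z ∈ devSet E ν μ U t := by
  rcases hz with ⟨u, hu, h⟩ | ⟨u, hu, e, he, h1, h2⟩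
  · exact Or.inl ⟨u, hu, by simp [h]⟩
  · refine Or.inr ⟨u, hu, _, E.add_mem hm.1 he, ?_, ?_⟩
    · simp only [Finsupp.add_apply, Prod.fst_add]; omega
    · simp only [Finsupp.add_apply, Prod.snd_add]; omega

lemma snd_mem_of_mem (hE : ((0, 1) : ℕ × ℕ) ∈ E) (k : ℕ) : ((0, k) : ℕ × ℕ) ∈ E := by
  have := E.nsmul_mem hE k
  simpa using this

/-- Induction on the p-degree up to which the deviation is controlled. A deviation enters the
equation for `t` through an old term with a deviating factor, or through a term present only in the
larger system. -/
lemma IsSol.suppIn_sub {K : T → T × (T →₀ ℕ) → MvPowerSeries (Fin 2 ⊕ T) ℝ}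
    (hK : Admissible E ν μ K) (hE : ((0, 1) : ℕ × ℕ) ∈ E) {S S' : Set T}
    {J J' : Finset (T × (T →₀ ℕ))} (hSS' : S ⊆ S') (hJ : IndexIn S J) (hJ' : IndexIn S' J')
    (hJJ' : J ⊆ J')
    (hnew : ∀ j ∈ J', j ∉ J → j.1 ∈ S' \ S ∨ ∃ v ∈ j.2.support, v ∈ S' \ S)
    {γ δ γ' δ' : T → MvPowerSeries (Fin 2 ⊕ T) ℝ} (hsol : IsSol S J K γ δ)
    (hsol' : IsSol S' J' K γ' δ') {t : T} (ht : t ∈ S) :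
    SuppIn (devSet E ν μ (S' \ S) t) (γ' t - γ t) := by
  classical
  set M := expMonoid E μ with hM
  set U := S' \ S with hU
  have hmem : ∀ t ∈ S, SuppIn (M : Set _) (γ t) ∧ SuppIn (M : Set _) (δ t) := fun t ht =>
    hsol.suppIn hJ (fun t j _ => hK.deg t j) (fun t j _ => hK.mem t j) ht
  have hmem' : ∀ t ∈ S', SuppIn (M : Set _) (γ' t) ∧ SuppIn (M : Set _) (δ' t) := fun t ht =>
    hsol'.suppIn hJ' (fun t j _ => hK.deg t j) (fun t j _ => hK.mem t j) ht
  have key : ∀ k, ∀ t ∈ S, SuppIn (devSet E ν μ U t ∪ degGE (Sum.inl 1) k) (γ' t - γ t) ∧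
      SuppIn (devSet E ν μ U t ∪ degGE (Sum.inl 1) k) (δ' t - δ t) := by
    intro k
    induction k with
    | zero =>
      exact fun t _ => ⟨fun m _ => Or.inr (Nat.zero_le _), fun m _ => Or.inr (Nat.zero_le _)⟩
    | succ k ih =>
      intro t ht
      set Z := devSet E ν μ U t ∪ degGE (Sum.inl 1) (k + 1) with hZ
      have hZM : ∀ m ∈ M, ∀ z ∈ Z, m + z ∈ Z := by
        rintro m hm z (hz | hz)
        · exact Or.inl (add_mem_devSet hm hz)
        · exact Or.inr (add_comm m z ▸ add_mem_degGE_left hz m)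
      have hpos : ∀ j a, MvPowerSeries.coeff a (K t j) ≠ 0 → ∀ w ∈ degGE (Sum.inl 1) k,
          a + w ∈ Z := fun j a ha w hw => Or.inr (by
            rw [add_comm k]; exact add_mem_degGE (hK.deg t j a ha) hw)
      have h1 : SuppIn Z (sysR J K γ' δ' t - sysR J K γ δ t) := by
        refine suppIn_sysR_sub hJ hZM (fun t ht => (hmem t ht).2)
          (fun t ht => (hmem' t (hSS' ht)).1) (fun t ht => (hmem' t (hSS' ht)).2) ?_ ?_
        -- A deviation of γ_u for `u = j.1` is normalised by (ν(u), μ(u)); multiplication by `K t j`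
        -- passes to (ν(t), μ(t)) by `ratio`. Surplus powers of p are absorbed since (0,1) is in
        -- `E`.
        · intro j hj a ha w hw
          rcases (ih j.1 (hJ j hj).1).1 w hw with h | h
          · left
            rcases h with ⟨u, hu, h⟩ | ⟨u, hu, e, he, h1, h2⟩
            · exact Or.inl ⟨u, hu, by simp [h]⟩
            · obtain ⟨h3, h4⟩ := hK.ratio t j a ha
              refine Or.inr ⟨u, hu, e + (0, a (Sum.inl 1) + μ t - μ j.1),
                E.add_mem he (snd_mem_of_mem hE _), ?_, ?_⟩
              · simp only [Finsupp.add_apply, Prod.fst_add]; omega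
              · simp only [Finsupp.add_apply, Prod.snd_add]; omega
          · exact hpos j a ha w h
        -- A deviation of δ_v is normalised by (ν(v), μ(v)). As `v` occurs inside a cluster of type
        -- `j.1`, the field `sub` passes from `v` to `j.1` at the cost of one more element of `E`.
        · intro j hj a ha v hv w hw
          rcases (ih v ((hJ j hj).2 v hv)).2 w hw with h | h
          · left
            rcases h with ⟨u, hu, h⟩ | ⟨u, hu, e, he, h1, h2⟩
            · exact Or.inl ⟨u, hu, by simp [h]⟩
            · obtain ⟨h3, h4⟩ := hK.ratio t j a ha
              obtain ⟨e', he', h5, h6⟩ := hK.sub t j (fun h0 => ha (by rw [h0, map_zero])) v hv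
              refine Or.inr ⟨u, hu, e + e' + (0, a (Sum.inl 1) + μ t - μ j.1),
                E.add_mem (E.add_mem he he') (snd_mem_of_mem hE _), ?_, ?_⟩
              · simp only [Finsupp.add_apply, Prod.fst_add]; omega
              · simp only [Finsupp.add_apply, Prod.snd_add]; omega
          · exact hpos j a ha w h
      have hJd : IndexIn S' (J' \ J) := fun j hj => hJ' j (Finset.mem_sdiff.1 hj).1
      -- A new pair has a new type as `j.1`, giving the second alternative of `devSet`, or a new
      -- type `v` in `j.2`, and then g_v divides the coefficient.
      have h2 : SuppIn Z (sysR (J' \ J) K γ' δ' t) := by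
        refine suppIn_sysR hJd (fun t ht => (hmem' t ht).1) (fun t ht => (hmem' t ht).2) ?_
        intro j hj a ha m hm
        obtain ⟨hj', hjn⟩ := Finset.mem_sdiff.1 hj
        left
        rw [add_comm]
        refine add_mem_devSet hm ?_
        rcases hnew j hj' hjn with h | ⟨v, hv, hvU⟩
        · obtain ⟨h3, h4⟩ := hK.ratio t j a ha
          refine Or.inr ⟨j.1, h, (0, a (Sum.inl 1) + μ t - μ j.1), snd_mem_of_mem hE _, ?_, ?_⟩
          · simpa using h3
          · simp only; omega
        · exact Or.inl ⟨v, hvU, hK.gvar t j a ha v hv⟩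
      have hsplit : sysR J' K γ' δ' t = sysR (J' \ J) K γ' δ' t + sysR J K γ' δ' t :=
        (Finset.sum_sdiff hJJ').symm
      have h3 : SuppIn Z (sysR J' K γ' δ' t - sysR J K γ δ t) := by
        rw [hsplit, add_sub_assoc]
        exact h2.add h1
      refine ⟨?_, ?_⟩
      · rw [hsol.gamma t ht, hsol'.gamma t (hSS' ht), sub_sub_sub_cancel_left, ← neg_sub]
        exact h3.neg
      · rw [hsol.delta t ht, hsol'.delta t (hSS' ht), add_sub_add_left_eq_sub]
        have : sysR J' K γ' δ' t * δ' t - sysR J K γ δ t * δ t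
          = sysR J' K γ' δ' t * (δ' t - δ t) + (sysR J' K γ' δ' t - sysR J K γ δ t) * δ t := by
          ring
        rw [this]
        refine SuppIn.add ?_ ?_
        · have hR : SuppIn ((M : Set _) ∩ degGE (Sum.inl 1) 1) (sysR J' K γ' δ' t) := by
            refine suppIn_sysR hJ' (fun t ht => (hmem' t ht).1) (fun t ht => (hmem' t ht).2) ?_
            exact fun j _ a ha m hm =>
              ⟨M.add_mem (hK.mem t j a ha) hm, add_mem_degGE_left (hK.deg t j a ha) m⟩
          refine hR.mul (ih t ht).2 ?_
          rintro a b _ ⟨ha, ha'⟩ (hb | hb)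
          · exact Or.inl (add_mem_devSet ha hb)
          · right
            rw [add_comm k]
            exact add_mem_degGE ha' hb
        · exact h3.mul (hmem t ht).2 fun a b _ ha hb => add_comm a b ▸ hZM b hb a ha
  intro m hm
  refine ((key (m (Sum.inl 1) + 1) t ht).1 m hm).resolve_right fun h => ?_
  have := mem_degGE.1 h
  omega

end Compare

/-! ### Growth of clusters -/

section Growth
variable {V : Type*}

/-- The pairs `(a, b)` for which clusters can grow by `a` vertices and `b` edges when copies of
`G₀` are added one by one, each of them meeting what is already there. -/
def extMonoid (G₀ : SimpleGraph V) : AddSubmonoid (ℕ × ℕ) :=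
  AddSubmonoid.closure {e | ∃ G₁ : ProperSub G₀, subMu G₁.1 < subMu (⊤ : G₀.Subgraph) ∧
    e.1 ≤ subNu (⊤ : G₀.Subgraph) - subNu G₁.1 ∧ e.2 = subMu (⊤ : G₀.Subgraph) - subMu G₁.1}

variable {G₀ : SimpleGraph V}

/-- Needed because λ_u/λ_t contains lower powers of n besides the leading one; the inequality in the
generators provides for them. -/
lemma extMonoid_lower {e : ℕ × ℕ} (he : e ∈ extMonoid G₀) {a : ℕ} (ha : a ≤ e.1) :
    (a, e.2) ∈ extMonoid G₀ := by
  induction he using AddSubmonoid.closure_induction generalizing a with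
  | mem e he =>
    obtain ⟨G₁, h1, h2, h3⟩ := he
    exact AddSubmonoid.subset_closure ⟨G₁, h1, ha.trans h2, h3⟩
  | zero =>
    obtain rfl : a = 0 := by simpa using ha
    exact AddSubmonoid.zero_mem _
  | add x y _ _ hx hy =>
    have h1 := hx (a := min a x.1) (min_le_right _ _)
    have h2 := hy (a := a - x.1) (by simp only [Prod.fst_add] at ha; omega)
    have := AddSubmonoid.add_mem _ h1 h2
    convert this using 1
    ext
    · simp only [Prod.fst_add]; omega
    · simp

lemma ncard_edgeSet_top : subMu (⊤ : G₀.Subgraph) = G₀.edgeSet.ncard := by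
  simp [subMu]

/-- Deleting a single edge and keeping all vertices leaves a proper subgraph, which still has an
edge because there were at least two. -/
lemma one_mem_extMonoid [Finite V] (h : 2 ≤ G₀.edgeSet.ncard) :
    ((0, 1) : ℕ × ℕ) ∈ extMonoid G₀ := by
  have hfin : G₀.edgeSet.Finite := Set.toFinite _
  obtain ⟨e, he⟩ : G₀.edgeSet.Nonempty := (Set.ncard_pos hfin).1 (by omega)
  set G₁ : G₀.Subgraph := (⊤ : G₀.Subgraph).deleteEdges {e} with hG
  have hes : G₁.edgeSet = G₀.edgeSet \ {e} := by
    ext x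
    induction x with
    | _ a b => simp [hG]
  have hcard : subMu G₁ = G₀.edgeSet.ncard - 1 := by
    rw [subMu, hes, Set.ncard_sdiff_singleton_of_mem he]
  have hne : G₁.edgeSet.Nonempty := by
    rw [← Set.ncard_pos (Set.toFinite _)]
    change 0 < subMu G₁
    omega
  refine AddSubmonoid.subset_closure ⟨⟨G₁, ?_, hne⟩, ?_, Nat.zero_le _, ?_⟩
  · intro h0
    rw [h0] at hcard
    rw [ncard_edgeSet_top] at hcard
    omega
  · change subMu G₁ < _
    rw [ncard_edgeSet_top, hcard]; omega
  · change 1 = _ - subMu G₁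
    rw [ncard_edgeSet_top, hcard]; omega

instance [Finite V] : Finite (ProperSub G₀) := by unfold ProperSub; infer_instance

lemma fst_le_chi_mul [Finite V] {e : ℕ × ℕ} (he : e ∈ extMonoid G₀) :
    (e.1 : ℝ) ≤ chi G₀ * e.2 := by
  induction he using AddSubmonoid.closure_induction with
  | mem e he =>
    obtain ⟨G₁, h1, h2, h3⟩ := he
    have hle : subNu G₁.1 ≤ subNu (⊤ : G₀.Subgraph) :=
      Set.ncard_le_ncard (by simp) (Set.toFinite _)
    have h4 : ((subNu (⊤ : G₀.Subgraph) : ℝ) - subNu G₁.1) /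
        ((subMu (⊤ : G₀.Subgraph) : ℝ) - subMu G₁.1) ≤ chi G₀ :=
      le_ciSup (f := fun G₁ : ProperSub G₀ => ((subNu (⊤ : G₀.Subgraph) : ℝ) - subNu G₁.1) /
        ((subMu (⊤ : G₀.Subgraph) : ℝ) - subMu G₁.1)) (Set.finite_range _).bddAbove G₁
    have h5 : (0 : ℝ) < (subMu (⊤ : G₀.Subgraph) : ℝ) - subMu G₁.1 := by
      rw [sub_pos]; exact_mod_cast h1
    rw [div_le_iff₀ h5] at h4
    rw [h3, Nat.cast_sub h1.le]
    refine le_trans ?_ h4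
    rw [← Nat.cast_sub hle]
    exact_mod_cast h2
  | zero => simp
  | add x y _ _ hx hy =>
    simp only [Prod.fst_add, Prod.snd_add, Nat.cast_add]
    linarith

lemma chi_nonneg [Finite V] (h : 2 ≤ G₀.edgeSet.ncard) : 0 ≤ chi G₀ := by
  simpa using fst_le_chi_mul (one_mem_extMonoid h)

/-- `H` is the edge set of the copy of `G₀` given by `φ`. -/
def IsCopy (G₀ : SimpleGraph V) (H : Finset Edge) : Prop :=
  ∃ φ : V ↪ ℕ, ∀ e : Edge, e ∈ H ↔ e.1 ∈ Sym2.map φ '' G₀.edgeSet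

/-- A set of edges which meets a cluster without containing it meets a copy of `G₀` in the
cluster without containing it. -/
lemma IsCluster.exists_copy {star : Bool} {J : Finset Edge} (hJ : IsCluster G₀ star J)
    {A : Finset Edge} (h1 : (A ∩ J).Nonempty) (h2 : ¬ J ⊆ A) :
    ∃ C, IsCopy G₀ C ∧ C ⊆ J ∧ (A ∩ C).Nonempty ∧ ¬ C ⊆ A := by
  induction hJ with
  | copy φ H hH => exact ⟨H, ⟨φ, hH⟩, subset_rfl, h1, h2⟩
  | edge hs e =>
    obtain ⟨x, hx⟩ := h1
    simp only [Finset.mem_inter, Finset.mem_singleton] at hx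
    exact absurd (by simpa [hx.2] using hx.1) h2
  | union H H' _ _ hne ih ih' =>
    by_cases hA : H ⊆ A
    · by_cases hA' : H' ⊆ A
      · exact absurd (Finset.union_subset hA hA') h2
      · obtain ⟨x, hx⟩ := hne
        rw [Finset.mem_inter] at hx
        obtain ⟨C, hC, h3, h4⟩ := ih' ⟨x, Finset.mem_inter.2 ⟨hA hx.1, hx.2⟩⟩ hA'
        exact ⟨C, hC, h3.trans Finset.subset_union_right, h4⟩
    · by_cases hAH : (A ∩ H).Nonempty
      · obtain ⟨C, hC, h3, h4⟩ := ih hAH hA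
        exact ⟨C, hC, h3.trans Finset.subset_union_left, h4⟩
      · have hA' : ¬ H' ⊆ A := by
          intro hsub
          obtain ⟨x, hx⟩ := hne
          rw [Finset.mem_inter] at hx
          exact hAH ⟨x, Finset.mem_inter.2 ⟨hsub hx.2, hx.1⟩⟩
        have : (A ∩ H').Nonempty := by
          obtain ⟨x, hx⟩ := h1
          rw [Finset.mem_inter, Finset.mem_union] at hx
          rcases hx.2 with h | h
          · exact absurd ⟨x, Finset.mem_inter.2 ⟨hx.1, h⟩⟩ hAH
          · exact ⟨x, Finset.mem_inter.2 ⟨hx.1, h⟩⟩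
        obtain ⟨C, hC, h3, h4⟩ := ih' this hA'
        exact ⟨C, hC, h3.trans Finset.subset_union_right, h4⟩

lemma verts_finite (H : Finset Edge) : (verts H).Finite := by
  have : verts H = ⋃ e ∈ H, {v | v ∈ e.1} := by ext; simp [verts]
  rw [this]
  refine H.finite_toSet.biUnion fun e _ => ?_
  obtain ⟨⟨a, b⟩, h⟩ := e
  refine (Set.toFinite {a, b}).subset fun v hv => ?_
  simpa using hv

lemma verts_mono {H H' : Finset Edge} (h : H ⊆ H') : verts H ⊆ verts H' :=
  fun _ ⟨e, he, hv⟩ => ⟨e, h he, hv⟩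

lemma verts_union (H H' : Finset Edge) : verts (H ∪ H') = verts H ∪ verts H' := by
  ext v
  simp only [verts, Finset.mem_union, Set.mem_union, Set.mem_ofPred_eq]
  constructor
  · rintro ⟨e, h | h, hv⟩
    · exact Or.inl ⟨e, h, hv⟩
    · exact Or.inr ⟨e, h, hv⟩
  · rintro (⟨e, h, hv⟩ | ⟨e, h, hv⟩)
    · exact ⟨e, Or.inl h, hv⟩
    · exact ⟨e, Or.inr h, hv⟩

lemma not_isDiag_map {W : Type*} {f : V → W} (hf : Function.Injective f) {e : Sym2 V}
    (he : ¬ e.IsDiag) : ¬ (Sym2.map f e).IsDiag := by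
  induction e with
  | _ a b => simpa [hf.eq_iff] using he

lemma card_eq_subMu (φ : V ↪ ℕ) (G₁ : G₀.Subgraph) {D : Finset Edge}
    (hD : ∀ e : Edge, e ∈ D ↔ e.1 ∈ Sym2.map φ '' G₁.edgeSet) : D.card = subMu G₁ := by
  have h : Subtype.val '' (D : Set Edge) = Sym2.map φ '' G₁.edgeSet := by
    ext x
    constructor
    · rintro ⟨e, he, rfl⟩
      exact (hD e).1 he
    · intro hx
      obtain ⟨y, hy, rfl⟩ := hx
      exact ⟨⟨_, not_isDiag_map φ.injective
        (G₀.not_isDiag_of_mem_edgeSet (G₁.edgeSet_subset hy))⟩, (hD _).2 ⟨y, hy, rfl⟩, rfl⟩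
  rw [subMu, ← Set.ncard_image_of_injective _ (Sym2.map.injective φ.injective), ← h,
    Set.ncard_image_of_injective _ Subtype.val_injective, Set.ncard_coe_finset]

/-- The part of the copy already present, pulled back along `φ`, is a proper subgraph `G₁` with an
edge. Its vertices are all those mapped into `verts Q`, not only those on common edges, so every new
vertex comes from the complement of `G₁.verts`. -/
lemma copy_step_mem [Finite V] {C Q : Finset Edge} (hC : IsCopy G₀ C) (h1 : (Q ∩ C).Nonempty)
    (h2 : ¬ C ⊆ Q) :
    ((verts (Q ∪ C)).ncard - (verts Q).ncard, (Q ∪ C).card - Q.card) ∈ extMonoid G₀ := by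
  obtain ⟨φ, hφ⟩ := hC
  let G₁ : G₀.Subgraph :=
    { verts := {v | φ v ∈ verts Q}
      Adj := fun a b => G₀.Adj a b ∧ ∃ e ∈ Q, e.1 = s(φ a, φ b)
      adj_sub := fun h => h.1
      edge_vert := fun {a b} h => by
        obtain ⟨_, e, he, h'⟩ := h
        exact ⟨e, he, by rw [h']; simp⟩
      symm := ⟨fun a b h => by
        obtain ⟨h0, e, he, h'⟩ := h
        exact ⟨h0.symm, e, he, by rw [h', Sym2.eq_swap]⟩⟩ }
  have hCtop : C.card = subMu (⊤ : G₀.Subgraph) :=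
    card_eq_subMu φ _ fun e => by rw [hφ]; simp
  have hin : ∀ e : Edge, e ∈ Q ∩ C ↔ e.1 ∈ Sym2.map φ '' G₁.edgeSet := by
    intro e
    rw [Finset.mem_inter, hφ]
    constructor
    · rintro ⟨he, y, hy, hye⟩
      refine ⟨y, ?_, hye⟩
      induction y with
      | _ a b => exact ⟨hy, e, he, by rw [← hye]; rfl⟩
    · rintro ⟨y, hy, hye⟩
      induction y with
      | _ a b =>
        obtain ⟨h0, e', he', h'⟩ := hy
        have : e' = e := Subtype.ext (by rw [h', ← hye]; rfl)
        exact ⟨this ▸ he', _, h0, hye⟩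
  have hG₁ : (Q ∩ C).card = subMu G₁ := card_eq_subMu φ _ hin
  have hlt : (Q ∩ C).card < C.card := by
    refine Finset.card_lt_card ((Finset.ssubset_iff_subset_ne).2 ⟨Finset.inter_subset_right, ?_⟩)
    exact fun h => h2 (Finset.inter_eq_right.1 h)
  have hcard : (Q ∪ C).card + (Q ∩ C).card = Q.card + C.card := Finset.card_union_add_card_inter _ _
  refine AddSubmonoid.subset_closure ⟨⟨G₁, ?_, ?_⟩, ?_, ?_, ?_⟩
  · intro h
    rw [h] at hG₁
    omega
  · obtain ⟨x, hx⟩ := h1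
    obtain ⟨y, hy, _⟩ := (hin x).1 hx
    exact ⟨y, hy⟩
  · change subMu G₁ < _
    omega
  · have hN : subNu (⊤ : G₀.Subgraph) - subNu G₁ = (G₁.vertsᶜ).ncard := by
      rw [subNu, subNu, Set.ncard_compl]; simp [Set.ncard_univ]
    simp only
    rw [hN, verts_union, tsub_le_iff_left]
    have hsub : verts Q ∪ verts C ⊆ verts Q ∪ φ '' G₁.vertsᶜ := by
      rintro v (hv | ⟨e, he, hv⟩)
      · exact Or.inl hv
      · by_cases hvQ : v ∈ verts Q
        · exact Or.inl hvQ
        · right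
          obtain ⟨y, hy, hye⟩ := (hφ e).1 he
          rw [← hye, Sym2.mem_map] at hv
          obtain ⟨a, _, rfl⟩ := hv
          exact ⟨a, hvQ, rfl⟩
    refine (Set.ncard_le_ncard hsub ((verts_finite Q).union (Set.toFinite _))).trans ?_
    refine (Set.ncard_union_le _ _).trans ?_
    gcongr
    exact Set.ncard_image_le (Set.toFinite _)
  · simp only
    omega

/-- Copies supplied by `IsCluster.exists_copy` are added to `Q` until `J` is exhausted. The
intermediate sets need not be clusters, hence the arbitrary nonempty `Q`. -/
lemma IsCluster.growth_mem [Finite V] {star : Bool} {J : Finset Edge} (hJ : IsCluster G₀ star J)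
    {Q : Finset Edge} (hQJ : Q ⊆ J) (hQ : Q.Nonempty) :
    ((verts J).ncard - (verts Q).ncard, J.card - Q.card) ∈ extMonoid G₀ := by
  induction hn : J.card - Q.card using Nat.strong_induction_on generalizing Q with
  | _ n ih =>
    by_cases h : J ⊆ Q
    · obtain rfl := Finset.Subset.antisymm hQJ h
      have : n = 0 := by omega
      rw [this, Nat.sub_self]
      exact (extMonoid G₀).zero_mem
    · obtain ⟨C, hC, hCJ, h1, h2⟩ := hJ.exists_copy
        (by rwa [Finset.inter_eq_left.2 hQJ]) h
      have hsub : Q ∪ C ⊆ J := Finset.union_subset hQJ hCJ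
      have hlt : Q.card < (Q ∪ C).card := Finset.card_lt_card
        (Finset.ssubset_iff_subset_ne.2 ⟨Finset.subset_union_left,
          fun h => h2 (h ▸ Finset.subset_union_right)⟩)
      have hle := Finset.card_le_card hsub
      have h3 := ih (J.card - (Q ∪ C).card) (by omega) hsub (hQ.mono Finset.subset_union_left) rfl
      have h4 := AddSubmonoid.add_mem _ h3 (copy_step_mem hC h1 h2)
      have hv1 := Set.ncard_le_ncard (verts_mono hsub) (verts_finite _)
      have hv2 := Set.ncard_le_ncard (verts_mono (Finset.subset_union_left (s₁ := Q) (s₂ := C)))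
        (verts_finite _)
      convert h4 using 1
      ext
      · simp only [Prod.fst_add]; omega
      · simp only [Prod.snd_add]; omega

end Growth

/-! ### Types of clusters -/

section Types
variable {V : Type*} {G₀ : SimpleGraph V} {star : Bool}

lemma card_eq_ncard_edgeSet (H : Finset Edge) : H.card = (graph H).edgeSet.ncard := by
  have h : Sym2.map Subtype.val '' (graph H).edgeSet = Subtype.val '' (H : Set Edge) := by
    ext x
    constructor
    · rintro ⟨y, hy, rfl⟩
      induction y with
      | _ a b =>
        have : (SimpleGraph.fromEdgeSet (Subtype.val '' (H : Set Edge))).Adj a b := hy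
        rw [SimpleGraph.fromEdgeSet_adj] at this
        exact this.1
    · rintro ⟨e, he, rfl⟩
      obtain ⟨⟨a, b⟩, hab⟩ := e
      have ha : a ∈ verts H := ⟨_, he, Sym2.mem_mk_left a b⟩
      have hb : b ∈ verts H := ⟨_, he, Sym2.mem_mk_right a b⟩
      refine ⟨s(⟨a, ha⟩, ⟨b, hb⟩), ?_, rfl⟩
      change (SimpleGraph.fromEdgeSet (Subtype.val '' (H : Set Edge))).Adj a b
      rw [SimpleGraph.fromEdgeSet_adj]
      exact ⟨⟨_, he, rfl⟩, fun h => hab (by simpa using h)⟩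
  rw [← Set.ncard_image_of_injective _ (Sym2.map.injective Subtype.val_injective), h,
    Set.ncard_image_of_injective _ Subtype.val_injective, Set.ncard_coe_finset]

lemma tau_rep (t : ClType G₀ star) : tau (rep t) = t := Quotient.out_eq t

lemma tau_eq_iff {Q Q' : Cluster G₀ star} :
    tau Q = tau Q' ↔ Nonempty (graph Q.1 ≃g graph Q'.1) := Quotient.eq

lemma nu_tau (Q : Cluster G₀ star) : nu (tau Q) = (verts Q.1).ncard := by
  obtain ⟨e⟩ := tau_eq_iff.1 (tau_rep (tau Q))
  rw [nu, ← Nat.card_coe_set_eq, ← Nat.card_coe_set_eq]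
  exact Nat.card_congr e.toEquiv

lemma mu_tau (Q : Cluster G₀ star) : mu (tau Q) = Q.1.card := by
  obtain ⟨e⟩ := tau_eq_iff.1 (tau_rep (tau Q))
  rw [mu, card_eq_ncard_edgeSet, card_eq_ncard_edgeSet, ← Nat.card_coe_set_eq,
    ← Nat.card_coe_set_eq]
  exact Nat.card_congr e.mapEdgeSet

lemma IsCluster.nonempty (hG : 2 ≤ G₀.edgeSet.ncard) {H : Finset Edge}
    (h : IsCluster G₀ star H) : H.Nonempty := by
  induction h with
  | copy φ H hH =>
    obtain ⟨e, he⟩ : G₀.edgeSet.Nonempty := by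
      rw [Set.nonempty_iff_ne_empty]
      rintro h0
      simp [h0] at hG
    exact ⟨⟨_, not_isDiag_map φ.injective (G₀.not_isDiag_of_mem_edgeSet he)⟩,
      (hH _).2 ⟨e, he, rfl⟩⟩
  | edge => simp
  | union H H' _ _ _ ih _ => exact ih.mono Finset.subset_union_left

lemma mu_pos (hG : 2 ≤ G₀.edgeSet.ncard) (t : ClType G₀ star) : 0 < mu t :=
  Finset.card_pos.2 ((rep t).2.nonempty hG)

lemma ncard_verts_le (H : Finset Edge) : (verts H).ncard ≤ 2 * H.card := by
  classical
  induction H using Finset.induction_on with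
  | empty => simp [verts]
  | insert e H he ih =>
    rw [Finset.insert_eq, verts_union, Finset.card_union_of_disjoint (by simpa using he)]
    refine (Set.ncard_union_le _ _).trans ?_
    have : (verts {e}).ncard ≤ 2 := by
      obtain ⟨⟨a, b⟩, h⟩ := e
      refine le_trans (Set.ncard_le_ncard (t := {a, b}) ?_ (Set.toFinite _)) ((Set.ncard_insert_le a {b}).trans
        (by simp))
      rintro v ⟨e, he, hv⟩
      rw [Finset.mem_singleton] at he
      subst he
      simpa using hv
    simp only [Finset.card_singleton]
    omega

/-- A type is determined by a graph on `Fin k` isomorphic to it, and at most `L` edges cover at most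
`2 * L` vertices. -/
lemma finite_mu_le (G₀ : SimpleGraph V) (star : Bool) (L : ℕ) :
    {t : ClType G₀ star | mu t ≤ L}.Finite := by
  have hfin : ∀ t : ClType G₀ star, Finite (verts (rep t).1) := fun t => verts_finite _
  let e : ∀ t : ClType G₀ star, verts (rep t).1 ≃ Fin (nu t) := fun t =>
    (Finite.equivFin _).trans (finCongr (Nat.card_coe_set_eq _))
  let code : {t : ClType G₀ star // mu t ≤ L} → Σ k : Fin (2 * L + 1), SimpleGraph (Fin k) :=
    fun t => ⟨⟨nu t.1, Nat.lt_succ_of_le ((ncard_verts_le _).trans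
      (Nat.mul_le_mul_left 2 t.2))⟩, (graph (rep t.1).1).map (e t.1)⟩
  have hiso : ∀ p q : Σ k : Fin (2 * L + 1), SimpleGraph (Fin k), p = q →
      Nonempty (p.2 ≃g q.2) := by
    rintro p _ rfl
    exact ⟨SimpleGraph.Iso.refl⟩
  have hcode : Function.Injective code := fun t t' h => by
    obtain ⟨f⟩ := hiso _ _ h
    have h1 : tau (rep t.1) = tau (rep t'.1) := tau_eq_iff.2
      ⟨(SimpleGraph.Iso.map (e t.1) _).trans (f.trans (SimpleGraph.Iso.map (e t'.1) _).symm)⟩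
    rw [tau_rep, tau_rep] at h1
    exact Subtype.ext h1
  have : Finite {t : ClType G₀ star // mu t ≤ L} := Finite.of_injective code hcode
  exact this

/-! ### Maximal clusters -/

lemma finite_subclusters (H : Finset Edge) : {Q : Cluster G₀ star | Q.1 ⊆ H}.Finite := by
  refine Set.Finite.of_finite_image (f := Subtype.val) ?_ Subtype.val_injective.injOn
  refine (H.powerset.finite_toSet).subset ?_
  rintro _ ⟨Q, hQ, rfl⟩
  simpa using hQ

lemma finite_maxClusters (H : Finset Edge) : (maxClusters G₀ star H).Finite :=
  (finite_subclusters H).subset fun _ h => h.1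

lemma exists_of_sFun_ne_zero {H : Finset Edge} {v : ClType G₀ star} (h : sFun H v ≠ 0) :
    ∃ Q : Cluster G₀ star, Q.1 ⊆ H ∧ tau Q = v := by
  obtain ⟨Q, hQ, hv⟩ := Set.nonempty_of_ncard_ne_zero h
  exact ⟨Q, hQ.1, hv⟩

lemma sFun_support_finite (H : Finset Edge) :
    (Function.support (sFun (G₀ := G₀) (star := star) H)).Finite := by
  refine ((finite_subclusters H).image tau).subset fun v hv => ?_
  obtain ⟨Q, hQ, hv⟩ := exists_of_sFun_ne_zero hv
  exact ⟨Q, hQ, hv⟩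

lemma disjoint_maxClusters {H : Finset Edge} {Q Q' : Cluster G₀ star}
    (hQ : Q ∈ maxClusters G₀ star H) (hQ' : Q' ∈ maxClusters G₀ star H) (hne : Q ≠ Q') :
    Disjoint Q.1 Q'.1 := by
  rw [Finset.disjoint_iff_inter_eq_empty]
  by_contra h
  let J : Cluster G₀ star := ⟨Q.1 ∪ Q'.1, IsCluster.union _ _ Q.2 Q'.2
    (Finset.nonempty_iff_ne_empty.2 h)⟩
  have hJ : J.1 ⊆ H := Finset.union_subset hQ.1 hQ'.1
  exact hne ((hQ.2 J hJ Finset.subset_union_left).symm.trans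
    (hQ'.2 J hJ Finset.subset_union_right))

/-- Distinct maximal clusters are disjoint, since otherwise their union would be a larger cluster.
The left side therefore counts distinct edges of `H`. -/
lemma sum_sFun_mul_mu_le (H : Finset Edge) (s : Finset (ClType G₀ star)) :
    ∑ v ∈ s, sFun H v * mu v ≤ H.card := by
  classical
  have hfin := finite_maxClusters (G₀ := G₀) (star := star) H
  have h1 : ∀ v, sFun H v * mu v =
      ∑ Q ∈ hfin.toFinset.filter (fun Q => tau Q = v), Q.1.card := by
    intro v
    rw [Finset.sum_congr rfl (g := fun _ => mu v), Finset.sum_const, smul_eq_mul, sFun]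
    · congr 1
      rw [← Set.ncard_coe_finset]
      congr 1
      ext Q
      simp
    · intro Q hQ
      rw [← (Finset.mem_filter.1 hQ).2, mu_tau]
  calc ∑ v ∈ s, sFun H v * mu v
      = ∑ v ∈ s, ∑ Q ∈ hfin.toFinset.filter (fun Q => tau Q = v), Q.1.card :=
        Finset.sum_congr rfl fun v _ => h1 v
    _ = ∑ Q ∈ hfin.toFinset.filter (fun Q => tau Q ∈ s), Q.1.card := by
        rw [← Finset.sum_fiberwise_of_maps_to
          (s := hfin.toFinset.filter (fun Q => tau Q ∈ s)) (t := s) (g := tau)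
          (fun Q hQ => (Finset.mem_filter.1 hQ).2)]
        refine Finset.sum_congr rfl fun v hv => Finset.sum_congr ?_ fun _ _ => rfl
        ext Q
        simp only [Finset.mem_filter]
        constructor
        · rintro ⟨h, rfl⟩; exact ⟨⟨h, hv⟩, rfl⟩
        · rintro ⟨⟨h, _⟩, h'⟩; exact ⟨h, h'⟩
    _ = ((hfin.toFinset.filter (fun Q => tau Q ∈ s)).biUnion fun Q => Q.1).card := by
        rw [Finset.card_biUnion]
        intro Q hQ Q' hQ' hne
        exact disjoint_maxClusters (hfin.mem_toFinset.1 (Finset.mem_filter.1 hQ).1)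
          (hfin.mem_toFinset.1 (Finset.mem_filter.1 hQ').1) hne
    _ ≤ H.card := by
        refine Finset.card_le_card (Finset.biUnion_subset.2 fun Q hQ => ?_)
        exact (hfin.mem_toFinset.1 (Finset.mem_filter.1 hQ).1).1

lemma sFun_empty (hG : 2 ≤ G₀.edgeSet.ncard) : sFun (G₀ := G₀) (star := star) ∅ = 0 := by
  ext v
  by_contra h
  obtain ⟨Q, hQ, _⟩ := exists_of_sFun_ne_zero h
  exact (Q.2.nonempty hG).ne_empty (Finset.subset_empty.1 hQ)

/-- Passing from a cluster to a larger one changes `(ν, μ)` by an element of `extMonoid G₀`. -/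
lemma growth_of_subset [Finite V] (hG : 2 ≤ G₀.edgeSet.ncard) {Q J : Cluster G₀ star}
    (h : Q.1 ⊆ J.1) : nu (tau Q) ≤ nu (tau J) ∧ mu (tau Q) ≤ mu (tau J) ∧
      (nu (tau J) - nu (tau Q), mu (tau J) - mu (tau Q)) ∈ extMonoid G₀ := by
  rw [nu_tau, nu_tau, mu_tau, mu_tau]
  exact ⟨Set.ncard_le_ncard (verts_mono h) (verts_finite _), Finset.card_le_card h,
    J.2.growth_mem h (Q.2.nonempty hG)⟩

/-- A cluster grows from any one of its edges, which has two vertices; that edge need not itself be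
a cluster. -/
lemma nu_le_two_add [Finite V] (hG : 2 ≤ G₀.edgeSet.ncard) (t : ClType G₀ star) :
    (nu t : ℝ) ≤ 2 + chi G₀ * mu t := by
  obtain ⟨e, he⟩ := (rep t).2.nonempty hG
  have h := fst_le_chi_mul ((rep t).2.growth_mem (Q := {e}) (by simpa using he) (by simp))
  have h2 : (verts {e}).ncard ≤ 2 := by simpa using ncard_verts_le {e}
  have h3 : (nu t : ℝ) ≤ 2 + ((nu t - (verts {e}).ncard : ℕ) : ℝ) := by
    norm_cast; omega
  refine h3.trans (add_le_add le_rfl (h.trans ?_))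
  refine mul_le_mul_of_nonneg_left ?_ (chi_nonneg hG)
  exact_mod_cast Nat.sub_le _ _

/-- From κμ ≤ ν ≤ 2 + χμ follows μ ≤ 2/(κ - χ). -/
lemma finite_smallTypes [Finite V] (hG : 2 ≤ G₀.edgeSet.ncard) {κ : ℝ} (hκ : chi G₀ < κ) :
    (SmallTypes G₀ star κ).Finite := by
  refine (finite_mu_le G₀ star ⌊2 / (κ - chi G₀)⌋₊).subset fun t ht => ?_
  have hpos : (0 : ℝ) < mu t := by exact_mod_cast mu_pos hG t
  have h1 : κ * mu t ≤ nu t := (le_div_iff₀ hpos).1 ht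
  have h2 := nu_le_two_add hG t
  refine Nat.le_floor ?_
  rw [le_div_iff₀ (by linarith)]
  linarith

end Types

/-! ### The number of clusters of a given type -/

section Count
variable {V : Type*} {G₀ : SimpleGraph V} {star : Bool}

/-- The action of an injective map of the vertices on the edges. -/
def mapEdge (f : ℕ ↪ ℕ) : Edge ↪ Edge where
  toFun e := ⟨Sym2.map f e.1, not_isDiag_map f.injective e.2⟩
  inj' _ _ h := Subtype.ext (Sym2.map.injective f.injective (congrArg Subtype.val h))

lemma mapEdge_val (f : ℕ ↪ ℕ) (e : Edge) : (mapEdge f e).1 = Sym2.map f e.1 := rfl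

lemma IsCluster.map (f : ℕ ↪ ℕ) {H : Finset Edge} (h : IsCluster G₀ star H) :
    IsCluster G₀ star (H.map (mapEdge f)) := by
  induction h with
  | copy φ H hH =>
    refine IsCluster.copy (φ.trans f) _ fun e => ?_
    rw [Finset.mem_map]
    constructor
    · rintro ⟨e', he', rfl⟩
      obtain ⟨y, hy, hye⟩ := (hH e').1 he'
      exact ⟨y, hy, by rw [mapEdge_val, ← hye, Sym2.map_map]; rfl⟩
    · rintro ⟨y, hy, hye⟩
      refine ⟨⟨_, not_isDiag_map φ.injective (G₀.not_isDiag_of_mem_edgeSet hy)⟩,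
        (hH _).2 ⟨y, hy, rfl⟩, Subtype.ext ?_⟩
      rw [← hye, mapEdge_val, Sym2.map_map]
      rfl
  | edge hs e => rw [Finset.map_singleton]; exact IsCluster.edge hs _
  | union H H' _ _ hne ih ih' =>
    rw [Finset.map_union]
    refine IsCluster.union _ _ ih ih' ?_
    rw [← Finset.map_inter]
    exact hne.map

lemma verts_map (f : ℕ ↪ ℕ) (H : Finset Edge) : verts (H.map (mapEdge f)) = f '' verts H := by
  ext v
  constructor
  · rintro ⟨e, he, hv⟩
    obtain ⟨e', he', rfl⟩ := Finset.mem_map.1 he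
    obtain ⟨a, ha, rfl⟩ := Sym2.mem_map.1 hv
    exact ⟨a, ⟨e', he', ha⟩, rfl⟩
  · rintro ⟨a, ⟨e, he, ha⟩, rfl⟩
    exact ⟨_, Finset.mem_map_of_mem _ he, Sym2.mem_map.2 ⟨a, ha, rfl⟩⟩

lemma graph_adj {H : Finset Edge} {a b : verts H} :
    (graph H).Adj a b ↔ ∃ e ∈ H, e.1 = s(a.1, b.1) := by
  change (SimpleGraph.fromEdgeSet (Subtype.val '' (H : Set Edge))).Adj a b ↔ _
  rw [SimpleGraph.fromEdgeSet_adj]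
  constructor
  · rintro ⟨⟨e, he, h⟩, _⟩
    exact ⟨e, he, h⟩
  · rintro ⟨e, he, h⟩
    exact ⟨⟨e, he, h⟩, fun hab => e.2 (by rw [h]; exact hab)⟩

lemma exists_iso_map (f : ℕ ↪ ℕ) (H : Finset Edge) :
    Nonempty (graph H ≃g graph (H.map (mapEdge f))) := by
  refine ⟨⟨(Equiv.Set.image f (verts H) f.injective).trans
    (Equiv.setCongr (verts_map f H).symm), ?_⟩⟩
  intro a b
  rw [graph_adj, graph_adj]
  constructor
  · rintro ⟨e, he, h⟩
    obtain ⟨e', he', rfl⟩ := Finset.mem_map.1 he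
    exact ⟨e', he', Sym2.map.injective f.injective h⟩
  · rintro ⟨e, he, h⟩
    refine ⟨_, Finset.mem_map_of_mem _ he, ?_⟩
    change Sym2.map f e.1 = _
    rw [h]
    rfl

lemma finite_omega (n : ℕ) : (Omega n).Finite := by
  refine Set.Finite.of_finite_image (f := Subtype.val) ?_ Subtype.val_injective.injOn
  refine (((Finset.range n).sym2).finite_toSet).subset ?_
  rintro _ ⟨e, he, rfl⟩
  exact Finset.mem_sym2_iff.2 fun v hv => Finset.mem_range.2 (he v hv)

lemma finite_clusters_omega (n : ℕ) (G₀ : SimpleGraph V) (star : Bool) :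
    {Q : Cluster G₀ star | ∀ e ∈ Q.1, e ∈ Omega n}.Finite := by
  refine (finite_subclusters (finite_omega n).toFinset).subset fun Q hQ e he => ?_
  simpa using hQ e he

lemma finite_numType (n : ℕ) (t : ClType G₀ star) :
    {Q : Cluster G₀ star | (∀ e ∈ Q.1, e ∈ Omega n) ∧ tau Q = t}.Finite :=
  (finite_clusters_omega n G₀ star).subset fun _ h => h.1

/-- A cluster is recovered from one isomorphism of the representative onto it, recorded as a map of
ν(t) vertices into `Fin n`. -/
lemma numType_le (n : ℕ) (t : ClType G₀ star) : numType n t ≤ n ^ nu t := by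
  classical
  set X := {Q : Cluster G₀ star | (∀ e ∈ Q.1, e ∈ Omega n) ∧ tau Q = t} with hX
  have hiso : ∀ Q : X, Nonempty (graph (rep t).1 ≃g graph Q.1.1) := fun Q =>
    tau_eq_iff.1 ((tau_rep t).trans Q.2.2.symm)
  let φ := fun Q => (hiso Q).some
  have hlt : ∀ (Q : X) (v : verts Q.1.1), v.1 < n := by
    rintro Q ⟨v, e, he, hv⟩
    exact Q.2.1 e he v hv
  have : Finite (verts (rep t).1) := verts_finite _
  have hinj : Function.Injective (fun Q : X => (fun v => ⟨(φ Q v).1, hlt Q _⟩ :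
      verts (rep t).1 → Fin n)) := by
    intro Q Q' h
    have key : ∀ Q Q' : X, (∀ v, (φ Q v).1 = (φ Q' v).1) → Q.1.1 ⊆ Q'.1.1 := by
      intro Q Q' h e he
      obtain ⟨⟨a, b⟩, hab⟩ := e
      have ha : a ∈ verts Q.1.1 := ⟨_, he, Sym2.mem_mk_left a b⟩
      have hb : b ∈ verts Q.1.1 := ⟨_, he, Sym2.mem_mk_right a b⟩
      have h1 : (graph Q.1.1).Adj ⟨a, ha⟩ ⟨b, hb⟩ := graph_adj.2 ⟨_, he, rfl⟩
      obtain ⟨v, hv⟩ := (φ Q).surjective ⟨a, ha⟩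
      obtain ⟨w, hw⟩ := (φ Q).surjective ⟨b, hb⟩
      rw [← hv, ← hw, (φ Q).map_adj_iff, ← (φ Q').map_adj_iff, graph_adj, ← h, ← h, hv, hw] at h1
      obtain ⟨e', he', h'⟩ := h1
      have : e' = ⟨s(a, b), hab⟩ := Subtype.ext h'
      exact this ▸ he'
    have h' : ∀ v, (φ Q v).1 = (φ Q' v).1 := fun v => congrArg Fin.val (congrFun h v)
    exact Subtype.ext (Subtype.ext (Finset.Subset.antisymm (key Q Q' h')
      (key Q' Q fun v => (h' v).symm)))
  have h1 := Nat.card_le_card_of_injective _ hinj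
  rw [Nat.card_coe_set_eq, Nat.card_fun, Nat.card_coe_set_eq, Nat.card_fin] at h1
  exact h1

lemma exists_embedding_image {A s : Finset ℕ} (h : A.card = s.card) :
    ∃ f : ℕ ↪ ℕ, f '' A = s := by
  classical
  let e : A ≃ s := Finset.equivOfCardEq h
  obtain ⟨b, hb⟩ := s.bddAbove
  -- Points outside `A` are shifted beyond the upper bound `b` of `s`, so they cannot collide with
  -- images of points of `A`.
  let f : ℕ → ℕ := fun x => if hx : x ∈ A then (e ⟨x, hx⟩).1 else x + b + 1
  have hle : ∀ x (hx : x ∈ A), (e ⟨x, hx⟩).1 ≤ b := fun x hx => hb (e ⟨x, hx⟩).2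
  refine ⟨⟨f, fun x y hxy => ?_⟩, ?_⟩
  · simp only [f] at hxy
    split_ifs at hxy with hx hy hy
    · simpa using hxy
    · have := hle x hx; omega
    · have := hle y hy; omega
    · omega
  · ext v
    constructor
    · rintro ⟨x, hx, rfl⟩
      have hx' : x ∈ A := hx
      change f x ∈ s
      simp only [f]
      rw [dif_pos hx']
      exact (e _).2
    · intro hv
      refine ⟨(e.symm ⟨v, hv⟩).1, (e.symm ⟨v, hv⟩).2, ?_⟩
      change f _ = v
      simp [f]

/-- Each ν(t)-subset of the vertices carries a copy of the representative, and the vertices of the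
copy recover the subset. -/
lemma choose_le_numType (n : ℕ) (t : ClType G₀ star) : n.choose (nu t) ≤ numType n t := by
  classical
  set X := {Q : Cluster G₀ star | (∀ e ∈ Q.1, e ∈ Omega n) ∧ tau Q = t} with hX
  set A := (verts_finite (rep t).1).toFinset with hA
  have hAc : A.card = nu t := by rw [nu, Set.ncard_eq_toFinset_card _ (verts_finite _)]
  have hf : ∀ s : (Finset.range n).powersetCard (nu t), ∃ f : ℕ ↪ ℕ, f '' A = s.1 := fun s =>
    exists_embedding_image (hAc.trans (Finset.mem_powersetCard.1 s.2).2.symm)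
  choose f hf using hf
  have hverts : ∀ s, verts ((rep t).1.map (mapEdge (f s))) = s.1 := fun s => by
    rw [verts_map, ← hf s]; simp [hA]
  have hmem : ∀ s, (⟨_, (rep t).2.map (f s)⟩ : Cluster G₀ star) ∈ X := by
    intro s
    refine ⟨fun e he v hv => ?_, ?_⟩
    · have h1 : v ∈ verts ((rep t).1.map (mapEdge (f s))) := ⟨e, he, hv⟩
      rw [hverts] at h1
      exact Finset.mem_range.1 ((Finset.mem_powersetCard.1 s.2).1 h1)
    · obtain ⟨g⟩ := exists_iso_map (f s) (rep t).1
      refine Eq.trans ?_ (tau_rep t)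
      exact tau_eq_iff.2 ⟨g.symm⟩
  have : Finite X := finite_numType n t
  have h1 := Nat.card_le_card_of_injective (fun s => (⟨_, hmem s⟩ : X)) fun s s' h => by
    have h2 : (rep t).1.map (mapEdge (f s)) = (rep t).1.map (mapEdge (f s')) :=
      congrArg (fun Q : X => Q.1.1) h
    have h3 := hverts s
    rw [h2, hverts s'] at h3
    exact Subtype.ext (Finset.coe_injective h3.symm)
  rw [Nat.card_coe_set_eq, Nat.card_eq_fintype_card, Fintype.card_coe, Finset.card_powersetCard,
    Finset.card_range] at h1
  exact h1

end Count

/-! ### The equations for `\bar γ` as a polynomial system -/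

section Coefficients
variable {V : Type*} {G₀ : SimpleGraph V} {star : Bool}
open scoped ENNReal

lemma cSer_ne_zero {u t : ClType G₀ star} {h : ClType G₀ star → ℕ} (hc : cSer u t h ≠ 0) :
    ∃ (Q : Cluster G₀ star) (H : Finset Edge), Q.1 ⊆ (rep u).1 ∧ tau Q = t ∧ H ⊆ (rep u).1 ∧
      H ∪ Q.1 = (rep u).1 ∧ sFun H = h := by
  classical
  obtain ⟨Q, hQ, hne⟩ := exists_ne_zero_of_finsum_mem_ne_zero hc
  obtain ⟨H, hH, _⟩ := Finset.exists_ne_zero_of_sum_ne_zero hne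
  rw [Finset.mem_filter, Finset.mem_powerset] at hH
  exact ⟨Q, H, hQ.1, hQ.2, hH.1, hH.2⟩

/-- The exponents of the powers of `p`. -/
def pMonoid (T : Type*) : AddSubmonoid (Fin 2 ⊕ T →₀ ℕ) where
  carrier := {m | ∀ s, s ≠ Sum.inl 1 → m s = 0}
  zero_mem' := fun _ _ => rfl
  add_mem' := fun ha hb s hs => by rw [Finsupp.add_apply, ha s hs, hb s hs]

lemma suppIn_varP : SuppIn (pMonoid (ClType G₀ star) : Set _) (varP : Series G₀ star) :=
  suppIn_X _ fun s hs => by simp [hs.symm]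

lemma suppIn_varP_pow (k : ℕ) :
    SuppIn {m | m (Sum.inl 1) = k ∧ ∀ s, s ≠ Sum.inl 1 → m s = 0} (varP ^ k : Series G₀ star) := by
  rw [varP, MvPowerSeries.X_pow_eq]
  exact suppIn_monomial _ ⟨by simp, fun s hs => by simp [hs.symm]⟩

lemma suppIn_varP_mul (a b : ℕ) :
    SuppIn {m | a ≤ m (Sum.inl 1) ∧ ∀ s, s ≠ Sum.inl 1 → m s = 0}
      (varP ^ a * (1 - varP) ^ b : Series G₀ star) := by
  have h1 : SuppIn (pMonoid (ClType G₀ star) : Set _) ((1 - varP) ^ b : Series G₀ star) :=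
    ((suppIn_one (pMonoid _).zero_mem).sub suppIn_varP).pow_mem b
  refine (suppIn_varP_pow a).mul h1 ?_
  rintro x y _ ⟨hx, hx'⟩ hy
  refine ⟨by rw [Finsupp.add_apply]; omega, fun s hs => ?_⟩
  rw [Finsupp.add_apply, hx' s hs, hy s hs]

/-- The maximal clusters of `H` are disjoint, so ∑ h(v) μ(v) ≤ |H| = |J| - |Q| + |Q ∩ H|. The power
of p in c(u,t,h) pays for |Q ∩ H|; the remaining μ(u) - μ(t) is paid for by λ_u/λ_t. -/
lemma suppIn_cSer (u t : ClType G₀ star) (h : ClType G₀ star →₀ ℕ) :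
    SuppIn {m | (∑ v ∈ h.support, h v * mu v ≤ mu u - mu t + m (Sum.inl 1)) ∧
      ∀ s, s ≠ Sum.inl 1 → m s = 0} (cSer u t h) := by
  classical
  refine finsum_mem_induction (SuppIn _) (suppIn_zero _) (fun _ _ h1 h2 => h1.add h2) ?_
  intro Q hQ
  refine suppIn_sum _ fun H hH => ?_
  rw [Finset.mem_filter, Finset.mem_powerset] at hH
  obtain ⟨hHJ, hun, hs⟩ := hH
  refine (suppIn_varP_mul _ _).mono ?_
  rintro m ⟨hm, hm'⟩
  refine ⟨?_, hm'⟩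
  have h1 := sum_sFun_mul_mu_le H h.support
  rw [hs] at h1
  have h2 : (H ∪ Q.1).card + (H ∩ Q.1).card = H.card + Q.1.card :=
    Finset.card_union_add_card_inter _ _
  rw [hun, Finset.inter_comm] at h2
  have h3 : mu t = Q.1.card := by rw [← hQ.2, mu_tau]
  have h4 : Q.1.card ≤ (rep u).1.card := Finset.card_le_card hQ.1
  have h5 : mu u = (rep u).1.card := rfl
  omega

lemma suppIn_prod_varN (s : Finset ℕ) :
    SuppIn {m | m (Sum.inl 0) ≤ s.card ∧ ∀ i, i ≠ Sum.inl 0 → m i = 0}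
      (∏ j ∈ s, (varN - MvPowerSeries.C (j : ℝ)) : Series G₀ star) := by
  classical
  induction s using Finset.induction_on with
  | empty =>
    rw [Finset.prod_empty]
    refine suppIn_one ?_
    exact ⟨by simp, fun _ _ => rfl⟩
  | insert a s ha ih =>
    rw [Finset.prod_insert ha, Finset.card_insert_of_notMem ha]
    have h1 : SuppIn {m : Idx G₀ star →₀ ℕ | m (Sum.inl 0) ≤ 1 ∧ ∀ i, i ≠ Sum.inl 0 → m i = 0}
        (varN - MvPowerSeries.C (a : ℝ) : Series G₀ star) := by
      refine SuppIn.sub (suppIn_X _ ?_) (suppIn_C _ ?_)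
      · exact ⟨by simp, fun i hi => by simp [hi.symm]⟩
      · exact ⟨by simp, fun _ _ => rfl⟩
    refine h1.mul ih ?_
    rintro x y _ ⟨hx, hx'⟩ ⟨hy, hy'⟩
    refine ⟨by rw [Finsupp.add_apply]; omega, fun i hi => ?_⟩
    rw [Finsupp.add_apply, hx' i hi, hy' i hi]

lemma suppIn_ratioSer (u t : ClType G₀ star) :
    SuppIn {m | m (Sum.inl 0) ≤ nu u - nu t ∧ m (Sum.inl 1) = mu u - mu t ∧
      ∀ v, m (Sum.inr v) = 0} (ratioSer u t) := by
  have h1 : SuppIn {m : Idx G₀ star →₀ ℕ | m (Sum.inl 0) ≤ nu u - nu t ∧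
      ∀ i, i ≠ Sum.inl 0 → m i = 0} (MvPowerSeries.C ((aut t : ℝ) / aut u) *
        ∏ j ∈ Finset.Ico (nu t) (nu u), (varN - MvPowerSeries.C (j : ℝ)) : Series G₀ star) := by
    refine (suppIn_C (B := {0}) _ rfl).mul (suppIn_prod_varN _) ?_
    rintro a b _ ha ⟨hb, hb'⟩
    obtain rfl : a = 0 := ha
    rw [zero_add]
    exact ⟨by rwa [Nat.card_Ico] at hb, hb'⟩
  refine h1.mul (suppIn_varP_pow _) ?_
  rintro a b _ ⟨ha, ha'⟩ ⟨hb, hb'⟩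
  refine ⟨?_, ?_, fun v => ?_⟩
  · rw [Finsupp.add_apply, hb' _ (by simp)]; omega
  · rw [Finsupp.add_apply, ha' _ (by simp)]; omega
  · rw [Finsupp.add_apply, ha' _ (by simp), hb' _ (by simp)]

/-- The exponents of `∏ g_v ^ h(v)`. -/
noncomputable def gExp (h : ClType G₀ star →₀ ℕ) : Idx G₀ star →₀ ℕ := h.mapDomain Sum.inr

lemma gExp_inr (h : ClType G₀ star →₀ ℕ) (v : ClType G₀ star) : gExp h (Sum.inr v) = h v :=
  Finsupp.mapDomain_apply Sum.inr_injective _ _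

lemma gExp_inl (h : ClType G₀ star →₀ ℕ) (i : Fin 2) : gExp h (Sum.inl i) = 0 :=
  Finsupp.mapDomain_of_notMem_range _ _ (by simp)

lemma prod_varG (h : ClType G₀ star →₀ ℕ) :
    ∏ v ∈ h.support, varG v ^ h v = (MvPowerSeries.monomial (gExp h) (1 : ℝ)) := by
  classical
  have : ∀ s : Finset (ClType G₀ star), ∏ v ∈ s, (varG v ^ h v : Series G₀ star) =
      MvPowerSeries.monomial (∑ v ∈ s, Finsupp.single (Sum.inr v) (h v)) (1 : ℝ) := by
    intro s
    induction s using Finset.induction_on with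
    | empty => simp
    | insert a s ha ih =>
      rw [Finset.prod_insert ha, Finset.sum_insert ha, ih, varG, MvPowerSeries.X_pow_eq,
        MvPowerSeries.monomial_mul_monomial, one_mul]
  rw [this, gExp, Finsupp.mapDomain, Finsupp.sum]

open Classical in
/-- The coefficients of the polynomial system for `\bar γ`. -/
noncomputable def coefK (t : ClType G₀ star) (j : ClType G₀ star × (ClType G₀ star →₀ ℕ)) :
    Series G₀ star :=
  -- Clearing the denominator gives c(t,t,0) γ_t on the left; the excess c(t,t,0) - 1 is carried as
  -- the coefficient of γ_t in R.
  if j = (t, 0) then cSer t t 0 - 1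
  else ratioSer j.1 t * cSer j.1 t j.2 * MvPowerSeries.monomial (gExp j.2) 1

lemma weight_eq_sum {T : Type*} (μ : T → ℕ) (m : Fin 2 ⊕ T →₀ ℕ) (s : Finset T)
    (hs : ∀ v, m (Sum.inr v) ≠ 0 → v ∈ s) :
    Finsupp.weight (Sum.elim (fun _ => 0) μ) m = ∑ v ∈ s, m (Sum.inr v) * μ v := by
  rw [Finsupp.weight_apply, Finsupp.sum_of_support_subset m (s := Finset.univ.disjSum s),
    Finset.sum_disjSum]
  · simp
  · rintro (i | v) hi
    · simp
    · simpa using hs v (by simpa using hi)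
  · simp

lemma coeff_ratio_mul_ne_zero {t u : ClType G₀ star} {h : ClType G₀ star →₀ ℕ}
    {m : Idx G₀ star →₀ ℕ} (hm : MvPowerSeries.coeff m
      (ratioSer u t * cSer u t h * MvPowerSeries.monomial (gExp h) 1) ≠ 0) :
    m (Sum.inl 0) ≤ nu u - nu t ∧ mu u - mu t ≤ m (Sum.inl 1) ∧
      ∑ v ∈ h.support, h v * mu v ≤ m (Sum.inl 1) ∧ ∀ v, m (Sum.inr v) = h v := by
  have h1 : SuppIn {m : Idx G₀ star →₀ ℕ | m (Sum.inl 0) ≤ nu u - nu t ∧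
      mu u - mu t ≤ m (Sum.inl 1) ∧ ∑ v ∈ h.support, h v * mu v ≤ m (Sum.inl 1) ∧
      ∀ v, m (Sum.inr v) = 0} (ratioSer u t * cSer u t h) := by
    refine (suppIn_ratioSer u t).mul (suppIn_cSer u t h) ?_
    rintro a b _ ⟨ha, ha', ha''⟩ ⟨hb, hb'⟩
    refine ⟨?_, ?_, ?_, fun v => ?_⟩
    · rw [Finsupp.add_apply, hb' _ (by simp)]; omega
    · rw [Finsupp.add_apply]; omega
    · rw [Finsupp.add_apply]; omega
    · rw [Finsupp.add_apply, ha'', hb' _ (by simp)]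
  have h2 : SuppIn {m : Idx G₀ star →₀ ℕ | m (Sum.inl 0) ≤ nu u - nu t ∧
      mu u - mu t ≤ m (Sum.inl 1) ∧ ∑ v ∈ h.support, h v * mu v ≤ m (Sum.inl 1) ∧
      ∀ v, m (Sum.inr v) = h v}
      (ratioSer u t * cSer u t h * MvPowerSeries.monomial (gExp h) 1) := by
    refine h1.mul (suppIn_monomial (B := {gExp h}) 1 rfl) ?_
    rintro a b _ ⟨h1, h2, h3, h4⟩ hb
    obtain rfl : b = gExp h := hb
    exact ⟨by simpa [gExp_inl] using h1, by simpa [gExp_inl] using h2,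
      by simpa [gExp_inl] using h3, fun v => by simp [gExp_inr, h4]⟩
  exact h2 m hm

lemma wnorm_cSer_lt_top (u t : ClType G₀ star) (h : ClType G₀ star → ℕ) :
    wnorm (Sum.inl 1) 1 (cSer u t h) < ∞ := by
  have hX : wnorm (Sum.inl 1) 1 (varP : Series G₀ star) < ∞ := by
    rw [varP, MvPowerSeries.X, wnorm_monomial]; simp
  refine finsum_mem_induction (fun φ => wnorm (Sum.inl 1) 1 φ < ∞) (by simp [wnorm_zero])
    (fun _ _ h1 h2 => (wnorm_add_le _ _ _ _).trans_lt (ENNReal.add_lt_top.2 ⟨h1, h2⟩)) ?_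
  intro Q _
  refine (wnorm_sum_le _ _ _ _).trans_lt (ENNReal.sum_lt_top.2 fun H _ => ?_)
  refine (wnorm_mul_le _ _ _ _).trans_lt (ENNReal.mul_lt_top ?_ ?_)
  · exact (wnorm_pow_le _ _ _ _).trans_lt (ENNReal.pow_lt_top hX)
  · refine (wnorm_pow_le _ _ _ _).trans_lt (ENNReal.pow_lt_top ?_)
    exact (wnorm_sub_le _ _ _ _).trans_lt (ENNReal.add_lt_top.2 ⟨by simp [wnorm_one], hX⟩)

lemma wnorm_ratioSer_lt_top (u t : ClType G₀ star) :
    wnorm (Sum.inl 1) 1 (ratioSer u t) < ∞ := by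
  have hC : ∀ a : ℝ, wnorm (Sum.inl 1) 1 (MvPowerSeries.C a : Series G₀ star) < ∞ := fun a => by
    rw [← MvPowerSeries.monomial_zero_eq_C_apply, wnorm_monomial]; simp
  refine (wnorm_mul_le _ _ _ _).trans_lt (ENNReal.mul_lt_top
    ((wnorm_mul_le _ _ _ _).trans_lt (ENNReal.mul_lt_top (hC _) ?_)) ?_)
  · refine (wnorm_prod_le _ _ _ _).trans_lt (ENNReal.prod_lt_top fun j _ => ?_)
    refine (wnorm_sub_le _ _ _ _).trans_lt (ENNReal.add_lt_top.2 ⟨?_, hC _⟩)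
    rw [varN, MvPowerSeries.X, wnorm_monomial]; simp
  · refine (wnorm_pow_le _ _ _ _).trans_lt (ENNReal.pow_lt_top ?_)
    rw [varP, MvPowerSeries.X, wnorm_monomial]; simp

/-- For `u = t` only `Q = J` is possible, and at p = 0 a term survives only if `Q ∩ H` is empty,
that is `H = ∅`. -/
lemma constantCoeff_cSer (hG : 2 ≤ G₀.edgeSet.ncard) (t : ClType G₀ star) :
    MvPowerSeries.constantCoeff (cSer t t 0) = 1 := by
  classical
  have hset : {Q : Cluster G₀ star | Q.1 ⊆ (rep t).1 ∧ tau Q = t} = {rep t} := by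
    ext Q
    constructor
    · rintro ⟨h1, h2⟩
      have : Q.1.card = (rep t).1.card := by rw [← mu_tau, h2]; rfl
      exact Subtype.ext (Finset.eq_of_subset_of_card_le h1 this.ge)
    · rintro rfl
      exact ⟨subset_rfl, tau_rep t⟩
  rw [cSer, hset, finsum_mem_singleton, map_sum, Finset.sum_eq_single ∅]
  · simp [varP]
  · intro H hH hne
    rw [Finset.mem_filter, Finset.mem_powerset] at hH
    have : ((rep t).1 ∩ H).card ≠ 0 := by
      rw [Finset.inter_eq_right.2 hH.1]
      exact Finset.card_ne_zero.2 (Finset.nonempty_iff_ne_empty.2 hne)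
    simp [varP, this]
  · intro h
    exact absurd (Finset.mem_filter.2 ⟨Finset.mem_powerset.2 (Finset.empty_subset _),
      by simp, sFun_empty hG⟩) h

lemma suppIn_cSer_sub_one (hG : 2 ≤ G₀.edgeSet.ncard) (t : ClType G₀ star) :
    SuppIn {m | 1 ≤ m (Sum.inl 1) ∧ ∀ s, s ≠ Sum.inl 1 → m s = 0}
      (cSer t t 0 - 1 : Series G₀ star) := by
  have h1 : SuppIn (pMonoid (ClType G₀ star) : Set _) (cSer t t 0 - 1 : Series G₀ star) :=
    SuppIn.sub (SuppIn.mono (suppIn_cSer t t 0) fun m hm => hm.2)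
      (suppIn_one (pMonoid _).zero_mem)
  intro m hm
  refine ⟨?_, h1 m hm⟩
  by_contra h0
  have : m = 0 := by
    ext s
    by_cases hs : s = Sum.inl 1
    · subst hs; simp only [Finsupp.coe_zero, Pi.zero_apply]; omega
    · exact h1 m hm s hs
  subst this
  apply hm
  rw [MvPowerSeries.coeff_zero_eq_constantCoeff_apply, map_sub, constantCoeff_cSer hG, map_one,
    sub_self]

lemma admissible_coefK [Finite V] (hG : 2 ≤ G₀.edgeSet.ncard) :
    Admissible (extMonoid G₀) nu mu (coefK (G₀ := G₀) (star := star)) := by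
  classical
  have hE := one_mem_extMonoid hG
  have hsub : ∀ (t : ClType G₀ star) j, j ≠ (t, 0) → coefK t j ≠ 0 →
      ∃ (Q : Cluster G₀ star) (H : Finset Edge), Q.1 ⊆ (rep j.1).1 ∧ tau Q = t ∧
        H ⊆ (rep j.1).1 ∧ sFun H = j.2 := by
    intro t j hj h0
    rw [coefK, if_neg hj] at h0
    obtain ⟨Q, H, h1, h2, h3, _, h4⟩ :=
      cSer_ne_zero (right_ne_zero_of_mul (left_ne_zero_of_mul h0))
    exact ⟨Q, H, h1, h2, h3, h4⟩
  have hgrow : ∀ (t : ClType G₀ star) j, j ≠ (t, 0) → coefK t j ≠ 0 →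
      nu t ≤ nu j.1 ∧ mu t ≤ mu j.1 ∧ (nu j.1 - nu t, mu j.1 - mu t) ∈ extMonoid G₀ := by
    intro t j hj h0
    obtain ⟨Q, H, h1, h2, _⟩ := hsub t j hj h0
    have := growth_of_subset hG h1
    rwa [h2, tau_rep] at this
  have hne : ∀ (t : ClType G₀ star) j m, MvPowerSeries.coeff m (coefK t j) ≠ 0 → coefK t j ≠ 0 :=
    fun t j m hm h0 => hm (by rw [h0, map_zero])
  have hdiag : ∀ (t : ClType G₀ star) m, MvPowerSeries.coeff m (coefK t (t, 0)) ≠ 0 →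
      1 ≤ m (Sum.inl 1) ∧ ∀ s, s ≠ Sum.inl 1 → m s = 0 := by
    intro t m hm
    rw [coefK, if_pos rfl] at hm
    exact suppIn_cSer_sub_one hG t m hm
  have hoff : ∀ (t : ClType G₀ star) j m, j ≠ (t, 0) → MvPowerSeries.coeff m (coefK t j) ≠ 0 →
      m (Sum.inl 0) ≤ nu j.1 - nu t ∧ mu j.1 - mu t ≤ m (Sum.inl 1) ∧
      ∑ v ∈ j.2.support, j.2 v * mu v ≤ m (Sum.inl 1) ∧ ∀ v, m (Sum.inr v) = j.2 v := by
    intro t j m hj hm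
    rw [coefK, if_neg hj] at hm
    exact coeff_ratio_mul_ne_zero hm
  refine ⟨?_, ?_, ?_, ?_, ?_, ?_⟩
  · intro t j m hm
    rw [mem_degGE]
    by_cases hj : j = (t, 0)
    · subst hj
      exact (hdiag t m hm).1
    · obtain ⟨_, h2, h3, _⟩ := hoff t j m hj hm
      -- With `h = 0` the cluster `Q` is a proper subset of `J`, as equality would mean `j = (t,
      -- 0)`; then the ratio contributes p. With `h ≠ 0` the bound by ∑ h(v) μ(v) contributes it.
      by_cases hh : j.2 = 0
      · obtain ⟨Q, H, hQ, hQt, _⟩ := hsub t j hj (hne t j m hm)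
        have hlt : Q.1.card < (rep j.1).1.card := by
          refine Finset.card_lt_card (Finset.ssubset_iff_subset_ne.2 ⟨hQ, fun he => hj ?_⟩)
          have : Q = rep j.1 := Subtype.ext he
          refine Prod.ext ?_ hh
          rw [← hQt, this, tau_rep]
        have h5 : mu t = Q.1.card := by rw [← hQt, mu_tau]
        have h6 : mu j.1 = (rep j.1).1.card := rfl
        omega
      · obtain ⟨v, hv⟩ := Finsupp.support_nonempty_iff.2 hh
        refine le_trans ?_ h3
        refine le_trans ?_ (Finset.single_le_sum (f := fun v => j.2 v * mu v)
          (fun _ _ => Nat.zero_le _) hv)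
        exact Nat.mul_pos (Nat.pos_of_ne_zero (Finsupp.mem_support_iff.1 hv)) (mu_pos hG v)
  · intro t j m hm
    by_cases hj : j = (t, 0)
    · subst hj
      have h1 := hdiag t m hm
      refine ⟨?_, ?_⟩
      · rw [h1.2 _ (by simp)]
        exact snd_mem_of_mem hE _
      · rw [weight_eq_sum mu m ∅ fun v hv => absurd (h1.2 _ (by simp)) hv]
        simp
    · obtain ⟨h1, h2, h3, h4⟩ := hoff t j m hj hm
      obtain ⟨h5, h6, h7⟩ := hgrow t j hj (hne t j m hm)
      refine ⟨?_, ?_⟩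
      · have h8 := AddSubmonoid.add_mem _ (extMonoid_lower h7 (a := m (Sum.inl 0)) h1)
          (snd_mem_of_mem hE (m (Sum.inl 1) - (mu j.1 - mu t)))
        convert h8 using 1
        ext
        · simp
        · simp only [Prod.snd_add]; omega
      · rw [weight_eq_sum mu m j.2.support fun v hv => by rw [h4] at hv; simpa using hv]
        refine le_trans (le_of_eq ?_) h3
        exact Finset.sum_congr rfl fun v _ => by rw [h4]
  · intro t j m hm v hv
    by_cases hj : j = (t, 0)
    · subst hj; simp at hv
    · rw [(hoff t j m hj hm).2.2.2]
      simpa using hv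
  · intro t j m hm
    by_cases hj : j = (t, 0)
    · subst hj
      have h1 := hdiag t m hm
      refine ⟨?_, by simp⟩
      rw [h1.2 _ (by simp)]; simp
    · obtain ⟨h1, h2, h3, h4⟩ := hoff t j m hj hm
      obtain ⟨h5, h6, h7⟩ := hgrow t j hj (hne t j m hm)
      exact ⟨by omega, by omega⟩
  · intro t j h0 v hv
    by_cases hj : j = (t, 0)
    · subst hj; simp at hv
    · obtain ⟨Q, H, _, _, hH, hs⟩ := hsub t j hj h0
      obtain ⟨R, hR, hRv⟩ := exists_of_sFun_ne_zero (H := H) (v := v)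
        (by rw [hs]; simpa using hv)
      have := growth_of_subset hG (hR.trans hH)
      rw [hRv, tau_rep] at this
      exact ⟨_, this.2.2, by simp only; omega, by simp only; omega⟩
  · intro t j
    rw [coefK]
    split_ifs
    · exact (wnorm_sub_le _ _ _ _).trans_lt (ENNReal.add_lt_top.2
        ⟨wnorm_cSer_lt_top _ _ _, by simp [wnorm_one]⟩)
    · refine (wnorm_mul_le _ _ _ _).trans_lt (ENNReal.mul_lt_top
        ((wnorm_mul_le _ _ _ _).trans_lt (ENNReal.mul_lt_top (wnorm_ratioSer_lt_top _ _)
          (wnorm_cSer_lt_top _ _ _))) ?_)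
      rw [wnorm_monomial]; simp

end Coefficients

/-! ### Restriction to finitely many types and identification of `gammaBar` with a solution of the
system -/

section GammaBar
variable {V : Type*} {G₀ : SimpleGraph V} {star : Bool}

/-- The function `s_H` as a finitely supported function. -/
noncomputable def sFinsupp (H : Finset Edge) : ClType G₀ star →₀ ℕ :=
  Finsupp.ofSupportFinite (sFun H) (sFun_support_finite H)

open Classical in
/-- The pairs `(u, h)` for which there can be a term in the equations for the types in `S`. -/
noncomputable def indexSet (S : Finset (ClType G₀ star)) :
    Finset (ClType G₀ star × (ClType G₀ star →₀ ℕ)) :=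
  (S.biUnion fun u => (rep u).1.powerset.image fun H => (u, sFinsupp H)).filter
    fun j => ∀ v ∈ j.2.support, v ∈ S

lemma mem_indexSet {S : Finset (ClType G₀ star)} {j : ClType G₀ star × (ClType G₀ star →₀ ℕ)} :
    j ∈ indexSet S ↔ j.1 ∈ S ∧ (∃ H ⊆ (rep j.1).1, sFinsupp H = j.2) ∧
      ∀ v ∈ j.2.support, v ∈ S := by
  classical
  obtain ⟨u, h⟩ := j
  simp only [indexSet, Finset.mem_filter, Finset.mem_biUnion, Finset.mem_image,
    Finset.mem_powerset, Prod.mk.injEq]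
  constructor
  · rintro ⟨⟨u', hu', H, hH, rfl, rfl⟩, h2⟩
    exact ⟨hu', ⟨H, hH, rfl⟩, h2⟩
  · rintro ⟨hu, ⟨H, hH, rfl⟩, h2⟩
    exact ⟨⟨u, hu, H, hH, rfl, rfl⟩, h2⟩

lemma indexIn_indexSet (S : Finset (ClType G₀ star)) :
    IndexIn (S : Set (ClType G₀ star)) (indexSet S) := fun j hj => by
  rw [mem_indexSet] at hj
  exact ⟨hj.1, hj.2.2⟩

lemma indexSet_mono {S S' : Finset (ClType G₀ star)} (h : S ⊆ S') : indexSet S ⊆ indexSet S' := by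
  intro j hj
  rw [mem_indexSet] at hj ⊢
  exact ⟨h hj.1, hj.2.1, fun v hv => h (hj.2.2 v hv)⟩

lemma of_mem_indexSet_of_notMem {S S' : Finset (ClType G₀ star)}
    {j : ClType G₀ star × (ClType G₀ star →₀ ℕ)} (h' : j ∈ indexSet S') (h : j ∉ indexSet S) :
    j.1 ∈ (S' : Set (ClType G₀ star)) \ S ∨
      ∃ v ∈ j.2.support, v ∈ (S' : Set (ClType G₀ star)) \ S := by
  rw [mem_indexSet] at h' h
  by_contra hcon
  push Not at hcon
  have h1 : j.1 ∈ S := by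
    by_contra h0
    exact hcon.1 ⟨h'.1, h0⟩
  refine h ⟨h1, h'.2.1, fun v hv => ?_⟩
  by_contra h0
  exact hcon.2 v hv ⟨h'.2.2 v hv, h0⟩

lemma mem_indexSet_self (hG : 2 ≤ G₀.edgeSet.ncard) {S : Finset (ClType G₀ star)}
    {t : ClType G₀ star} (ht : t ∈ S) : (t, 0) ∈ indexSet S := by
  rw [mem_indexSet]
  refine ⟨ht, ⟨∅, Finset.empty_subset _, ?_⟩, by simp⟩
  ext v
  exact congrFun (sFun_empty hG) v

/-- The `finsum` runs over infinitely many pairs, but c(u,t,h) ≠ 0 forces h = s_H for some H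
contained in the chosen cluster, so its terms vanish outside the finite index set. -/
lemma sysR_coefK (hG : 2 ≤ G₀.edgeSet.ncard) {κ : ℝ} {S : Finset (ClType G₀ star)}
    (hS : (S : Set (ClType G₀ star)) = SmallTypes G₀ star κ) (γ : ClType G₀ star → Series G₀ star)
    {t : ClType G₀ star} (ht : t ∈ S) :
    sysR (indexSet S) coefK γ (fun v => (γ v)⁻¹) t = (cSer t t 0 - 1) * γ t +
      ∑ᶠ uh ∈ {uh : ClType G₀ star × (ClType G₀ star → ℕ) |
          uh.1 ∈ SmallTypes G₀ star κ ∧ uh.2 ∈ Fun G₀ star κ ∧ uh ≠ (t, 0)},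
        ratioSer uh.1 t * cSer uh.1 t uh.2 * γ uh.1 *
          ∏ᶠ v : ClType G₀ star, (varG v * (γ v)⁻¹) ^ uh.2 v := by
  classical
  have hmemS : ∀ v, v ∈ SmallTypes G₀ star κ ↔ v ∈ S := fun v => by rw [← hS]; rfl
  let ι : ClType G₀ star × (ClType G₀ star →₀ ℕ) → ClType G₀ star × (ClType G₀ star → ℕ) :=
    fun j => (j.1, j.2)
  have hι : Function.Injective ι := fun j j' h =>
    Prod.ext (congrArg Prod.fst h :) (DFunLike.coe_injective (congrArg Prod.snd h :))
  rw [sysR, ← Finset.add_sum_erase _ _ (mem_indexSet_self hG ht)]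
  congr 1
  · simp [coefK]
  rw [finsum_mem_eq_sum_of_inter_support_eq (t := ((indexSet S).erase (t, 0)).image ι),
    Finset.sum_image hι.injOn]
  · refine Finset.sum_congr rfl fun j hj => ?_
    rw [coefK, if_neg (Finset.mem_erase.1 hj).1, finprod_eq_prod_of_mulSupport_subset
      (s := j.2.support)]
    · simp_rw [ι, mul_pow]
      rw [Finset.prod_mul_distrib, prod_varG]
      ring
    · intro v hv
      by_contra h0
      apply hv
      have : j.2 v = 0 := by simpa using h0
      simp [ι, this]
  · ext x
    simp only [Set.mem_inter_iff, Function.mem_support]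
    refine and_congr_left fun hx => ?_
    constructor
    · rintro ⟨h1, h2, h3⟩
      have hc := right_ne_zero_of_mul (left_ne_zero_of_mul (left_ne_zero_of_mul hx))
      obtain ⟨Q, H, _, _, hH, _, hs⟩ := cSer_ne_zero hc
      have hιj : ι (x.1, sFinsupp H) = x := Prod.ext rfl hs
      rw [Finset.mem_coe, Finset.mem_image]
      refine ⟨(x.1, sFinsupp H), Finset.mem_erase.2 ⟨?_, ?_⟩, hιj⟩
      · intro h0
        apply h3
        rw [← hιj, h0]
        rfl
      · rw [mem_indexSet]
        refine ⟨(hmemS _).1 h1, ⟨H, hH, rfl⟩, fun v hv => ?_⟩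
        by_contra h0
        rw [Finsupp.mem_support_iff] at hv
        apply hv
        change sFun H v = 0
        rw [hs]
        exact h2 v fun h => h0 ((hmemS v).1 h)
    · intro hx'
      rw [Finset.mem_coe, Finset.mem_image] at hx'
      obtain ⟨j, hj, rfl⟩ := hx'
      obtain ⟨hj1, hj2⟩ := Finset.mem_erase.1 hj
      rw [mem_indexSet] at hj2
      refine ⟨(hmemS _).2 hj2.1, fun v hv => ?_, fun h0 => hj1 (hι (h0.trans rfl))⟩
      by_contra h0
      exact hv ((hmemS v).2 (hj2.2.2 v (Finsupp.mem_support_iff.2 h0)))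

lemma isGammaBar_iff (hG : 2 ≤ G₀.edgeSet.ncard) {κ : ℝ} {S : Finset (ClType G₀ star)}
    (hS : (S : Set (ClType G₀ star)) = SmallTypes G₀ star κ)
    (γ : ClType G₀ star → Series G₀ star) :
    IsGammaBar G₀ star κ γ ↔ ∀ t ∈ S, MvPowerSeries.constantCoeff (γ t) = 1 ∧
      γ t = 1 - sysR (indexSet S) coefK γ (fun v => (γ v)⁻¹) t := by
  rw [IsGammaBar, ← hS]
  refine forall₂_congr fun t ht => and_congr_right fun _ => ?_
  rw [sysR_coefK hG hS γ ht]
  rw [hS]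
  have hc : MvPowerSeries.constantCoeff (cSer t t 0) ≠ 0 := by
    rw [constantCoeff_cSer hG]; exact one_ne_zero
  rw [mul_comm, MvPowerSeries.eq_mul_inv_iff_mul_eq hc, eq_sub_iff_add_eq, eq_sub_iff_add_eq]
  constructor <;> intro h
  · linear_combination h
  · linear_combination h

lemma IsSol.isGammaBar [Finite V] (hG : 2 ≤ G₀.edgeSet.ncard) {κ : ℝ}
    {S : Finset (ClType G₀ star)} (hS : (S : Set (ClType G₀ star)) = SmallTypes G₀ star κ)
    {γ δ : ClType G₀ star → Series G₀ star} (h : IsSol Set.univ (indexSet S) coefK γ δ) :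
    IsGammaBar G₀ star κ γ := by
  have hone : ∀ t, MvPowerSeries.constantCoeff (γ t) = 1 := by
    intro t
    rw [h.gamma t trivial, map_sub, map_one, sub_eq_self,
      ← MvPowerSeries.coeff_zero_eq_constantCoeff_apply]
    by_contra h0
    have := sysR_degGE (fun t j _ => (admissible_coefK hG).deg t j) t 0 h0
    simp [mem_degGE] at this
  -- The second equation reads (1 - R) δ = 1, and 1 - R = γ.
  have hinv : δ = fun v => (γ v)⁻¹ := by
    funext v
    rw [MvPowerSeries.eq_inv_iff_mul_eq_one (by rw [hone]; exact one_ne_zero),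
      h.gamma v trivial, mul_sub, mul_one, mul_comm, sub_eq_iff_eq_add]
    exact h.delta v trivial
  rw [isGammaBar_iff hG hS]
  intro t _
  rw [← hinv]
  exact ⟨hone t, h.gamma t trivial⟩

lemma isSol_gammaBar [Finite V] (hG : 2 ≤ G₀.edgeSet.ncard) {κ : ℝ}
    {S : Finset (ClType G₀ star)} (hS : (S : Set (ClType G₀ star)) = SmallTypes G₀ star κ) :
    IsSol (S : Set (ClType G₀ star)) (indexSet S) coefK (gammaBar G₀ star κ)
      (fun v => (gammaBar G₀ star κ v)⁻¹) := by
  obtain ⟨γ, δ, h⟩ := exists_isSol (J := indexSet S)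
    (fun t j _ => (admissible_coefK (star := star) hG).deg t j)
  have h1 : IsGammaBar G₀ star κ (gammaBar G₀ star κ) :=
    Classical.epsilon_spec (p := IsGammaBar G₀ star κ) ⟨γ, h.isGammaBar hG hS⟩
  rw [isGammaBar_iff hG hS] at h1
  refine ⟨fun t ht => (h1 t ht).2, fun t ht => ?_⟩
  have h2 := MvPowerSeries.mul_inv_cancel (gammaBar G₀ star κ t)
    (by rw [(h1 t ht).1]; exact one_ne_zero)
  have h3 : sysR (indexSet S) coefK (gammaBar G₀ star κ) (fun v => (gammaBar G₀ star κ v)⁻¹) t =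
      1 - gammaBar G₀ star κ t := by
    rw [eq_sub_iff_add_eq, add_comm, ← eq_sub_iff_add_eq]
    exact (h1 t ht).2
  rw [h3, sub_mul, h2, one_mul]
  ring

end GammaBar

/-! ### The series `ξ` -/

section Xi
variable {V : Type*} {G₀ : SimpleGraph V} {star : Bool}

/-- ξ is the coefficientwise limit of the solutions for growing finite sets of types. At a monomial
`m` the types with at most `m (Sum.inl 1) + mu t` edges determine the coefficient; any other type
could only influence monomials of larger p-degree. -/
lemma exists_xi [Finite V] (hG : 2 ≤ G₀.edgeSet.ncard) (star : Bool) :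
    ∃ ξ : ClType G₀ star → Series G₀ star,
      (∀ t, SuppIn ((expMonoid (extMonoid G₀) mu : AddSubmonoid (Idx G₀ star →₀ ℕ)) : Set (Idx G₀ star →₀ ℕ)) (ξ t)) ∧
      ∀ (S : Finset (ClType G₀ star)) (γ δ : ClType G₀ star → Series G₀ star),
        IsSol (S : Set (ClType G₀ star)) (indexSet S) coefK γ δ → ∀ t ∈ S, ∀ m,
          MvPowerSeries.coeff m (ξ t) - MvPowerSeries.coeff m (γ t) ≠ 0 →
          m ∈ devSet (extMonoid G₀) nu mu {u | u ∉ S ∧ mu u ≤ m (Sum.inl 1) + mu t} t := by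
  classical
  have hK := admissible_coefK (star := star) hG
  have hE := one_mem_extMonoid hG
  have hex : ∀ S : Finset (ClType G₀ star), ∃ γ δ : ClType G₀ star → Series G₀ star,
      IsSol (S : Set (ClType G₀ star)) (indexSet S) coefK γ δ := by
    intro S
    obtain ⟨γ, δ, h⟩ := exists_isSol (J := indexSet S) (fun t j _ => hK.deg t j)
    exact ⟨γ, δ, fun t _ => h.gamma t trivial, fun t _ => h.delta t trivial⟩
  choose γ δ hsol using hex
  have hmem : ∀ (S : Finset (ClType G₀ star)) γ δ,
      IsSol (S : Set (ClType G₀ star)) (indexSet S) coefK γ δ → ∀ t ∈ S,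
      SuppIn ((expMonoid (extMonoid G₀) mu : AddSubmonoid (Idx G₀ star →₀ ℕ)) : Set (Idx G₀ star →₀ ℕ)) (γ t) := fun S γ δ h t ht =>
    (h.suppIn (indexIn_indexSet S) (fun t j _ => hK.deg t j) (fun t j _ => hK.mem t j) ht).1
  have hcmp : ∀ (S S' : Finset (ClType G₀ star)), S ⊆ S' → ∀ γ δ γ' δ',
      IsSol (S : Set (ClType G₀ star)) (indexSet S) coefK γ δ →
      IsSol (S' : Set (ClType G₀ star)) (indexSet S') coefK γ' δ' → ∀ t ∈ S,
      SuppIn (devSet (extMonoid G₀) nu mu ((S' : Set (ClType G₀ star)) \ S) t) (γ' t - γ t) := by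
    intro S S' hSS' γ δ γ' δ' h h' t ht
    exact h.suppIn_sub hK hE (Finset.coe_subset.2 hSS') (indexIn_indexSet S) (indexIn_indexSet S')
      (indexSet_mono hSS') (fun j hj hj' => of_mem_indexSet_of_notMem hj hj') h' ht
  let lev : ℕ → Finset (ClType G₀ star) := fun L => (finite_mu_le G₀ star L).toFinset
  have hlev : ∀ L u, u ∈ lev L ↔ mu u ≤ L := fun L u => by simp [lev]
  let ξ : ClType G₀ star → Series G₀ star := fun t m =>
    MvPowerSeries.coeff m (γ (lev (m (Sum.inl 1) + mu t)) t)
  have hξ : ∀ t m, MvPowerSeries.coeff m (ξ t) =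
    MvPowerSeries.coeff m (γ (lev (m (Sum.inl 1) + mu t)) t) := fun _ _ => rfl
  have htlev : ∀ t k, t ∈ lev (k + mu t) := fun t k => by rw [hlev]; omega
  refine ⟨ξ, ?_, ?_⟩
  · intro t m hm
    rw [hξ] at hm
    exact hmem _ _ _ (hsol _) t (htlev _ _) m hm
  · intro S γ₀ δ₀ h₀ t ht m hm
    set L := m (Sum.inl 1) + mu t with hL
    -- A deviation needs a type `u` with more than `L` edges. If g_u occurs, the weight condition
    -- gives μ(u) ≤ p-degree; otherwise μ(u) ≤ μ(u) + e.2 = `L`. Both are impossible.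
    have hst : MvPowerSeries.coeff m (γ (S ∪ lev L) t) = MvPowerSeries.coeff m (γ (lev L) t) := by
      by_contra hne
      have h1 := hcmp (lev L) (S ∪ lev L) Finset.subset_union_right _ _ _ _ (hsol _) (hsol _) t
        (htlev _ _)
      have h2 : SuppIn ((expMonoid (extMonoid G₀) mu : AddSubmonoid (Idx G₀ star →₀ ℕ)) : Set (Idx G₀ star →₀ ℕ)) (γ (S ∪ lev L) t - γ (lev L) t) :=
        (hmem _ _ _ (hsol _) t (Finset.mem_union_right _ (htlev _ _))).sub
          (hmem _ _ _ (hsol _) t (htlev _ _))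
      have hne' : MvPowerSeries.coeff m (γ (S ∪ lev L) t - γ (lev L) t) ≠ 0 := by
        rw [map_sub]; exact sub_ne_zero.2 hne
      have h3 : m ∈ expMonoid (extMonoid G₀) mu := h2 m hne'
      rcases h1 m hne' with ⟨u, hu, h⟩ | ⟨u, hu, e, _, _, h⟩
      · have h4 := (Finsupp.le_weight_of_ne_zero' (Sum.elim (fun _ => 0) mu) h).trans h3.2
        have h5 : ¬ mu u ≤ L := fun h0 => hu.2 ((hlev L u).2 h0)
        simp only [Sum.elim_inr] at h4
        omega
      · have h5 : ¬ mu u ≤ L := fun h0 => hu.2 ((hlev L u).2 h0)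
        omega
    rw [hξ, ← hst, ← map_sub] at hm
    have h1 := hcmp S (S ∪ lev L) Finset.subset_union_left _ _ _ _ h₀ (hsol _) t ht m hm
    have hU : ∀ u, u ∈ ((S ∪ lev L : Finset _) : Set (ClType G₀ star)) \ S →
        u ∉ S ∧ mu u ≤ L := by
      rintro u ⟨hu, hu'⟩
      refine ⟨hu', ?_⟩
      rcases Finset.mem_union.1 hu with h | h
      · exact absurd h hu'
      · exact (hlev L u).1 h
    rcases h1 with ⟨u, hu, h⟩ | ⟨u, hu, e, he, h⟩
    · exact Or.inl ⟨u, hU u hu, h⟩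
    · exact Or.inr ⟨u, hU u hu, e, he, h⟩

/-- The p-degree controls everything else: the n-degree through χ, and both the types and the
multiplicities of the g_v through the weight condition, as μ(v) ≥ 1. -/
lemma finite_expMonoid_lt [Finite V] (hG : 2 ≤ G₀.edgeSet.ncard) (star : Bool) (N : ℕ) :
    {m : Idx G₀ star →₀ ℕ | m ∈ expMonoid (extMonoid G₀) mu ∧ m (Sum.inl 1) < N}.Finite := by
  classical
  set s : Finset (Idx G₀ star) := Finset.univ.disjSum (finite_mu_le G₀ star N).toFinset with hs
  set b : ℕ := ⌈chi G₀ * N⌉₊ + N with hb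
  refine (Set.finite_Iic (∑ i ∈ s, Finsupp.single i b)).subset ?_
  rintro m ⟨⟨h1, h2⟩, h3⟩ i
  rw [Finsupp.finsetSum_apply]
  by_cases hi : m i = 0
  · rw [hi]; exact Nat.zero_le _
  have hw : ∀ v, m (Sum.inr v) ≠ 0 → mu v ≤ N ∧ m (Sum.inr v) ≤ N := by
    intro v hv
    refine ⟨?_, ?_⟩
    · have := (Finsupp.le_weight_of_ne_zero' (Sum.elim (fun _ => 0) mu) hv).trans h2
      simp only [Sum.elim_inr] at this
      omega
    · have := (Finsupp.le_weight (Sum.elim (fun _ => 0) mu) (s := Sum.inr v)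
        (by simpa using (mu_pos hG v).ne') m).trans h2
      omega
  have his : i ∈ s ∧ m i ≤ b := by
    rcases i with i | v
    · refine ⟨by simp [hs], ?_⟩
      have h4 : m (Sum.inl 0) ≤ ⌈chi G₀ * N⌉₊ := by
        have h5 : (m (Sum.inl 0) : ℝ) ≤ chi G₀ * N := (fst_le_chi_mul h1).trans
          (mul_le_mul_of_nonneg_left (by exact_mod_cast h3.le) (chi_nonneg hG))
        exact_mod_cast h5.trans (Nat.le_ceil _)
      fin_cases i
      · change m (Sum.inl 0) ≤ b; omega
      · change m (Sum.inl 1) ≤ b; omega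
    · refine ⟨by simpa [hs] using (hw v hi).1, ?_⟩
      have := (hw v hi).2
      omega
  rw [Finset.sum_eq_single_of_mem i his.1 fun j _ hj => by simp [hj]]
  simpa using his.2

end Xi

/-! ### Estimates for the monomials -/

section Monomials
variable {V : Type*} {G₀ : SimpleGraph V} {star : Bool}

lemma pow_mul_pow_le_of_mem [Finite V] {n : ℕ} (hn : 1 ≤ n) {p : ℝ} (hp : 0 < p) {e : ℕ × ℕ}
    (he : e ∈ extMonoid G₀) :
    (n : ℝ) ^ e.1 * p ^ e.2 ≤ ((n : ℝ) ^ chi G₀ * p) ^ e.2 := by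
  have hn' : (1 : ℝ) ≤ n := by exact_mod_cast hn
  rw [mul_pow]
  gcongr
  rw [← Real.rpow_natCast, ← Real.rpow_natCast, ← Real.rpow_mul (by linarith)]
  exact Real.rpow_le_rpow_of_exponent_le hn' (fst_le_chi_mul he)

lemma pow_mul_pow_le_one_of_mem [Finite V] {n : ℕ} (hn : 1 ≤ n) {p : ℝ} (hp : 0 < p)
    (hq : (n : ℝ) ^ chi G₀ * p ≤ 1) {e : ℕ × ℕ} (he : e ∈ extMonoid G₀) :
    (n : ℝ) ^ e.1 * p ^ e.2 ≤ 1 :=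
  (pow_mul_pow_le_of_mem hn hp he).trans (pow_le_one₀ (by positivity) hq)

/-- One generator gives a factor at most x, and the remaining ones give a factor at most 1. -/
lemma pow_mul_pow_le_extVal [Finite V] {n : ℕ} (hn : 1 ≤ n) {p : ℝ} (hp : 0 < p)
    (hq : (n : ℝ) ^ chi G₀ * p ≤ 1) {e : ℕ × ℕ} (he : e ∈ extMonoid G₀) (h0 : e ≠ 0) :
    (n : ℝ) ^ e.1 * p ^ e.2 ≤ extVal G₀ n p := by
  have hn' : (1 : ℝ) ≤ n := by exact_mod_cast hn
  have key : e = 0 ∨ (n : ℝ) ^ e.1 * p ^ e.2 ≤ extVal G₀ n p := by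
    clear h0
    induction he using AddSubmonoid.closure_induction with
    | mem e he =>
      obtain ⟨G₁, h1, h2, h3⟩ := he
      right
      refine le_trans ?_ (le_ciSup (f := fun G₁ : ProperSub G₀ =>
        (n : ℝ) ^ (subNu (⊤ : G₀.Subgraph) - subNu G₁.1) *
        p ^ (subMu (⊤ : G₀.Subgraph) - subMu G₁.1)) (Set.finite_range _).bddAbove G₁)
      rw [h3]
      gcongr
    | zero => exact Or.inl rfl
    | add x y hx hy ihx ihy =>
      rcases ihx with rfl | ihx
      · simpa using ihy
      · right
        refine le_trans (le_of_eq ?_) ((mul_le_of_le_one_right (by positivity)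
          (pow_mul_pow_le_one_of_mem hn hp hq hy)).trans ihx)
        rw [Prod.fst_add, Prod.snd_add, pow_add, pow_add]
        ring
  exact key.resolve_left h0

lemma point_prod (n : ℕ) (p : ℝ) (f : ClType G₀ star → ℕ) (m : Idx G₀ star →₀ ℕ)
    (s : Finset (ClType G₀ star)) (hs : ∀ v, m (Sum.inr v) ≠ 0 → v ∈ s) :
    (m.prod fun v k => point n p f v ^ k) = (n : ℝ) ^ m (Sum.inl 0) * p ^ m (Sum.inl 1) *
      ∏ v ∈ s, ((f v : ℝ) / lam n p v) ^ m (Sum.inr v) := by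
  rw [Finsupp.prod_of_support_subset m (s := Finset.univ.disjSum s), Finset.prod_disjSum,
    Fin.prod_univ_two]
  · rfl
  · rintro (i | v) hi
    · simp
    · simpa using hs v (by simpa using hi)
  · simp

/-- The number of factors g_v in the monomial, with multiplicity, is at most its p-degree because
μ(v) ≥ 1. -/
lemma abs_point_prod_le (hG : 2 ≤ G₀.edgeSet.ncard) {E : AddSubmonoid (ℕ × ℕ)} {n : ℕ} {p L : ℝ}
    (hp : 0 < p) (hL : 1 ≤ L) {f : ClType G₀ star → ℕ} (hf : ∀ v, |(f v : ℝ) / lam n p v| ≤ L)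
    {m : Idx G₀ star →₀ ℕ} (hm : m ∈ expMonoid E mu) :
    |m.prod fun v k => point n p f v ^ k| ≤
      (n : ℝ) ^ m (Sum.inl 0) * p ^ m (Sum.inl 1) * L ^ m (Sum.inl 1) := by
  classical
  set s : Finset (ClType G₀ star) := (m.comapDomain Sum.inr Sum.inr_injective.injOn).support
  have hs : ∀ v, m (Sum.inr v) ≠ 0 → v ∈ s := fun v hv => by simpa [s] using hv
  rw [point_prod n p f m s hs, abs_mul, abs_of_nonneg (a := (n : ℝ) ^ m (Sum.inl 0) * _)
    (by positivity), Finset.abs_prod]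
  gcongr
  calc ∏ v ∈ s, |((f v : ℝ) / lam n p v) ^ m (Sum.inr v)|
      ≤ ∏ v ∈ s, L ^ m (Sum.inr v) := by
        refine Finset.prod_le_prod (fun _ _ => abs_nonneg _) fun v _ => ?_
        rw [abs_pow]
        exact pow_le_pow_left₀ (abs_nonneg _) (hf v) _
    _ = L ^ ∑ v ∈ s, m (Sum.inr v) := Finset.prod_pow_eq_pow_sum _ _ _
    _ ≤ L ^ m (Sum.inl 1) := by
        refine pow_le_pow_right₀ hL (le_trans ?_ hm.2)
        rw [weight_eq_sum mu m s hs]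
        exact Finset.sum_le_sum fun v _ => Nat.le_mul_of_pos_right _ (mu_pos hG v)

end Monomials

/-! ### Values of power series -/

section Values
variable {σ : Type*}

lemma eval_truncate (A : Finset (σ →₀ ℕ)) (φ : MvPowerSeries σ ℝ) (a : σ → ℝ) :
    MvPolynomial.eval a (truncate A φ) = ∑ m ∈ A, termValue φ a m := by
  rw [truncate, map_sum]
  exact Finset.sum_congr rfl fun m _ => MvPolynomial.eval_monomial

/-- Convergence and the tail of a power series, when the values of its monomials are at most
`q ^ (m i)` with `q` not larger than a radius of convergence. -/
lemma summable_termValue_and_tail (i : σ) {φ : MvPowerSeries σ ℝ} {r q : ℝ} (hr : 0 < r)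
    (hq : 0 ≤ q) (hqr : q ≤ r) (hφ : wnorm i (ENNReal.ofReal r) φ ≤ 2) {a : σ → ℝ}
    (ha : ∀ m, MvPowerSeries.coeff m φ ≠ 0 → |m.prod fun v k => a v ^ k| ≤ q ^ m i)
    (A : Finset (σ →₀ ℕ)) {N : ℕ} (hA : ∀ m, MvPowerSeries.coeff m φ ≠ 0 → m ∉ A → N ≤ m i) :
    Summable (termValue φ a) ∧
      |∑ m ∈ A, termValue φ a m - ∑' m, termValue φ a m| ≤ 2 * (q / r) ^ N := by
  have hterm : ∀ m, |termValue φ a m| ≤ |MvPowerSeries.coeff m φ| * q ^ m i := by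
    intro m
    rw [termValue, abs_mul]
    by_cases h0 : MvPowerSeries.coeff m φ = 0
    · simp [h0]
    · exact mul_le_mul_of_nonneg_left (ha m h0) (abs_nonneg _)
  set F : (σ →₀ ℕ) → ENNReal := fun m => ‖MvPowerSeries.coeff m φ‖ₑ * ENNReal.ofReal r ^ m i
  have hF : ∑' m, F m ≠ ⊤ := (hφ.trans_lt (by simp)).ne
  have hFr : ∀ m, (F m).toReal = |MvPowerSeries.coeff m φ| * r ^ m i := fun m => by
    simp [F, ENNReal.toReal_mul, ENNReal.toReal_pow, hr.le]
  have hsum : Summable fun m => |MvPowerSeries.coeff m φ| * r ^ m i := by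
    simpa only [hFr] using ENNReal.summable_toReal hF
  have htsum : ∑' m, |MvPowerSeries.coeff m φ| * r ^ m i ≤ 2 := by
    simp_rw [← hFr]
    rw [← ENNReal.tsum_toReal_eq fun m => ENNReal.ne_top_of_tsum_ne_top hF m]
    exact ENNReal.toReal_le_of_le_ofReal (by norm_num) (hφ.trans (by simp))
  have hs : Summable (termValue φ a) := by
    refine Summable.of_norm_bounded hsum fun m => (hterm m).trans ?_
    gcongr
  refine ⟨hs, ?_⟩
  rw [← hs.sum_add_tsum_subtype_compl A, sub_add_cancel_left, abs_neg]
  have hb : ∀ m : {m // m ∉ A}, ‖termValue φ a m‖ ≤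
      (|MvPowerSeries.coeff m.1 φ| * r ^ m.1 i) * (q / r) ^ N := by
    rintro ⟨m, hm⟩
    refine (hterm m).trans ?_
    by_cases h0 : MvPowerSeries.coeff m φ = 0
    · simp [h0]
    · have h1 : q ^ m i = r ^ m i * (q / r) ^ m i := by
        rw [← mul_pow, mul_div_cancel₀ _ hr.ne']
      rw [h1, mul_assoc]
      have h2 : (q / r) ^ m i ≤ (q / r) ^ N :=
        pow_le_pow_of_le_one (by positivity) ((div_le_one hr).2 hqr) (hA m h0 hm)
      gcongr
  have hsub : Summable fun m : {m // m ∉ A} => |MvPowerSeries.coeff m.1 φ| * r ^ m.1 i :=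
    hsum.comp_injective Subtype.val_injective
  refine (tsum_of_norm_bounded (hsub.mul_right _).hasSum hb).trans ?_
  rw [tsum_mul_right]
  refine mul_le_mul_of_nonneg_right (le_trans ?_ htsum) (by positivity)
  exact hsum.tsum_subtype_le _ {m | m ∉ A} (fun m => by positivity)

end Values

/-! ### Asymptotics -/

section Asymptotics

lemma eventually_mul_log_pow_le (D : ℝ) (N : ℕ) {η : ℝ} (hη : 0 < η) :
    ∀ᶠ n : ℕ in atTop, D * Real.log n ^ N ≤ (n : ℝ) ^ η := by
  have h1 := ((isLittleO_log_rpow_rpow_atTop (N : ℝ) hη).comp_tendsto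
    tendsto_natCast_atTop_atTop).bound (c := (|D| + 1)⁻¹) (by positivity)
  filter_upwards [h1, eventually_ge_atTop 1] with n hn hn1
  have hn1' : (1 : ℝ) ≤ n := by exact_mod_cast hn1
  simp only [Function.comp_apply, Real.rpow_natCast, Real.norm_eq_abs] at hn
  rw [abs_of_nonneg (pow_nonneg (Real.log_nonneg hn1') N),
    abs_of_nonneg (a := (n : ℝ) ^ η) (by positivity),
    ← div_eq_inv_mul, le_div_iff₀ (by positivity)] at hn
  have h2 : 0 ≤ Real.log n ^ N := pow_nonneg (Real.log_nonneg hn1') N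
  nlinarith [le_abs_self D]

lemma PKappa.eventually_pow_mul_pow_le {κ : ℝ} {p : ℕ → ℝ} (hp : PKappa κ p) (a k : ℕ) {θ : ℝ}
    (hθ : 0 < θ) :
    ∀ᶠ n : ℕ in atTop, (n : ℝ) ^ a * p n ^ k ≤ (n : ℝ) ^ ((a : ℝ) - κ * k + θ) := by
  obtain ⟨δ, hδ, hpδ⟩ := hp
  have h1 : Tendsto (fun n => δ n * k) atTop (𝓝 0) := by simpa using hδ.mul_const (k : ℝ)
  filter_upwards [hpδ, h1.eventually (eventually_le_nhds hθ), eventually_ge_atTop 1]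
    with n hn hn' hn1
  have hn1' : (1 : ℝ) ≤ n := by exact_mod_cast hn1
  rw [hn, ← Real.rpow_natCast, ← Real.rpow_natCast _ k, ← Real.rpow_mul (by linarith),
    ← Real.rpow_add (by linarith)]
  refine Real.rpow_le_rpow_of_exponent_le hn1' ?_
  linarith

/-- Of the margin ε in the exponent, ε/4 pays for the o(1), ε/4 for the logarithm, and ε/2 is left.
The bound log n ≥ 3 makes λ_t log n dominate 3 λ_t, so one bound serves both cases of `mBound`. -/
lemma PKappa.eventually_small {κ χ ε : ℝ} (hχ : 0 ≤ χ) (hε : 0 < ε) (hκ : χ + ε ≤ κ) {p : ℕ → ℝ}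
    (hp : PKappa κ p) :
    ∀ᶠ n : ℕ in atTop, 1 ≤ n ∧ 0 < p n ∧ p n ≤ 1 ∧ 3 ≤ Real.log n ∧
      (n : ℝ) ^ χ * p n * Real.log n ≤ (n : ℝ) ^ (-(ε / 2)) := by
  obtain ⟨δ, hδ, hpδ⟩ := hp
  have hlog : ∀ᶠ n : ℕ in atTop, 3 ≤ Real.log n :=
    (Real.tendsto_log_atTop.comp tendsto_natCast_atTop_atTop).eventually_ge_atTop 3
  filter_upwards [hpδ, hδ.eventually (eventually_le_nhds (show (0 : ℝ) < ε / 4 by positivity)),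
    eventually_ge_atTop 1, hlog, eventually_mul_log_pow_le 1 1 (show (0 : ℝ) < ε / 4 by positivity)]
    with n hn hδn hn1 hlogn hlog'
  have hn1' : (1 : ℝ) ≤ n := by exact_mod_cast hn1
  refine ⟨hn1, ?_, ?_, hlogn, ?_⟩
  · rw [hn]; positivity
  · rw [hn]
    exact Real.rpow_le_one_of_one_le_of_nonpos hn1' (by linarith)
  · rw [pow_one, one_mul] at hlog'
    calc (n : ℝ) ^ χ * p n * Real.log n
        ≤ (n : ℝ) ^ χ * p n * (n : ℝ) ^ (ε / 4) := by
          gcongr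
          rw [hn]; positivity
      _ = (n : ℝ) ^ (χ + (-κ + δ n) + ε / 4) := by
          rw [hn, ← Real.rpow_add (by linarith), ← Real.rpow_add (by linarith)]
      _ ≤ (n : ℝ) ^ (-(ε / 2)) := Real.rpow_le_rpow_of_exponent_le hn1' (by linarith)

end Asymptotics

/-! ### Comparison of λ_t with n^ν(t) p^μ(t), and the error estimate -/

section Main
variable {V : Type*} {G₀ : SimpleGraph V} {star : Bool}

lemma lam_le (n : ℕ) {p : ℝ} (hp : 0 ≤ p) (t : ClType G₀ star) :
    lam n p t ≤ (n : ℝ) ^ nu t * p ^ mu t := by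
  refine mul_le_mul_of_nonneg_right ?_ (by positivity)
  exact_mod_cast numType_le n t

lemma lam_pos {n : ℕ} {p : ℝ} (hp : 0 < p) {t : ClType G₀ star} (hn : nu t ≤ n) :
    0 < lam n p t := by
  refine mul_pos ?_ (by positivity)
  exact_mod_cast (Nat.choose_pos hn).trans_le (choose_le_numType n t)

lemma pow_mul_pow_le_lam {n : ℕ} {p : ℝ} (hp : 0 ≤ p) {t : ClType G₀ star} (hn : 2 * nu t ≤ n) :
    (n : ℝ) ^ nu t * p ^ mu t ≤ (2 ^ nu t * (nu t).factorial : ℕ) * lam n p t := by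
  rw [lam, ← mul_assoc]
  refine mul_le_mul_of_nonneg_right ?_ (by positivity)
  have h1 : n ^ nu t ≤ 2 ^ nu t * (nu t).factorial * numType n t := by
    calc n ^ nu t ≤ (2 * (n + 1 - nu t)) ^ nu t := Nat.pow_le_pow_left (by omega) _
      _ = 2 ^ nu t * (n + 1 - nu t) ^ nu t := mul_pow _ _ _
      _ ≤ 2 ^ nu t * ((nu t).factorial * n.choose (nu t)) := by
          refine Nat.mul_le_mul_left _ ?_
          have := Nat.pow_le_choose (α := ℚ) (nu t) n
          rw [div_le_iff₀' (by positivity)] at this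
          exact_mod_cast this
      _ ≤ 2 ^ nu t * (nu t).factorial * numType n t := by
          rw [mul_assoc]
          exact Nat.mul_le_mul_left _ (Nat.mul_le_mul_left _ (choose_le_numType n t))
  exact_mod_cast h1

/-- For fixed n only finitely many types occur in K_n and the other λ_t vanish, so the supremum is
over a bounded set and is not a default value. -/
lemma lam_le_lamLarge {κ : ℝ} (n : ℕ) (p : ℝ) {u : ClType G₀ star}
    (hu : u ∉ SmallTypes G₀ star κ) : lam n p u ≤ lamLarge G₀ star κ n p := by
  refine le_ciSup (f := fun t : {t : ClType G₀ star // t ∉ SmallTypes G₀ star κ} => lam n p t.1)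
    (Set.Finite.bddAbove ?_) ⟨u, hu⟩
  refine ((((finite_clusters_omega n G₀ star).image tau).image (lam n p)).insert 0).subset ?_
  rintro _ ⟨t, rfl⟩
  by_cases h : numType n t.1 = 0
  · left
    simp [lam, h]
  · right
    obtain ⟨Q, hQ, hQt⟩ := Set.nonempty_of_ncard_ne_zero h
    exact ⟨_, ⟨Q, hQ, rfl⟩, by rw [hQt]⟩

lemma lamLarge_nonneg {κ : ℝ} (n : ℕ) {p : ℝ} (hp : 0 ≤ p) : 0 ≤ lamLarge G₀ star κ n p :=
  Real.iSup_nonneg fun _ => mul_nonneg (Nat.cast_nonneg _) (by positivity)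

/-- The degree in `p` from which on the terms of `ξ_t` are omitted. -/
noncomputable def truncDeg (ε : ℝ) (t : ClType G₀ star) : ℕ := ⌈2 * (nu t + 2) / ε⌉₊

/-- The types with at most `L` edges which are not small. -/
noncomputable def largeTypes (G₀ : SimpleGraph V) (star : Bool) (κ : ℝ) (L : ℕ) :
    Finset (ClType G₀ star) :=
  (show {u | u ∉ SmallTypes G₀ star κ ∧ mu u ≤ L}.Finite from
    (finite_mu_le G₀ star L).subset fun _ h => h.2).toFinset

lemma mem_largeTypes {κ : ℝ} {L : ℕ} {u : ClType G₀ star} :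
    u ∈ largeTypes G₀ star κ L ↔ u ∉ SmallTypes G₀ star κ ∧ mu u ≤ L := by
  simp [largeTypes]

lemma abs_point_le {κ : ℝ} {n : ℕ} {p : ℝ} (hlog : 3 ≤ Real.log n)
    (hlam : ∀ v ∈ SmallTypes G₀ star κ, 0 < lam n p v) {f : ClType G₀ star → ℕ}
    (hf : f ∈ FunS G₀ star κ n p) (v : ClType G₀ star) :
    |(f v : ℝ) / lam n p v| ≤ Real.log n := by
  by_cases hv : v ∈ SmallTypes G₀ star κ
  · have h1 := hf.2 v hv
    rw [abs_of_nonneg (div_nonneg (Nat.cast_nonneg _) (hlam v hv).le), div_le_iff₀ (hlam v hv)]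
    rw [mBound] at h1
    split_ifs at h1
    · linarith
    · have := mul_le_mul_of_nonneg_right hlog (hlam v hv).le
      linarith
  · rw [hf.1 v hv]
    simp only [Nat.cast_zero, zero_div, abs_zero]
    linarith

/-- The contribution of a monomial which occurs in `ξ_t - \bar γ_t`. -/
lemma abs_point_prod_le_of_mem_devSet [Finite V] (hG : 2 ≤ G₀.edgeSet.ncard) {κ : ℝ} {n : ℕ}
    (hn : 1 ≤ n) {p : ℝ} (hp : 0 < p) (hq : (n : ℝ) ^ chi G₀ * p ≤ 1) (hlog : 3 ≤ Real.log n)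
    (hlam : ∀ v ∈ SmallTypes G₀ star κ, 0 < lam n p v) {f : ClType G₀ star → ℕ}
    (hf : f ∈ FunS G₀ star κ n p) {t : ClType G₀ star} (ht : t ∈ SmallTypes G₀ star κ) {N : ℕ}
    {m : Idx G₀ star →₀ ℕ} (hm : m ∈ expMonoid (extMonoid G₀) mu) (hmN : m (Sum.inl 1) < N)
    (hdev : m ∈ devSet (extMonoid G₀) nu mu
      {u | u ∉ SmallTypes G₀ star κ ∧ mu u ≤ m (Sum.inl 1) + mu t} t) :
    |m.prod fun v k => point n p f v ^ k| ≤
      Real.log n ^ N * (∑ u ∈ largeTypes G₀ star κ (N + mu t), (n : ℝ) ^ nu u * p ^ mu u) /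
        lam n p t := by
  have hn' : (1 : ℝ) ≤ n := by exact_mod_cast hn
  have hlog1 : 1 ≤ Real.log n := by linarith
  rcases hdev with ⟨u, hu, h⟩ | ⟨u, hu, e, he, h1, h2⟩
  -- The monomial contains g_u for a type that is not small, and f vanishes there.
  · have h0 : (m.prod fun v k => point n p f v ^ k) = 0 := by
      refine Finset.prod_eq_zero (Finsupp.mem_support_iff.2 h) ?_
      have : point n p f (Sum.inr u) = 0 := by
        change (f u : ℝ) / lam n p u = 0
        rw [hf.1 u hu.1, Nat.cast_zero, zero_div]
      change point n p f (Sum.inr u) ^ _ = 0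
      rw [this, zero_pow h]
    rw [h0, abs_zero]
    exact div_nonneg (mul_nonneg (by positivity) (Finset.sum_nonneg fun _ _ => by positivity))
      (hlam t ht).le
  · rw [le_div_iff₀ (hlam t ht)]
    calc |m.prod fun v k => point n p f v ^ k| * lam n p t
        ≤ ((n : ℝ) ^ m (Sum.inl 0) * p ^ m (Sum.inl 1) * Real.log n ^ m (Sum.inl 1)) *
            ((n : ℝ) ^ nu t * p ^ mu t) :=
          mul_le_mul (abs_point_prod_le hG hp hlog1 (abs_point_le hlog hlam hf) hm)
            (lam_le n hp.le t) (hlam t ht).le (by positivity)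
      _ = Real.log n ^ m (Sum.inl 1) * ((n : ℝ) ^ (m (Sum.inl 0) + nu t) *
            p ^ (m (Sum.inl 1) + mu t)) := by rw [pow_add, pow_add]; ring
      _ ≤ Real.log n ^ N * ((n : ℝ) ^ (nu u + e.1) * p ^ (mu u + e.2)) := by
          rw [h2]
          gcongr
      _ = Real.log n ^ N * (((n : ℝ) ^ nu u * p ^ mu u) * ((n : ℝ) ^ e.1 * p ^ e.2)) := by
          rw [pow_add, pow_add]; ring
      _ ≤ Real.log n ^ N * ((n : ℝ) ^ nu u * p ^ mu u) := by
          refine mul_le_mul_of_nonneg_left ?_ (by positivity)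
          exact mul_le_of_le_one_right (by positivity) (pow_mul_pow_le_one_of_mem hn hp hq he)
      _ ≤ _ := by
          gcongr
          refine Finset.single_le_sum (f := fun u => (n : ℝ) ^ nu u * p ^ mu u)
            (fun _ _ => by positivity) ?_
          rw [mem_largeTypes]
          exact ⟨hu.1, hu.2.trans (by omega)⟩

/-- The difference between the truncation of `ξ_t` and `\bar γ_t`. -/
lemma exists_eventually_abs_sub_le [Finite V] (hG : 2 ≤ G₀.edgeSet.ncard)
    {ξ : ClType G₀ star → Series G₀ star}
    (hξ : ∀ (S : Finset (ClType G₀ star)) (γ δ : ClType G₀ star → Series G₀ star),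
        IsSol (S : Set (ClType G₀ star)) (indexSet S) coefK γ δ → ∀ t ∈ S, ∀ m,
          MvPowerSeries.coeff m (ξ t) - MvPowerSeries.coeff m (γ t) ≠ 0 →
          m ∈ devSet (extMonoid G₀) nu mu {u | u ∉ S ∧ mu u ≤ m (Sum.inl 1) + mu t} t)
    {ε κ : ℝ} (hε : 0 < ε) (hκ : chi G₀ + ε ≤ κ) {t : ClType G₀ star}
    (ht : t ∈ SmallTypes G₀ star κ) :
    ∃ D : ℝ, 0 ≤ D ∧ ∀ p : ℕ → ℝ, PKappa κ p → ∀ᶠ n : ℕ in atTop,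
      0 < p n ∧ 0 < lam n (p n) t ∧ ∀ f ∈ FunS G₀ star κ n (p n),
        Summable (termValue (gammaBar G₀ star κ t) (point n (p n) f)) ∧
        |MvPolynomial.eval (point n (p n) f)
            (truncate (finite_expMonoid_lt hG star (truncDeg ε t)).toFinset (ξ t)) -
          ∑' m, termValue (gammaBar G₀ star κ t) (point n (p n) f) m| ≤
        (2⁻¹ * (n : ℝ) ^ (-1 : ℝ) + D * Real.log n ^ truncDeg ε t *
          ∑ u ∈ largeTypes G₀ star κ (truncDeg ε t + mu t), (n : ℝ) ^ nu u * p n ^ mu u) /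
          lam n (p n) t := by
  have hfin := finite_smallTypes (star := star) hG (show chi G₀ < κ by linarith)
  set S := hfin.toFinset with hSdef
  have hS : (S : Set (ClType G₀ star)) = SmallTypes G₀ star κ := hfin.coe_toFinset
  have htS : t ∈ S := hfin.mem_toFinset.2 ht
  have hK := admissible_coefK (star := star) hG
  have hsol := isSol_gammaBar hG hS
  obtain ⟨r, hr, hrγ⟩ := hsol.exists_wnorm_le S.finite_toSet (indexIn_indexSet S)
    (fun t j _ => hK.deg t j) (fun t j _ => hK.fin t j)
  have hrt := hrγ t htS
  set γ := gammaBar G₀ star κ with hγ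
  have hγM := (hsol.suppIn (indexIn_indexSet S) (fun t j _ => hK.deg t j)
    (fun t j _ => hK.mem t j) htS).1
  set N := truncDeg ε t with hN
  set A := (finite_expMonoid_lt hG star N).toFinset with hA
  have hAmem : ∀ m, m ∈ A ↔ m ∈ expMonoid (extMonoid G₀) mu ∧ m (Sum.inl 1) < N := fun m => by
    simp [A]
  -- The finitely many coefficient differences depend on κ but not on p or n; in the final bounds
  -- they are absorbed by a small power of n.
  refine ⟨∑ m ∈ A, |MvPowerSeries.coeff m (ξ t) - MvPowerSeries.coeff m (γ t)|,
    Finset.sum_nonneg fun _ _ => abs_nonneg _, fun p hp => ?_⟩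
  have hlam : ∀ᶠ n : ℕ in atTop, ∀ v ∈ SmallTypes G₀ star κ, nu v ≤ n :=
    hfin.eventually_all.2 fun v _ => eventually_ge_atTop (nu v)
  have hrn : ∀ᶠ n : ℕ in atTop, (n : ℝ) ^ (-(ε / 2)) ≤ r :=
    ((tendsto_rpow_neg_atTop (show 0 < ε / 2 by positivity)).comp
      tendsto_natCast_atTop_atTop).eventually (eventually_le_nhds hr)
  have hrN : ∀ᶠ n : ℕ in atTop, 4 / r ^ N ≤ (n : ℝ) :=
    tendsto_natCast_atTop_atTop.eventually_ge_atTop _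
  filter_upwards [hp.eventually_small (chi_nonneg hG) hε hκ, hlam, hrn, hrN]
    with n ⟨hn1, hp0, hp1, hlog, hq⟩ hnu hrn hrN
  have hlam : ∀ v ∈ SmallTypes G₀ star κ, 0 < lam n (p n) v := fun v hv => lam_pos hp0 (hnu v hv)
  have hn' : (1 : ℝ) ≤ n := by exact_mod_cast hn1
  have hn0 : (0 : ℝ) < n := by linarith
  refine ⟨hp0, hlam t ht, fun f hf => ?_⟩
  have hqle : (n : ℝ) ^ chi G₀ * p n ≤ 1 := by
    have h1 : (n : ℝ) ^ (-(ε / 2)) ≤ 1 :=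
      Real.rpow_le_one_of_one_le_of_nonpos hn' (by linarith)
    have h2 : (n : ℝ) ^ chi G₀ * p n * 1 ≤ (n : ℝ) ^ chi G₀ * p n * Real.log n := by
      gcongr
      linarith
    linarith
  have hpt := abs_point_le hlog hlam hf
  obtain ⟨hsum, htail⟩ := summable_termValue_and_tail (Sum.inl 1) hr
    (q := (n : ℝ) ^ chi G₀ * p n * Real.log n) (by positivity) (hq.trans hrn) hrt
    (a := point n (p n) f) (fun m hm => by
      refine (abs_point_prod_le hG hp0 (by linarith) hpt (hγM m hm)).trans ?_
      rw [mul_pow _ (Real.log n)]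
      have := pow_mul_pow_le_of_mem hn1 hp0 (hγM m hm).1
      gcongr) A (N := N)
    (fun m hm hmA => by
      by_contra h
      exact hmA ((hAmem m).2 ⟨hγM m hm, not_le.1 h⟩))
  refine ⟨hsum, ?_⟩
  rw [eval_truncate]
  have hsplit : ∑ m ∈ A, termValue (ξ t) (point n (p n) f) m -
      ∑' m, termValue (γ t) (point n (p n) f) m =
      (∑ m ∈ A, termValue (γ t) (point n (p n) f) m -
        ∑' m, termValue (γ t) (point n (p n) f) m) +
      ∑ m ∈ A, (MvPowerSeries.coeff m (ξ t) - MvPowerSeries.coeff m (γ t)) *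
        m.prod fun v k => point n (p n) f v ^ k := by
    simp_rw [termValue, sub_mul]
    rw [Finset.sum_sub_distrib]
    ring
  rw [hsplit, add_div]
  refine (abs_add_le _ _).trans (add_le_add (htail.trans ?_) ?_)
  · rw [le_div_iff₀ (hlam t ht)]
    have h1 : lam n (p n) t ≤ (n : ℝ) ^ (nu t : ℝ) := by
      rw [Real.rpow_natCast]
      exact (lam_le n hp0.le t).trans
        (mul_le_of_le_one_right (by positivity) (pow_le_one₀ hp0.le hp1))
    -- By the choice of `truncDeg`, Nε/2 ≥ ν(t) + 2. Of this exponent ν(t) compensates λ_t ≤ n^ν(t),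
    -- one unit absorbs the constant 2/r^N, and one unit remains as n^(-1).
    have h2 : ((n : ℝ) ^ chi G₀ * p n * Real.log n) ^ N ≤ (n : ℝ) ^ (-(nu t + 2 : ℝ)) := by
      refine (pow_le_pow_left₀ (by positivity) hq N).trans ?_
      rw [← Real.rpow_natCast, ← Real.rpow_mul hn0.le]
      refine Real.rpow_le_rpow_of_exponent_le hn' ?_
      have h3 : 2 * (nu t + 2 : ℝ) / ε ≤ N := Nat.le_ceil _
      rw [div_le_iff₀ hε] at h3
      linarith
    have h4 : (n : ℝ) ^ (-(nu t + 2 : ℝ)) * (n : ℝ) ^ (nu t : ℝ) =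
        (n : ℝ) ^ (-1 : ℝ) * (n : ℝ)⁻¹ := by
      rw [← Real.rpow_neg_one (n : ℝ), ← Real.rpow_add hn0, ← Real.rpow_add hn0]
      congr 1
      ring
    have h5 : (2 / r ^ N) * (n : ℝ)⁻¹ ≤ 2⁻¹ := by
      rw [← div_eq_mul_inv, div_le_iff₀ hn0]
      have : 4 / r ^ N = 2 * (2 / r ^ N) := by ring
      linarith
    calc 2 * ((n : ℝ) ^ chi G₀ * p n * Real.log n / r) ^ N * lam n (p n) t
        = (2 / r ^ N) * (((n : ℝ) ^ chi G₀ * p n * Real.log n) ^ N * lam n (p n) t) := by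
          rw [div_pow]; ring
      _ ≤ (2 / r ^ N) * ((n : ℝ) ^ (-(nu t + 2 : ℝ)) * (n : ℝ) ^ (nu t : ℝ)) := by
          have := (hlam t ht).le
          gcongr
      _ = ((2 / r ^ N) * (n : ℝ)⁻¹) * (n : ℝ) ^ (-1 : ℝ) := by rw [h4]; ring
      _ ≤ 2⁻¹ * (n : ℝ) ^ (-1 : ℝ) := by gcongr
  · refine (Finset.abs_sum_le_sum_abs _ _).trans ?_
    rw [mul_assoc, mul_div_assoc, Finset.sum_mul]
    refine Finset.sum_le_sum fun m hm => ?_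
    rw [abs_mul]
    by_cases h0 : MvPowerSeries.coeff m (ξ t) - MvPowerSeries.coeff m (γ t) = 0
    · simp [h0]
    · refine mul_le_mul_of_nonneg_left ?_ (abs_nonneg _)
      obtain ⟨h1, h2⟩ := (hAmem m).1 hm
      refine abs_point_prod_le_of_mem_devSet hG hn1 hp0 hqle hlog hlam hf ht h1 h2 ?_
      have h3 := hξ S γ _ hsol t htS m h0
      have h4 : ∀ u, u ∉ S ↔ u ∉ SmallTypes G₀ star κ := fun u => by
        rw [← hS, Finset.mem_coe]
      simpa only [h4] using h3

end Main

end SubgraphClusters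

/-! ### The corollary -/

open SubgraphClusters
theorem corollary1 {V : Type*} [Finite V] (G₀ : SimpleGraph V)
    (hbal : StrictlyBalanced G₀) (hedges : 2 ≤ G₀.edgeSet.ncard) (star : Bool) :
    ∃ (ξ : ClType G₀ star → Series G₀ star)
      (A : ℝ → ClType G₀ star → Finset (Idx G₀ star →₀ ℕ)),
      -- (a): every finite truncation of the coefficient of `g ^ i`, `i ≠ 0`, is `O(x)`
      (∀ (t : ClType G₀ star) (i : ClType G₀ star →₀ ℕ), i ≠ 0 →
        ∀ B : Finset (Fin 2 →₀ ℕ), ∃ C : ℝ,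
          ∀ κ : ℝ, chi G₀ < κ → ∀ p : ℕ → ℝ, PKappa κ p →
            ∀ᶠ n : ℕ in atTop,
              |MvPolynomial.eval ![(n : ℝ), p n] (truncate B (gCoeff i (ξ t)))|
                ≤ C * extVal G₀ n (p n)) ∧
      -- (b): the coefficient of `g ^ i` is a multiple of the product of the `p ^ (μ(u) i_u)`
      (∀ (t : ClType G₀ star) (i : ClType G₀ star →₀ ℕ),
        (i.prod fun u k => (MvPowerSeries.X (1 : Fin 2) : MvPowerSeries (Fin 2) ℝ) ^ (mu u * k))
          ∣ gCoeff i (ξ t)) ∧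
      -- (c): the truncation of `ξ_t` approximates `\bar γ_t(f)`
      (∀ ε : ℝ, 0 < ε → ∃ C : ℝ,
        -- with an exponent which does not depend on `κ`, up to the contribution of `λ_𝓛`
        (∃ ε₁ : ℝ, 0 < ε₁ ∧
          ∀ κ : ℝ, chi G₀ + ε ≤ κ → ∀ p : ℕ → ℝ, PKappa κ p → ∀ η : ℝ, 0 < η →
            ∀ᶠ n : ℕ in atTop, ∀ t ∈ SmallTypes G₀ star κ, ∀ f ∈ FunS G₀ star κ n (p n),
              Summable (termValue (gammaBar G₀ star κ t) (point n (p n) f)) ∧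
              |MvPolynomial.eval (point n (p n) f) (truncate (A ε t) (ξ t)) -
                  ∑' m, termValue (gammaBar G₀ star κ t) (point n (p n) f) m|
                ≤ C * ((n : ℝ) ^ (-ε₁) + (n : ℝ) ^ η * lamLarge G₀ star κ n (p n)) /
                    lam n (p n) t) ∧
        -- with an error `O(n ^ (-ε₂) / λ_t)` for every fixed `κ`
        (∀ κ : ℝ, chi G₀ + ε ≤ κ → ∃ ε₂ : ℝ, 0 < ε₂ ∧
          ∀ p : ℕ → ℝ, PKappa κ p →
            ∀ᶠ n : ℕ in atTop, ∀ t ∈ SmallTypes G₀ star κ, ∀ f ∈ FunS G₀ star κ n (p n),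
              Summable (termValue (gammaBar G₀ star κ t) (point n (p n) f)) ∧
              |MvPolynomial.eval (point n (p n) f) (truncate (A ε t) (ξ t)) -
                  ∑' m, termValue (gammaBar G₀ star κ t) (point n (p n) f) m|
                ≤ C * (n : ℝ) ^ (-ε₂) / lam n (p n) t)) := by
  obtain ⟨ξ, hξM, hξ⟩ := exists_xi hedges star
  have hcoeff : ∀ (t : ClType G₀ star) (i : ClType G₀ star →₀ ℕ) (e : Fin 2 →₀ ℕ),
      MvPowerSeries.coeff e (gCoeff i (ξ t)) ≠ 0 →
      (e 0, e 1) ∈ extMonoid G₀ ∧ ∑ v ∈ i.support, i v * mu v ≤ e 1 := by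
    intro t i e he
    obtain ⟨h1, h2⟩ := hξM t (Finsupp.sumElim e i) he
    refine ⟨by simpa using h1, ?_⟩
    rw [weight_eq_sum mu _ i.support fun v hv => by simpa using hv] at h2
    simpa using h2
  refine ⟨ξ, fun ε t => (finite_expMonoid_lt hedges star (truncDeg ε t)).toFinset, ?_, ?_, ?_⟩
  · intro t i hi B
    refine ⟨∑ e ∈ B, |MvPowerSeries.coeff e (gCoeff i (ξ t))|, fun κ hκ p hp => ?_⟩
    filter_upwards [hp.eventually_small (chi_nonneg hedges) (sub_pos.2 hκ) (by linarith)]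
      with n ⟨hn1, hp0, hp1, hlog, hq⟩
    have hn' : (1 : ℝ) ≤ n := by exact_mod_cast hn1
    have hqle : (n : ℝ) ^ chi G₀ * p n ≤ 1 := by
      have h1 : (n : ℝ) ^ (-((κ - chi G₀) / 2)) ≤ 1 :=
        Real.rpow_le_one_of_one_le_of_nonpos hn' (by linarith)
      have h2 : (n : ℝ) ^ chi G₀ * p n * 1 ≤ (n : ℝ) ^ chi G₀ * p n * Real.log n := by
        gcongr
        linarith
      linarith
    rw [eval_truncate, Finset.sum_mul]
    refine (Finset.abs_sum_le_sum_abs _ _).trans (Finset.sum_le_sum fun e _ => ?_)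
    rw [termValue, abs_mul]
    by_cases h0 : MvPowerSeries.coeff e (gCoeff i (ξ t)) = 0
    · simp [h0]
    · refine mul_le_mul_of_nonneg_left ?_ (abs_nonneg _)
      obtain ⟨h1, h2⟩ := hcoeff t i e h0
      rw [Finsupp.prod_fintype _ _ (by simp), Fin.prod_univ_two]
      simp only [Matrix.cons_val_zero, Matrix.cons_val_one]
      rw [abs_of_nonneg (by positivity)]
      -- The exponent is not zero: since `i ≠ 0`, its p-part is at least some i_v μ(v) > 0.
      refine pow_mul_pow_le_extVal hn1 hp0 hqle h1 fun h3 => ?_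
      obtain ⟨v, hv⟩ := Finsupp.support_nonempty_iff.2 hi
      have h4 : 0 < i v * mu v :=
        Nat.mul_pos (Nat.pos_of_ne_zero (Finsupp.mem_support_iff.1 hv)) (mu_pos hedges v)
      have h5 := Finset.single_le_sum (f := fun v => i v * mu v) (fun _ _ => Nat.zero_le _) hv
      have h6 : e 1 = 0 := congrArg Prod.snd h3
      omega
  · intro t i
    rw [Finsupp.prod, Finset.prod_pow_eq_pow_sum, MvPowerSeries.X_pow_dvd_iff]
    intro e he
    by_contra h0
    have h1 := (hcoeff t i e h0).2
    simp_rw [mul_comm (i _)] at h1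
    omega
  · intro ε hε
    -- The tail is at most n^(-1)/(2λ_t), so ε₁ = 1 works; all constants depending on κ are absorbed
    -- by n^η, or by n^ε₂ in the second bound, so C = 1.
    refine ⟨1, ⟨1, one_pos, ?_⟩, ?_⟩
    · intro κ hκ p hp η hη
      refine (finite_smallTypes hedges (by linarith)).eventually_all.2 fun t ht => ?_
      obtain ⟨D, hD, hmain⟩ := exists_eventually_abs_sub_le hedges hξ hε hκ ht
      set U := largeTypes G₀ star κ (truncDeg ε t + mu t) with hU
      set c : ℝ := ∑ u ∈ U, ((2 ^ nu u * (nu u).factorial : ℕ) : ℝ) with hc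
      have hnu : ∀ᶠ n : ℕ in atTop, ∀ u ∈ U, 2 * nu u ≤ n :=
        (Finset.eventually_all U).2 fun u _ => eventually_ge_atTop _
      filter_upwards [hmain p hp, hnu, eventually_mul_log_pow_le (D * c) (truncDeg ε t) hη,
        eventually_ge_atTop 1] with n ⟨hp0, hlam, hn⟩ hnu hlog hn1 f hf
      have hn1' : (1 : ℝ) ≤ n := by exact_mod_cast hn1
      obtain ⟨h1, h2⟩ := hn f hf
      refine ⟨h1, h2.trans ?_⟩
      rw [one_mul]
      refine div_le_div_of_nonneg_right (add_le_add ?_ ?_) hlam.le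
      · have : (0 : ℝ) ≤ (n : ℝ) ^ (-1 : ℝ) := by positivity
        linarith
      · have h3 : ∑ u ∈ U, (n : ℝ) ^ nu u * p n ^ mu u ≤ c * lamLarge G₀ star κ n (p n) := by
          rw [hc, Finset.sum_mul]
          refine Finset.sum_le_sum fun u hu => (pow_mul_pow_le_lam hp0.le (hnu u hu)).trans ?_
          exact mul_le_mul_of_nonneg_left (lam_le_lamLarge n (p n) (mem_largeTypes.1 hu).1)
            (Nat.cast_nonneg _)
        calc D * Real.log n ^ truncDeg ε t * ∑ u ∈ U, (n : ℝ) ^ nu u * p n ^ mu u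
            ≤ D * Real.log n ^ truncDeg ε t * (c * lamLarge G₀ star κ n (p n)) := by
              have := Real.log_nonneg hn1'
              gcongr
          _ = (D * c * Real.log n ^ truncDeg ε t) * lamLarge G₀ star κ n (p n) := by ring
          _ ≤ _ := mul_le_mul_of_nonneg_right hlog (lamLarge_nonneg n hp0.le)
    · intro κ hκ
      have hfin := finite_smallTypes (star := star) hedges (show chi G₀ < κ by linarith)
      have hB : (⋃ t ∈ SmallTypes G₀ star κ,
          (largeTypes G₀ star κ (truncDeg ε t + mu t) : Set (ClType G₀ star))).Finite :=
        hfin.biUnion fun t _ => Finset.finite_toSet _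
      -- Only finitely many types `u` are involved, each with κμ(u) - ν(u) > 0. Of three equal
      -- shares of this gap, one covers the o(1) in p, one the logarithms and constants, and one
      -- remains as n^(-ε₂).
      have hx : ∀ᶠ x : ℝ in 𝓝[>] 0, ∀ u ∈ (⋃ t ∈ SmallTypes G₀ star κ,
          (largeTypes G₀ star κ (truncDeg ε t + mu t) : Set (ClType G₀ star))),
          x ≤ (κ * mu u - nu u) / 3 := by
        refine hB.eventually_all.2 fun u hu => ?_
        obtain ⟨t, ht, hu⟩ := Set.mem_iUnion₂.1 hu
        have hu' := (mem_largeTypes.1 (Finset.mem_coe.1 hu)).1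
        have hmu : (0 : ℝ) < mu u := by exact_mod_cast mu_pos hedges u
        have h1 : (nu u : ℝ) < κ * mu u := by
          rw [← div_lt_iff₀ hmu]
          exact not_le.1 hu'
        exact (eventually_le_nhds (by linarith)).filter_mono nhdsWithin_le_nhds
      obtain ⟨ε₂, hε₂B, hε₂1, hε₂⟩ := (hx.and (((eventually_le_nhds
        (show (0 : ℝ) < 1 by norm_num)).filter_mono nhdsWithin_le_nhds).and
        self_mem_nhdsWithin)).exists
      have hε₂' : 0 < ε₂ := hε₂
      refine ⟨ε₂, hε₂', fun p hp => ?_⟩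
      refine hfin.eventually_all.2 fun t ht => ?_
      obtain ⟨D, hD, hmain⟩ := exists_eventually_abs_sub_le hedges hξ hε hκ ht
      set U := largeTypes G₀ star κ (truncDeg ε t + mu t) with hU
      have hpow : ∀ᶠ n : ℕ in atTop, ∀ u ∈ U,
          (n : ℝ) ^ nu u * p n ^ mu u ≤ (n : ℝ) ^ ((nu u : ℝ) - κ * mu u + ε₂) :=
        (Finset.eventually_all U).2 fun u _ => hp.eventually_pow_mul_pow_le _ _ hε₂'
      filter_upwards [hmain p hp, hpow,
        eventually_mul_log_pow_le (2 * (D * U.card)) (truncDeg ε t) hε₂',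
        eventually_ge_atTop 1] with n ⟨hp0, hlam, hn⟩ hpow hlog hn1 f hf
      have hn1' : (1 : ℝ) ≤ n := by exact_mod_cast hn1
      obtain ⟨h1, h2⟩ := hn f hf
      refine ⟨h1, h2.trans ?_⟩
      rw [one_mul]
      refine div_le_div_of_nonneg_right ?_ hlam.le
      have h3 : (n : ℝ) ^ (-1 : ℝ) ≤ (n : ℝ) ^ (-ε₂) :=
        Real.rpow_le_rpow_of_exponent_le hn1' (by linarith)
      have h4 : ∑ u ∈ U, (n : ℝ) ^ nu u * p n ^ mu u ≤ U.card * (n : ℝ) ^ (-(2 * ε₂)) := by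
        rw [← nsmul_eq_mul]
        refine Finset.sum_le_card_nsmul _ _ _ fun u hu => (hpow u hu).trans ?_
        have := hε₂B u (Set.mem_iUnion₂.2 ⟨t, ht, hu⟩)
        exact Real.rpow_le_rpow_of_exponent_le hn1' (by linarith)
      have h5 : D * Real.log n ^ truncDeg ε t * ∑ u ∈ U, (n : ℝ) ^ nu u * p n ^ mu u ≤
          2⁻¹ * (n : ℝ) ^ (-ε₂) := by
        calc D * Real.log n ^ truncDeg ε t * ∑ u ∈ U, (n : ℝ) ^ nu u * p n ^ mu u
            ≤ D * Real.log n ^ truncDeg ε t * (U.card * (n : ℝ) ^ (-(2 * ε₂))) := by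
              have := Real.log_nonneg hn1'
              gcongr
          _ = 2⁻¹ * (2 * (D * U.card) * Real.log n ^ truncDeg ε t) * (n : ℝ) ^ (-(2 * ε₂)) := by
              ring
          _ ≤ 2⁻¹ * (n : ℝ) ^ ε₂ * (n : ℝ) ^ (-(2 * ε₂)) := by gcongr
          _ = 2⁻¹ * (n : ℝ) ^ (-ε₂) := by
              rw [mul_assoc, ← Real.rpow_add (by linarith)]
              congr 2
              ring
      linarith
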